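/- **Conventions.** Subgroups of compact Lie groups are closed; representations are finite-dimensional and orthogonal. An *orthogonal space* is a topologically enriched functor $X$ from finite-dimensional real inner product spaces and linear isometric embeddings to compactly generated weak Hausdorff spaces; orthogonal spaces are symmetric monoidal under the box product $\boxtimes$ (Day convolution along $\oplus$). A *symmetric sequence* $M=(M_n)_{n\ge 0}$ consists of orthogonal spaces $M_n$ with $\Sigma_n$-action, and an *operad* is a monoid in symmetric sequences for the composition product built from $\boxtimes$. If $V$ is a representation of a compact Lie group $G$, then $G\times\Sigma_n$ acts on $M_n(V)$. A *graph subgroup* of $G\times \Sigma_n$ is a closed subgroup $\Gamma$ with $\Gamma\cap(\{1\}\times\Sigma_n)=1$; it is *admissible* for $M$ if $M_n(V)^\Gamma\neq\emptyset$ for some $G$-representation $V$. **Global $N_\infty$-operads.** A *global $N_\infty$-operad* is an operad $\mathcal O$ in orthogonal spaces such that, for every $n\ge 0$, $\mathcal O_n(V)\neq\emptyset$ for some $V$, and for every compact Lie group $G$, every admissible graph subgroup $\Gamma\le G\times\Sigma_n$, every $G$-representation $V$, every $l\ge 0$ and every continuous $\alpha\colon\partial D^l\to\mathcal O_n(V)^\Gamma$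 there are a $G$-embedding $\psi\colon V\to W$ into a $G$-representation and a continuous $\lambda\colon D^l\to\mathcal O_n(W)^\Gamma$ with $\lambda|_{\partial D^l}=\mathcal O_n(\psi)^\Gamma\circ\alpha$. Let $N_\infty^{Lie}$ be the full subcategory of operads on these objects. An *equivalence* of global $N_\infty$-operads is a morphism $f\colon\mathcal O\to\mathcal P$ of operads such that for all $n$, $G$, all graph subgroups $\Gamma\le G\times\Sigma_n$, all $G$-representations $V$, all $l\ge 0$ and all continuous $\alpha\colon\partial D^l\to\mathcal O_n(V)^\Gamma$, $\beta\colon D^l\to\mathcal P_n(V)^\Gamma$ with $f_n(V)\circ\alpha=\beta|_{\partial D^l}$ there are a $G$-embedding $\psi\colon V\to W$ into a $G$-representation and a continuous $\lambda\colon D^l\to\mathcal O_n(W)^\Gamma$ such that $\lambda|_{\partial D^l}=\mathcal O_n(\psi)\circ\alpha$ and $f_n(W)\circ\lambda$ is homotopic to $\mathcal P_n(\psi)\circ\beta$ relative to $\partial D^l$ (as maps to $\mathcal P_n(W)^\Gamma$). Let $\mathrm{Ho}(N_\infty^{Lie})$ be the localization of $N_\infty^{Lie}$ at the equivalences. **Global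 transfer systems.** A *global transfer system* is a partial order $\le_T$ on the class of compact Lie groups such that $K\le_T H$ implies that $K$ is a closed subgroup of finite index of $H$, and such that $K\le_T H$ implies $\theta^{-1}(K)\le_T G$ for every continuous homomorphism $\theta\colon G\to H$ of compact Lie groups. Let $I_{Lie}$ be the poset of global transfer systems ordered by inclusion. For a global $N_\infty$-operad $\mathcal O$, let $T_{\mathcal O}$ be the relation with $K\le_{T_{\mathcal O}}H$ if and only if $K$ is a closed subgroup of finite index $n$ in $H$ and the graph of the homomorphism $H\to\Sigma_n$ given by the action of $H$ on $H/K$ (for some ordering of $H/K$) is admissible for $\mathcal O$. **Proposition.** The category $\mathrm{Ho}(N_\infty^{Lie})$ is thin, i.e. it has at most one morphism between any two objects. Moreover, $\mathcal O\mapsto T_{\mathcal O}$ defines a functor $N_\infty^{Lie}\to I_{Lie}$ that inverts equivalences, and the induced functor $\mathcal T\colon\mathrm{Ho}(N_\infty^{Lie})\to I_{Lie}$ is fully faithful. -/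

import Mathlib

open CategoryTheory
open scoped Manifold ContDiff

noncomputable section

namespace GlobalOperads

/-! ### Compact Lie groups -/

/-- `G` is a compact Lie group: a compact Hausdorff topological group which carries the structure
of a smooth finite-dimensional real Lie group.  (Such a structure is unique and every continuous
homomorphism between Lie groups is smooth, so nothing else has to be recorded.) -/
class IsCompactLieGroup (G : Type) [Group G] [TopologicalSpace G] : Prop where
  compactSpace : CompactSpace G
  t2Space : T2Space G
  exists_lieGroup : ∃ (d : ℕ) (_ : ChartedSpace (EuclideanSpace ℝ (Fin d)) G),
    LieGroup (𝓡 d) ∞ G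

/-! ### Global transfer systems -/

/-- A global transfer system: a relation `K ≤_T H` between compact Lie groups.  Since the relation
refines "being a closed subgroup of finite index", it is recorded as a predicate on the subgroups
`K` of each compact Lie group `H`; in this form antisymmetry holds automatically. -/
@[ext]
structure GlobalTransferSystem where
  rel : ∀ (H : Type) [Group H] [TopologicalSpace H] [IsCompactLieGroup H], Subgroup H → Prop
  isClosed : ∀ (H : Type) [Group H] [TopologicalSpace H] [IsCompactLieGroup H] (K : Subgroup H),
    rel H K → IsClosed (K : Set H)
  finiteIndex : ∀ (H : Type) [Group H] [TopologicalSpace H] [IsCompactLieGroup H]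
    (K : Subgroup H), rel H K → K.FiniteIndex
  refl : ∀ (H : Type) [Group H] [TopologicalSpace H] [IsCompactLieGroup H], rel H ⊤
  trans : ∀ (G : Type) [Group G] [TopologicalSpace G] [IsCompactLieGroup G]
    (H : Subgroup G) [IsCompactLieGroup H] (K : Subgroup H),
    rel H K → rel G H → rel G (K.map H.subtype)
  comap : ∀ (G H : Type) [Group G] [TopologicalSpace G] [IsCompactLieGroup G]
    [Group H] [TopologicalSpace H] [IsCompactLieGroup H] (θ : G →* H), Continuous θ →
    ∀ K : Subgroup H, rel H K → rel G (K.comap θ)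

/-- Global transfer systems are partially ordered by inclusion. -/
instance : PartialOrder GlobalTransferSystem where
  le T T' := ∀ (H : Type) [Group H] [TopologicalSpace H] [IsCompactLieGroup H] (K : Subgroup H),
    T.rel H K → T'.rel H K
  le_refl _ _ _ _ _ _ h := h
  le_trans _ _ _ h₁ h₂ H _ _ _ K h := h₂ H K (h₁ H K h)
  le_antisymm T T' h₁ h₂ := by
    apply GlobalTransferSystem.ext
    funext H _ _ _ K
    exact propext ⟨h₁ H K, h₂ H K⟩

/-! ### Finite-dimensional inner product spaces -/

/-- A finite-dimensional real inner product space: an object of the category `L`. -/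
structure InnSpace where
  carrier : Type
  [normedAddCommGroup : NormedAddCommGroup carrier]
  [innerProductSpace : InnerProductSpace ℝ carrier]
  [finiteDimensional : FiniteDimensional ℝ carrier]

namespace InnSpace

instance : CoeSort InnSpace Type := ⟨InnSpace.carrier⟩

attribute [instance] normedAddCommGroup innerProductSpace finiteDimensional

/-- The space `L(V, W)` of linear isometric embeddings, with its topology as a subspace of the
normed space of linear maps. -/
instance (V W : InnSpace) : TopologicalSpace (V →ₗᵢ[ℝ] W) :=
  TopologicalSpace.induced LinearIsometry.toContinuousLinearMap inferInstance

/-- The orthogonal direct sum `V ⊕ W₁ ⊕ ⋯ ⊕ W_k`. -/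
def dsum (V : InnSpace) {k : ℕ} (W : Fin k → InnSpace) : InnSpace where
  carrier := WithLp 2 (V × PiLp 2 fun i => (W i).carrier)

variable {V V' : InnSpace} {k : ℕ} {W W' : Fin k → InnSpace}

/-- The vector `(v, w₁, …, w_k)` of the direct sum. -/
def dmk (v : V) (w : ∀ i, W i) : V.dsum W :=
  WithLp.toLp 2 (v, WithLp.toLp 2 w)

/-- The component in `V` of a vector of the direct sum. -/
def dfst (x : V.dsum W) : V :=
  WithLp.fst (α := V.carrier) (β := PiLp 2 fun i => (W i).carrier) x

/-- The component in `W i` of a vector of the direct sum. -/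
def dcomp (x : V.dsum W) (i : Fin k) : W i :=
  (WithLp.snd (α := V.carrier) (β := PiLp 2 fun i => (W i).carrier) x) i

theorem norm_sq_dsum (x : V.dsum W) : ‖x‖ ^ 2 = ‖dfst x‖ ^ 2 + ∑ i, ‖dcomp x i‖ ^ 2 := by
  refine (WithLp.prod_norm_sq_eq_of_L2 (α := V.carrier)
    (β := PiLp 2 fun i => (W i).carrier) x).trans ?_
  exact congrArg _ (PiLp.norm_sq_eq_of_L2 (fun i => (W i).carrier) _)

theorem norm_sq_dmk (v : V) (w : ∀ i, W i) :
    ‖dmk v w‖ ^ 2 = ‖v‖ ^ 2 + ∑ i, ‖w i‖ ^ 2 :=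
  norm_sq_dsum (dmk v w)

theorem norm_eq_of_sq {E F : Type} [NormedAddCommGroup E] [NormedAddCommGroup F] {x : E} {y : F}
    (h : ‖x‖ ^ 2 = ‖y‖ ^ 2) : ‖x‖ = ‖y‖ :=
  (pow_left_inj₀ (norm_nonneg _) (norm_nonneg _) two_ne_zero).1 h

/-- The sum `φ ⊕ ψ₁ ⊕ ⋯ ⊕ ψ_k` of linear isometric embeddings. -/
def dsumMap (φ : V →ₗᵢ[ℝ] V') (ψ : ∀ i, W i →ₗᵢ[ℝ] W' i) : V.dsum W →ₗᵢ[ℝ] V'.dsum W' where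
  toFun x := dmk (φ (dfst x)) fun i => ψ i (dcomp x i)
  map_add' x y := by
    have h₁ : φ (dfst (x + y)) = φ (dfst x) + φ (dfst y) := map_add φ _ _
    have h₂ : (fun i => ψ i (dcomp (x + y) i)) =
        (fun i => ψ i (dcomp x i)) + fun i => ψ i (dcomp y i) :=
      funext fun i => map_add (ψ i) _ _
    rw [h₁, h₂]
    rfl
  map_smul' c x := by
    have h₁ : φ (dfst (c • x)) = c • φ (dfst x) := map_smul φ _ _
    have h₂ : (fun i => ψ i (dcomp (c • x) i)) = c • fun i => ψ i (dcomp x i) :=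
      funext fun i => map_smul (ψ i) _ _
    rw [h₁, h₂]
    rfl
  norm_map' x := norm_eq_of_sq (by
    refine (norm_sq_dmk _ _).trans ?_
    rw [norm_sq_dsum x]
    simp)

/-- The inclusion `V → V ⊕ W₁ ⊕ ⋯ ⊕ W_k`. -/
def dinl (V : InnSpace) {k : ℕ} (W : Fin k → InnSpace) : V →ₗᵢ[ℝ] V.dsum W where
  toFun v := dmk v 0
  map_add' x y := by
    have h : (0 : ∀ i, W i) = 0 + 0 := (add_zero _).symm
    conv_lhs => rw [h]
    rfl
  map_smul' c x := by
    have h : (0 : ∀ i, W i) = c • (0 : ∀ i, W i) := (smul_zero _).symm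
    conv_lhs => rw [h]
    rfl
  norm_map' x := norm_eq_of_sq (by
    refine (norm_sq_dmk _ _).trans ?_
    simp)

/-- The inclusion `W → V ⊕ W` of the second summand. -/
def dinr (V W : InnSpace) : W →ₗᵢ[ℝ] V.dsum fun _ : Fin 1 => W where
  toFun w := dmk 0 fun _ => w
  map_add' x y := by
    have h : (0 : V) = 0 + 0 := (add_zero _).symm
    conv_lhs => rw [h]
    rfl
  map_smul' c x := by
    have h : (0 : V) = c • (0 : V) := (smul_zero _).symm
    conv_lhs => rw [h]
    rfl
  norm_map' x := norm_eq_of_sq (by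
    refine (norm_sq_dmk _ _).trans ?_
    simp)

/-- The symmetry isometry `V ⊕ ⨁ᵢ W_i → V ⊕ ⨁ᵢ W_{σ i}`, `(v, w) ↦ (v, (w_{σ i})_i)`. -/
def dperm (V : InnSpace) {k : ℕ} (W : Fin k → InnSpace) (σ : Equiv.Perm (Fin k)) :
    V.dsum W →ₗᵢ[ℝ] V.dsum fun i => W (σ i) where
  toFun x := dmk (dfst x) fun i => dcomp x (σ i)
  map_add' _ _ := rfl
  map_smul' _ _ := rfl
  norm_map' x := norm_eq_of_sq (by
    refine (norm_sq_dmk _ _).trans ?_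
    rw [norm_sq_dsum x, Equiv.sum_comp σ fun i => ‖dcomp x i‖ ^ 2])

/-- The associativity isometry
`(V ⊕ ⨁ᵢ W_i) ⊕ ⨁ₚ U_p → V ⊕ ⨁ᵢ (W_i ⊕ ⨁ⱼ U_{e(i,j)})`, where `e` identifies the pairs `(i, j)`
with the indices `p`. -/
def dassoc (V : InnSpace) {k : ℕ} (W : Fin k → InnSpace) {n : Fin k → ℕ} {N : ℕ}
    (e : (Σ i, Fin (n i)) ≃ Fin N) (U : Fin N → InnSpace) :
    (V.dsum W).dsum U →ₗᵢ[ℝ] V.dsum fun i => (W i).dsum fun j => U (e ⟨i, j⟩) where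
  toFun x := dmk (dfst (dfst x)) fun i =>
    dmk (dcomp (dfst x) i) fun j => dcomp x (e ⟨i, j⟩)
  map_add' _ _ := rfl
  map_smul' _ _ := rfl
  norm_map' x := norm_eq_of_sq (by
    refine (norm_sq_dmk _ _).trans ?_
    simp only [norm_sq_dmk]
    rw [norm_sq_dsum x, norm_sq_dsum (dfst x), Finset.sum_add_distrib, add_assoc,
      ← Equiv.sum_comp e fun p => ‖dcomp x p‖ ^ 2, Fintype.sum_sigma])

end InnSpace

/-! ### Orthogonal spaces -/

/-- Weak Hausdorff spaces: continuous images of compact Hausdorff spaces are closed. -/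
class WeaklyHausdorff (X : Type) [TopologicalSpace X] : Prop where
  isClosed_range : ∀ (K : Type) [TopologicalSpace K] [CompactSpace K] [T2Space K] (f : K → X),
    Continuous f → IsClosed (Set.range f)

/-- An orthogonal space: a topologically enriched functor from finite-dimensional real inner
product spaces and linear isometric embeddings to compactly generated weak Hausdorff spaces.
(Since `L(V, W)` is compact Hausdorff, the product topology on `L(V, W) × X(V)` is already
compactly generated.) -/
structure OrthogonalSpace where
  obj : InnSpace → Type
  [topologicalSpace : ∀ V, TopologicalSpace (obj V)]
  [compactlyGenerated : ∀ V, CompactlyGeneratedSpace (obj V)]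
  [weaklyHausdorff : ∀ V, WeaklyHausdorff (obj V)]
  map : ∀ {V W : InnSpace}, (V →ₗᵢ[ℝ] W) → obj V → obj W
  map_id : ∀ (V : InnSpace) (x : obj V), map LinearIsometry.id x = x
  map_comp : ∀ {U V W : InnSpace} (ψ : V →ₗᵢ[ℝ] W) (φ : U →ₗᵢ[ℝ] V) (x : obj U),
    map (ψ.comp φ) x = map ψ (map φ x)
  continuous_map : ∀ V W : InnSpace,
    Continuous fun p : (V →ₗᵢ[ℝ] W) × obj V => map p.1 p.2

attribute [instance] OrthogonalSpace.topologicalSpace OrthogonalSpace.compactlyGenerated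
  OrthogonalSpace.weaklyHausdorff

theorem OrthogonalSpace.continuous_map_right (X : OrthogonalSpace) {V W : InnSpace}
    (φ : V →ₗᵢ[ℝ] W) : Continuous (X.map φ) :=
  (X.continuous_map V W).comp (Continuous.prodMk_right φ)

/-! ### Symmetric sequences -/

/-- A symmetric sequence of orthogonal spaces: orthogonal spaces `M_n` for `n ≥ 0`, each with a
(left) action of the symmetric group `Σ_n` by morphisms of orthogonal spaces. -/
structure SymSeq where
  space : ℕ → OrthogonalSpace
  act : ∀ {n : ℕ} {V : InnSpace}, Equiv.Perm (Fin n) → (space n).obj V → (space n).obj V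
  act_one : ∀ {n : ℕ} {V : InnSpace} (x : (space n).obj V), act 1 x = x
  act_mul : ∀ {n : ℕ} {V : InnSpace} (σ τ : Equiv.Perm (Fin n)) (x : (space n).obj V),
    act (σ * τ) x = act σ (act τ x)
  continuous_act : ∀ {n : ℕ} {V : InnSpace} (σ : Equiv.Perm (Fin n)),
    Continuous fun x : (space n).obj V => act σ x
  act_map : ∀ {n : ℕ} {V W : InnSpace} (φ : V →ₗᵢ[ℝ] W) (σ : Equiv.Perm (Fin n))
    (x : (space n).obj V), act σ ((space n).map φ x) = (space n).map φ (act σ x)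

/-- The space `M_n(V)`. -/
abbrev SymSeq.at (M : SymSeq) (n : ℕ) (V : InnSpace) : Type := (M.space n).obj V

/-- The map `M_n(V) → M_n(W)` induced by a linear isometric embedding `V → W`. -/
abbrev SymSeq.map (M : SymSeq) {n : ℕ} {V W : InnSpace} (φ : V →ₗᵢ[ℝ] W) :
    M.at n V → M.at n W :=
  (M.space n).map φ

/-- A morphism of symmetric sequences: equivariant morphisms of orthogonal spaces
`f_n : M_n → N_n`, that is, equivariant natural transformations by continuous maps. -/
@[ext]
structure SymSeq.Hom (M N : SymSeq) where
  app : ∀ (n : ℕ) (V : InnSpace), M.at n V → N.at n V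
  continuous_app : ∀ (n : ℕ) (V : InnSpace), Continuous (app n V)
  naturality : ∀ (n : ℕ) {V W : InnSpace} (φ : V →ₗᵢ[ℝ] W) (x : M.at n V),
    app n W (M.map φ x) = N.map φ (app n V x)
  equivariant : ∀ (n : ℕ) (V : InnSpace) (σ : Equiv.Perm (Fin n)) (x : M.at n V),
    app n V (M.act σ x) = N.act σ (app n V x)

/-! ### Representations, graph subgroups and admissibility -/

/-- A (finite-dimensional, orthogonal) representation of a topological group. -/
structure OrthRep (G : Type) [Group G] [TopologicalSpace G] where
  space : InnSpace
  ρ : G →* (space ≃ₗᵢ[ℝ] space)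
  continuous_ρ : Continuous fun p : G × space => ρ p.1 p.2

/-- A `G`-embedding of representations: an equivariant linear isometric embedding. -/
structure OrthRep.Embedding {G : Type} [Group G] [TopologicalSpace G] (V W : OrthRep G) where
  toIsom : V.space →ₗᵢ[ℝ] W.space
  equivariant : ∀ (g : G) (v : V.space), toIsom (V.ρ g v) = W.ρ g (toIsom v)

/-- A graph subgroup of `G × Σ_n`: a closed subgroup (with `Σ_n` discrete) which intersects
`{1} × Σ_n` trivially. -/
structure IsGraphSubgroup {G : Type} [Group G] [TopologicalSpace G] {n : ℕ}
    (Γ : Subgroup (G × Equiv.Perm (Fin n))) : Prop where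
  isClosed : @IsClosed (G × Equiv.Perm (Fin n)) (@instTopologicalSpaceProd _ _ _ ⊥) Γ
  trivial : ∀ σ : Equiv.Perm (Fin n), ((1 : G), σ) ∈ Γ → σ = 1

section Fixed

variable {G : Type} [Group G] [TopologicalSpace G] {n : ℕ}

/-- The fixed points `M_n(V)^Γ`, where `(g, σ) ∈ G × Σ_n` acts on `M_n(V)` through the action of
`g` on `V` and that of `σ` on `M_n`. -/
def SymSeq.fixed (M : SymSeq) (V : OrthRep G) (Γ : Subgroup (G × Equiv.Perm (Fin n))) :
    Set (M.at n V.space) :=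
  {x | ∀ γ ∈ Γ, M.act γ.2 (M.map (V.ρ γ.1).toLinearIsometry x) = x}

/-- The map `M_n(ψ)^Γ : M_n(V)^Γ → M_n(W)^Γ` induced by a `G`-embedding `ψ`. -/
def SymSeq.fixedMap (M : SymSeq) {V W : OrthRep G} (ψ : V.Embedding W)
    (Γ : Subgroup (G × Equiv.Perm (Fin n))) : C(M.fixed V Γ, M.fixed W Γ) where
  toFun x := ⟨M.map ψ.toIsom x.1, fun γ hγ => by
    have h : (W.ρ γ.1).toLinearIsometry.comp ψ.toIsom =
        ψ.toIsom.comp (V.ρ γ.1).toLinearIsometry :=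
      LinearIsometry.ext fun v => (ψ.equivariant γ.1 v).symm
    rw [SymSeq.map, SymSeq.map, ← OrthogonalSpace.map_comp, h, OrthogonalSpace.map_comp,
      M.act_map, x.2 γ hγ]⟩
  continuous_toFun :=
    (((M.space n).continuous_map_right ψ.toIsom).comp continuous_subtype_val).subtype_mk _

/-- The map `f_n(V)^Γ : M_n(V)^Γ → N_n(V)^Γ` induced by a morphism `f`. -/
def SymSeq.Hom.fixedApp {M N : SymSeq} (f : M.Hom N) (V : OrthRep G)
    (Γ : Subgroup (G × Equiv.Perm (Fin n))) : C(M.fixed V Γ, N.fixed V Γ) where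
  toFun x := ⟨f.app n V.space x.1, fun γ hγ => by
    rw [← f.naturality, ← f.equivariant, x.2 γ hγ]⟩
  continuous_toFun := ((f.continuous_app n V.space).comp continuous_subtype_val).subtype_mk _

/-- The set of admissible graph subgroups of `G × Σ_n`: those with a fixed point in `M_n(V)` for
some `G`-representation `V`. -/
def SymSeq.admissible (M : SymSeq) (G : Type) [Group G] [TopologicalSpace G] (n : ℕ) :
    Set (Subgroup (G × Equiv.Perm (Fin n))) :=
  {Γ | IsGraphSubgroup Γ ∧ ∃ V : OrthRep G, (M.fixed V Γ).Nonempty}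

end Fixed

/-- The unit disc `D^l`. -/
abbrev Disc (l : ℕ) : Type := Metric.closedBall (0 : EuclideanSpace ℝ (Fin l)) 1

/-- The boundary `∂D^l`, as a subspace of the disc. -/
abbrev discBoundary (l : ℕ) : Set (Disc l) := {t | ‖(t : EuclideanSpace ℝ (Fin l))‖ = 1}

/-- `N_∞`-symmetric sequences. -/
structure SymSeq.IsNInfinity (M : SymSeq) : Prop where
  nonempty : ∀ n : ℕ, ∃ V : InnSpace, Nonempty (M.at n V)
  extend : ∀ (G : Type) [Group G] [TopologicalSpace G] [IsCompactLieGroup G] (n : ℕ),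
    ∀ Γ ∈ M.admissible G n, ∀ (V : OrthRep G) (l : ℕ) (α : C(discBoundary l, M.fixed V Γ)),
      ∃ (W : OrthRep G) (ψ : V.Embedding W) (lam : C(Disc l, M.fixed W Γ)),
        ∀ t : discBoundary l, lam t = M.fixedMap ψ Γ (α t)

/-- Equivalences of symmetric sequences: morphisms `f` such that every `f_n` is a `Σ_n`-global
equivalence. -/
def SymSeq.Hom.IsEquivalence {M N : SymSeq} (f : M.Hom N) : Prop :=
  ∀ (n : ℕ) (G : Type) [Group G] [TopologicalSpace G] [IsCompactLieGroup G]
    (Γ : Subgroup (G × Equiv.Perm (Fin n))), IsGraphSubgroup Γ →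
    ∀ (V : OrthRep G) (l : ℕ) (α : C(discBoundary l, M.fixed V Γ)) (β : C(Disc l, N.fixed V Γ)),
      (∀ t : discBoundary l, f.fixedApp V Γ (α t) = β t) →
      ∃ (W : OrthRep G) (ψ : V.Embedding W) (lam : C(Disc l, M.fixed W Γ)),
        (∀ t : discBoundary l, lam t = M.fixedMap ψ Γ (α t)) ∧
        ContinuousMap.HomotopicRel ((f.fixedApp W Γ).comp lam) ((N.fixedMap ψ Γ).comp β)
          (discBoundary l)

/-! ### Operads -/

/-- An operad in orthogonal spaces with respect to the box product, i.e. a monoid in symmetric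
sequences for the composition product
`(O ∘ O)_N = ∐_k O_k ⊠_{Σ_k} ∐_{n₁ + ⋯ + n_k = N} Σ_N ⊗_{Σ_{n₁} × ⋯ × Σ_{n_k}} (O_{n₁} ⊠ ⋯ ⊠ O_{n_k})`.

A morphism out of a box product `X₀ ⊠ ⋯ ⊠ X_k` is the same as a natural family of continuous maps
`X₀(V) × X₁(W₁) × ⋯ × X_k(W_k) → Z(V ⊕ W₁ ⊕ ⋯ ⊕ W_k)` (this is the defining universal property of
the box product), and an element of the copy of `Σ_N` in the formula above is the same as a
bijection `e` from the pairs `(i, j)` with `1 ≤ i ≤ k`, `1 ≤ j ≤ n_i` to `{1, …, N}`, telling which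
input of the composite the `j`-th input of the `i`-th operation becomes.  Hence a morphism
`O ∘ O → O` is a family of maps `comp e` which is natural (`comp_map`), continuous
(`continuous_comp`), `Σ_N`-equivariant (`comp_act_out`), balanced over `Σ_{n₁} × ⋯ × Σ_{n_k}`
(`comp_act_in`) and invariant under `Σ_k` (`comp_act`).  The products of spaces carry the compactly
generated topology, so that a map out of such a product is continuous if and only if its composites
with all continuous maps from compact Hausdorff spaces `T` are.

The unit of the box product is the constant one-point orthogonal space, so that the unit of the
operad is a compatible family of points `unit V ∈ O_1(V)`; the unit isomorphisms of the box
product are induced by the inclusions of summands. -/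
structure Operad extends SymSeq where
  comp : ∀ {k : ℕ} {n : Fin k → ℕ} {N : ℕ} (_ : (Σ i, Fin (n i)) ≃ Fin N)
    {V : InnSpace} {W : Fin k → InnSpace},
    toSymSeq.at k V → (∀ i, toSymSeq.at (n i) (W i)) → toSymSeq.at N (V.dsum W)
  unit : ∀ V : InnSpace, toSymSeq.at 1 V
  continuous_comp : ∀ {k : ℕ} {n : Fin k → ℕ} {N : ℕ} (e : (Σ i, Fin (n i)) ≃ Fin N)
    {V : InnSpace} {W : Fin k → InnSpace}
    (T : Type) [TopologicalSpace T] [CompactSpace T] [T2Space T]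
    (a : T → toSymSeq.at k V) (b : ∀ i, T → toSymSeq.at (n i) (W i)),
    Continuous a → (∀ i, Continuous (b i)) → Continuous fun t => comp e (a t) fun i => b i t
  comp_map : ∀ {k : ℕ} {n : Fin k → ℕ} {N : ℕ} (e : (Σ i, Fin (n i)) ≃ Fin N)
    {V V' : InnSpace} {W W' : Fin k → InnSpace}
    (φ : V →ₗᵢ[ℝ] V') (ψ : ∀ i, W i →ₗᵢ[ℝ] W' i)
    (x : toSymSeq.at k V) (y : ∀ i, toSymSeq.at (n i) (W i)),
    comp e (toSymSeq.map φ x) (fun i => toSymSeq.map (ψ i) (y i)) =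
      toSymSeq.map (InnSpace.dsumMap φ ψ) (comp e x y)
  comp_act_out : ∀ {k : ℕ} {n : Fin k → ℕ} {N : ℕ} (e : (Σ i, Fin (n i)) ≃ Fin N)
    {V : InnSpace} {W : Fin k → InnSpace} (σ : Equiv.Perm (Fin N))
    (x : toSymSeq.at k V) (y : ∀ i, toSymSeq.at (n i) (W i)),
    comp (e.trans σ) x y = act σ (comp e x y)
  comp_act_in : ∀ {k : ℕ} {n : Fin k → ℕ} {N : ℕ} (e : (Σ i, Fin (n i)) ≃ Fin N)
    {V : InnSpace} {W : Fin k → InnSpace} (τ : ∀ i, Equiv.Perm (Fin (n i)))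
    (x : toSymSeq.at k V) (y : ∀ i, toSymSeq.at (n i) (W i)),
    comp e x (fun i => act (τ i) (y i)) = comp ((Equiv.sigmaCongrRight τ).trans e) x y
  comp_act : ∀ {k : ℕ} {n : Fin k → ℕ} {N : ℕ} (e : (Σ i, Fin (n i)) ≃ Fin N)
    {V : InnSpace} {W : Fin k → InnSpace} (σ : Equiv.Perm (Fin k))
    (x : toSymSeq.at k V) (y : ∀ i, toSymSeq.at (n i) (W i)),
    toSymSeq.map (InnSpace.dperm V W σ) (comp e (act σ x) y) =
      comp (n := fun i => n (σ i))
        ((Equiv.sigmaCongrLeft (β := fun i => Fin (n i)) σ).trans e) x fun i => y (σ i)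
  comp_assoc : ∀ {k : ℕ} {n : Fin k → ℕ} {N : ℕ} {m : Fin N → ℕ} {M' : Fin k → ℕ} {M : ℕ}
    (e : (Σ i, Fin (n i)) ≃ Fin N) (f : (Σ p, Fin (m p)) ≃ Fin M)
    (h : ∀ i, (Σ j, Fin (m (e ⟨i, j⟩))) ≃ Fin (M' i)) (g : (Σ i, Fin (M' i)) ≃ Fin M)
    (_ : ∀ (i : Fin k) (j : Fin (n i)) (t : Fin (m (e ⟨i, j⟩))),
      g ⟨i, h i ⟨j, t⟩⟩ = f ⟨e ⟨i, j⟩, t⟩)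
    {V : InnSpace} {W : Fin k → InnSpace} {U : Fin N → InnSpace}
    (x : toSymSeq.at k V) (y : ∀ i, toSymSeq.at (n i) (W i)) (z : ∀ p, toSymSeq.at (m p) (U p)),
    toSymSeq.map (InnSpace.dassoc V W e U) (comp f (comp e x y) z) =
      comp g x fun i => comp (h i) (y i) fun j => z (e ⟨i, j⟩)
  unit_map : ∀ {V W : InnSpace} (φ : V →ₗᵢ[ℝ] W), toSymSeq.map φ (unit V) = unit W
  unit_comp : ∀ {m : ℕ} (e : (Σ _ : Fin 1, Fin m) ≃ Fin m) (_ : ∀ j, e ⟨0, j⟩ = j)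
    {V W : InnSpace} (y : toSymSeq.at m W),
    comp e (unit V) (fun _ : Fin 1 => y) = toSymSeq.map (InnSpace.dinr V W) y
  comp_unit : ∀ {k : ℕ} (e : (Σ _ : Fin k, Fin 1) ≃ Fin k) (_ : ∀ i, e ⟨i, 0⟩ = i)
    {V : InnSpace} {W : Fin k → InnSpace} (x : toSymSeq.at k V),
    comp e x (fun i => unit (W i)) = toSymSeq.map (InnSpace.dinl V W) x

/-- A morphism of operads: a morphism of symmetric sequences which is compatible with composition
and units. -/
@[ext]
structure Operad.Hom (O P : Operad) extends SymSeq.Hom O.toSymSeq P.toSymSeq where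
  app_comp : ∀ {k : ℕ} {n : Fin k → ℕ} {N : ℕ} (e : (Σ i, Fin (n i)) ≃ Fin N)
    {V : InnSpace} {W : Fin k → InnSpace} (x : O.at k V) (y : ∀ i, O.at (n i) (W i)),
    app N (V.dsum W) (O.comp e x y) = P.comp e (app k V x) fun i => app (n i) (W i) (y i)
  app_unit : ∀ V : InnSpace, app 1 V (O.unit V) = P.unit V

/-- The category of operads in orthogonal spaces. -/
instance : Category Operad where
  Hom := Operad.Hom
  id O :=
    { app := fun _ _ x => x
      continuous_app := fun _ _ => continuous_id
      naturality := fun _ _ _ _ _ => rfl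
      equivariant := fun _ _ _ _ => rfl
      app_comp := fun _ _ _ _ _ => rfl
      app_unit := fun _ => rfl }
  comp f g :=
    { app := fun n V x => g.app n V (f.app n V x)
      continuous_app := fun n V => (g.continuous_app n V).comp (f.continuous_app n V)
      naturality := fun n _ _ φ x => by rw [f.naturality, g.naturality]
      equivariant := fun n V σ x => by rw [f.equivariant, g.equivariant]
      app_comp := fun e _ _ x y => by rw [f.app_comp, g.app_comp]
      app_unit := fun V => by rw [f.app_unit, g.app_unit] }

/-! ### Global `N_∞`-operads and their homotopy category -/

/-- The category of global `N_∞`-operads: the full subcategory of operads whose underlying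
symmetric sequence is `N_∞`. -/
abbrev NInfinityOperad : Type 1 :=
  ObjectProperty.FullSubcategory fun O : Operad => O.toSymSeq.IsNInfinity

/-- Equivalences of global `N_∞`-operads. -/
def equivalences : MorphismProperty NInfinityOperad :=
  fun _ _ f => (Operad.Hom.toHom f.hom).IsEquivalence

/-- The homotopy category of global `N_∞`-operads: the localization at the equivalences. -/
abbrev HoNInfinity : Type 1 := equivalences.Localization

/-- The graph subgroup of `H × Σ_n` associated to an `H`-set `A` with an ordering `A ≃ Fin n`:
the graph of the homomorphism `H → Σ_n` describing the action. -/
def setGraph (H : Type) [Group H] {A : Type} [MulAction H A] {n : ℕ} (a : A ≃ Fin n) :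
    Subgroup (H × Equiv.Perm (Fin n)) :=
  (a.permCongrHom.toMonoidHom.comp (MulAction.toPermHom H A)).graph

/-- A finite `H`-set is admissible if its graph subgroup (for some ordering) is. -/
def SymSeq.AdmissibleSet (M : SymSeq) (H : Type) [Group H] [TopologicalSpace H]
    (A : Type) [MulAction H A] : Prop :=
  ∃ (n : ℕ) (a : A ≃ Fin n), setGraph H a ∈ M.admissible H n

/-- The transfer from a closed subgroup `K` of finite index to `H` is admissible if the `H`-set
`H/K` is. -/
def SymSeq.AdmissibleTransfer (M : SymSeq) (H : Type) [Group H] [TopologicalSpace H]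
    (K : Subgroup H) : Prop :=
  IsClosed (K : Set H) ∧ K.FiniteIndex ∧ M.AdmissibleSet H (H ⧸ K)

end GlobalOperads
end

/-!
Write `T_O` for the transfer system of a global `N_∞`-operad `O`. The theorem rests on the product
`O × P` of operads: if `T_O ≤ T_P`, then the projection `O × P → O` is an equivalence
(`hasWeakProducts`). Everything else is formal (`thin_full_faithful_of_weakProducts`). For an
operad `P`, the two projections `P × P → P` are equivalences with the diagonal as a common section,
so they agree in the localization, and parallel morphisms of operads become equal. As equivalences
do not change `T`, the product of two operads with `T_O ≤ T_P` can replace the pullback when spans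
`O ← Z → P` are composed or compared; hence every morphism of the localization is such a span, and
any two parallel ones are equal. If `T_O ≤ T_P`, the span `O ← O × P → P` is a morphism `O → P`.

Products are formed with the compactly generated topology (`KProd`). The lifting property of the
projection `O × P → O` only asks for fillings of spheres in fixed points of `P`, so the projection
is an equivalence as soon as every graph subgroup admissible for `O` is admissible for `P`
(`Operad.isEquivalence_fst`). The main point is that this already follows from `T_O ≤ T_P`
(`admissibleLE_of_transferSystem_le`).

A graph subgroup `Γ` of `G × Σ_n` is the graph of an action `φ : H → Σ_n` of a closed subgroup `H`
of `G`. Say that a finite `H`-set is realized by `O` if its graph is admissible (`SymSeq.FixedBy`).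
Composition in `O` shows that the realized `H`-sets are closed under passage to `H`-subsets
(plug the unit or an operation of arity zero into the inputs) and under disjoint unions (plug them
into an operation of the trivial `H`-set). So it depends only on the orbits `H/K`, that is on the
transfer system, whether `φ` is realized. The same kind of composition, with induced
representations, shows that `T_O` is transitive (`Operad.fixedBy_trans`).

Two facts on compact Lie groups are needed to apply this. First, `H` is a compact Lie group
(`isCompactLieGroup_of_isClosed`). Secondly, a fixed operation over an `H`-representation gives one
over a `G`-representation, as every `H`-representation embeds into the restriction of a
`G`-representation (`OrthRep.exists_embedding_comap`). Both are consequences of the Peter–Weyl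
theorem (`exists_matrixCoefficient_near`), which follows from the spectral theorem for the compact
operators obtained by averaging projections to a line over `G`. For the second one, a matrix
coefficient of `G` approximating a bump function on `H` is used to write down an injective
equivariant map, which is made isometric by polar decomposition. For the first one, `G` embeds into
a finite-dimensional algebra since it has no small subgroups (`exists_injective_orthRep`), and a
compact group inside a finite-dimensional algebra is a Lie group by von Neumann's argument: near
the identity it is the image of its Lie algebra under the exponential map
(`exists_local_parametrization`).
-/

noncomputable section

namespace GlobalOperads

/-! ### Localizations in which every morphism is a fraction through a product -/

section Localization

universe w

variable {C : Type 1} [Category.{w} C] {W : MorphismProperty C}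

/-- The morphism `h` of the localization has the form `Q(b) ∘ Q(a)⁻¹` for a span `(a, b)` in `C`
whose left leg `a` becomes invertible (though it need not belong to `W`). -/
def IsSpan (W : MorphismProperty C) {X Y : C} (h : W.Q.obj X ⟶ W.Q.obj Y) : Prop :=
  ∃ (Z : C) (a : Z ⟶ X) (b : Z ⟶ Y), IsIso (W.Q.map a) ∧ W.Q.map a ≫ h = W.Q.map b

variable {P : Type 1} [PartialOrder P]

/-- `C` has weak binary products, the first projection of a product `X × Y` belonging to `W` as soon
as `T X ≤ T Y`. -/
def HasWeakProducts (W : MorphismProperty C) (T : C ⥤ P) : Prop :=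
  ∀ X Y : C, ∃ (Z : C) (p : Z ⟶ X) (q : Z ⟶ Y),
    (T.obj X ≤ T.obj Y → W p) ∧
      ∀ (A : C) (f : A ⟶ X) (g : A ⟶ Y), ∃ h : A ⟶ Z, h ≫ p = f ∧ h ≫ q = g

/-- Parallel morphisms become equal in the localization: both are obtained from a morphism into the
square of the target by composing with a projection, and the two projections become equal since
the diagonal is a common section of both. -/
theorem Q_map_eq {T : C ⥤ P} (hprod : HasWeakProducts W T) {X Y : C} (f g : X ⟶ Y) :
    W.Q.map f = W.Q.map g := by
  obtain ⟨Z, p, q, hp, hl⟩ := hprod Y Y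
  obtain ⟨d, hd₁, hd₂⟩ := hl Y (𝟙 Y) (𝟙 Y)
  obtain ⟨h, rfl, rfl⟩ := hl X f g
  have ip : IsIso (W.Q.map p) := W.Q_inverts _ (hp le_rfl)
  have e₁ : W.Q.map d ≫ W.Q.map p = 𝟙 _ := by rw [← W.Q.map_comp, hd₁, W.Q.map_id]
  have e₂ : W.Q.map d ≫ W.Q.map q = 𝟙 _ := by rw [← W.Q.map_comp, hd₂, W.Q.map_id]
  have e₃ : W.Q.map p ≫ W.Q.map d = 𝟙 _ := by
    rw [← cancel_mono (W.Q.map p), Category.assoc, e₁, Category.comp_id, Category.id_comp]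
  have e : W.Q.map p = W.Q.map q := by
    calc W.Q.map p = W.Q.map p ≫ W.Q.map d ≫ W.Q.map q := by rw [e₂, Category.comp_id]
      _ = W.Q.map q := by rw [← Category.assoc, e₃, Category.id_comp]
  rw [W.Q.map_comp, W.Q.map_comp, e]

theorem obj_eq_of_isIso_Q_map {T : C ⥤ P} (hT : W.IsInvertedBy T) {X Y : C} (a : X ⟶ Y)
    (ha : IsIso (W.Q.map a)) : T.obj X = T.obj Y := by
  let e := (Localization.Construction.lift T hT).mapIso (asIso (W.Q.map a))
  exact le_antisymm (leOfHom e.hom) (leOfHom e.inv)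

/-- A span is determined by its source and target, as a morphism of the localization: compare two
spans on the product of their apices. -/
theorem IsSpan.eq {T : C ⥤ P} (hT : W.IsInvertedBy T)
    (hprod : HasWeakProducts W T) {X Y : C} {h h' : W.Q.obj X ⟶ W.Q.obj Y}
    (H : IsSpan W h) (H' : IsSpan W h') :
    h = h' := by
  obtain ⟨Z, a, b, ha, e⟩ := H
  obtain ⟨Z', a', b', ha', e'⟩ := H'
  obtain ⟨V, p, q, hp, -⟩ := hprod Z Z'
  have hZ : T.obj Z = T.obj Z' :=
    (obj_eq_of_isIso_Q_map hT a ha).trans (obj_eq_of_isIso_Q_map hT a' ha').symm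
  have ip : IsIso (W.Q.map p) := W.Q_inverts _ (hp hZ.le)
  rw [← cancel_epi (W.Q.map a), ← cancel_epi (W.Q.map p)]
  calc W.Q.map p ≫ W.Q.map a ≫ h = W.Q.map (p ≫ b) := by rw [e, W.Q.map_comp]
    _ = W.Q.map (q ≫ b') := Q_map_eq hprod _ _
    _ = W.Q.map (q ≫ a') ≫ h' := by rw [W.Q.map_comp, W.Q.map_comp, Category.assoc, e']
    _ = W.Q.map (p ≫ a) ≫ h' := by rw [Q_map_eq hprod (q ≫ a') (p ≫ a)]
    _ = _ := by rw [W.Q.map_comp, Category.assoc]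

/-- To compose the spans `X ← A → Y` and `Y ← B → Z`, use the product of `A` and `B` as a substitute
for the pullback: the square over `Y` need not commute in `C`, but it does in the localization. -/
theorem IsSpan.comp {T : C ⥤ P} (hT : W.IsInvertedBy T)
    (hprod : HasWeakProducts W T) {X Y Z : C} {h : W.Q.obj X ⟶ W.Q.obj Y}
    {k : W.Q.obj Y ⟶ W.Q.obj Z} (H : IsSpan W h) (K : IsSpan W k) : IsSpan W (h ≫ k) := by
  obtain ⟨A, a, b, ha, e⟩ := H
  obtain ⟨B, c, d, hc, e'⟩ := K
  obtain ⟨V, p, q, hp, -⟩ := hprod A B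
  have hAB : T.obj A ≤ T.obj B := (leOfHom (T.map b)).trans (obj_eq_of_isIso_Q_map hT c hc).ge
  have ip : IsIso (W.Q.map p) := W.Q_inverts _ (hp hAB)
  refine ⟨V, p ≫ a, q ≫ d, by rw [W.Q.map_comp]; infer_instance, ?_⟩
  rw [W.Q.map_comp, Category.assoc, ← Category.assoc (W.Q.map a), e, ← Category.assoc,
    ← W.Q.map_comp, Q_map_eq hprod (p ≫ b) (q ≫ c), W.Q.map_comp, Category.assoc, e',
    ← W.Q.map_comp]

/-- All morphisms of the localization are spans, since those of `C` and the formal inverses are. -/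
theorem isSpan_all {T : C ⥤ P} (hT : W.IsInvertedBy T)
    (hprod : HasWeakProducts W T) {X Y : C} (h : W.Q.obj X ⟶ W.Q.obj Y) : IsSpan W h := by
  let S : MorphismProperty W.Localization := fun A B h =>
    ∀ (X Y : C) (e : W.Q.obj X = A) (e' : W.Q.obj Y = B),
      IsSpan W (eqToHom e ≫ h ≫ eqToHom e'.symm)
  have hinj {X Y : C} (e : W.Q.obj X = W.Q.obj Y) : X = Y :=
    (Localization.Construction.objEquiv W).injective e
  have hS : S = ⊤ := by
    have : S.IsStableUnderComposition := ⟨fun {A B D} f g hf hg X Z e e' => by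
      obtain ⟨Y, rfl⟩ : ∃ Y, W.Q.obj Y = B := (Localization.Construction.objEquiv W).surjective B
      have := IsSpan.comp hT hprod (hf X Y e rfl) (hg Y Z rfl e')
      simpa using this⟩
    refine Localization.Construction.morphismProperty_eq_top S ?_ ?_
    · intro X Y f X' Y' e e'
      obtain rfl := hinj e
      obtain rfl := hinj e'
      exact ⟨X', 𝟙 _, f, by rw [W.Q.map_id]; infer_instance, by simp⟩
    · intro X Y w hw X' Y' e e'
      obtain rfl := hinj e
      obtain rfl := hinj e'
      refine ⟨Y', w, 𝟙 _, W.Q_inverts w hw, ?_⟩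
      simp only [eqToHom_refl, Category.comp_id, Category.id_comp, W.Q.map_id]
      exact (Localization.Construction.wIso w hw).hom_inv_id
  have : S h := by rw [hS]; trivial
  simpa using this X Y rfl rfl

/-- If the products of `C` have the stated property relative to `T`, the localization is thin and
`T` induces a fully faithful functor on it. -/
theorem thin_full_faithful_of_weakProducts {T : C ⥤ P} (hT : W.IsInvertedBy T)
    (hprod : HasWeakProducts W T) :
    Quiver.IsThin W.Localization ∧ (Localization.Construction.lift T hT).Full ∧
      (Localization.Construction.lift T hT).Faithful := by
  have hthin : Quiver.IsThin W.Localization := fun A B => ⟨fun h h' => by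
    obtain ⟨X, rfl⟩ := (Localization.Construction.objEquiv W).surjective A
    obtain ⟨Y, rfl⟩ := (Localization.Construction.objEquiv W).surjective B
    exact (isSpan_all hT hprod h).eq hT hprod (isSpan_all hT hprod h')⟩
  refine ⟨hthin, ⟨fun {A B} f => ?_⟩, ⟨fun _ => (hthin _ _).elim _ _⟩⟩
  obtain ⟨X, rfl⟩ := (Localization.Construction.objEquiv W).surjective A
  obtain ⟨Y, rfl⟩ := (Localization.Construction.objEquiv W).surjective B
  obtain ⟨Z, p, q, hp, -⟩ := hprod X Y
  have ip : IsIso (W.Q.map p) := W.Q_inverts _ (hp (leOfHom f))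
  exact ⟨(asIso (W.Q.map p)).inv ≫ W.Q.map q, Subsingleton.elim _ _⟩

end Localization

/-! ### Compactly generated products -/

section KProd

/-- The product of two spaces in the category of compactly generated spaces: the cartesian product
with the compactly generated refinement of the product topology. -/
def KProd (X Y : Type) : Type := X × Y

/-- The point of the compactly generated product with given components. -/
abbrev KProd.mk {X Y : Type} (x : X) (y : Y) : KProd X Y := (x, y)

variable {X Y Z : Type} [TopologicalSpace X] [TopologicalSpace Y] [TopologicalSpace Z]

instance : TopologicalSpace (KProd X Y) := TopologicalSpace.compactlyGenerated.{0} (X × Y)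

/-- Continuity on a compactly generated product is tested on compact Hausdorff spaces. -/
theorem KProd.continuous_of_probe (f : KProd X Y → Z)
    (h : ∀ (T : Type) [TopologicalSpace T] [CompactSpace T] [T2Space T] (g : T → X × Y),
      Continuous g → Continuous fun t => f (g t)) : Continuous f :=
  continuous_from_compactlyGenerated.{0} (X := X × Y) f fun S g => h S g g.continuous

theorem KProd.continuous_fst : Continuous fun p : KProd X Y => p.1 :=
  KProd.continuous_of_probe _ fun _ _ _ _ _ hg => _root_.continuous_fst.comp hg

theorem KProd.continuous_snd : Continuous fun p : KProd X Y => p.2 :=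
  KProd.continuous_of_probe _ fun _ _ _ _ _ hg => _root_.continuous_snd.comp hg

/-- The universal property of the compactly generated product with respect to compact Hausdorff
test spaces. -/
theorem KProd.continuous_mk {T : Type} [TopologicalSpace T] [CompactSpace T] [T2Space T]
    {f : T → X} {g : T → Y} (hf : Continuous f) (hg : Continuous g) :
    Continuous fun t => KProd.mk (f t) (g t) := by
  let φ : (Σ (i : (S : CompHaus.{0}) × C(S, X × Y)), i.fst) → X × Y := fun ⟨⟨_, i⟩, s⟩ => i s
  have h : @Continuous _ _ _ (TopologicalSpace.coinduced φ inferInstance) φ :=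
    continuous_coinduced_rng
  exact @Continuous.comp _ _ _ _ _ (TopologicalSpace.coinduced φ inferInstance) _ _ h
    (continuous_sigmaMk (σ := fun i : (S : CompHaus.{0}) × C(S, X × Y) => i.fst)
      (i := ⟨CompHaus.of T, ⟨fun t => (f t, g t), hf.prodMk hg⟩⟩))

instance : CompactlyGeneratedSpace (KProd X Y) :=
  compactlyGeneratedSpace_of_continuous_maps fun f h =>
    KProd.continuous_of_probe f fun T _ _ _ g hg =>
      h T g (KProd.continuous_mk (_root_.continuous_fst.comp hg) (_root_.continuous_snd.comp hg))

/-- A map `f` from a compact Hausdorff space to a weakly Hausdorff space has closed kernel relation: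
`f` is a closed map, so that disjoint neighbourhoods of two fibres contain saturated ones. -/
theorem WeaklyHausdorff.isClosed_kernel [WeaklyHausdorff X] {S : Type} [TopologicalSpace S]
    [CompactSpace S] [T2Space S] {f : S → X} (hf : Continuous f) :
    IsClosed {p : S × S | f p.1 = f p.2} := by
  have himg : ∀ C : Set S, IsClosed C → IsClosed (f '' C) := fun C hC => by
    have : CompactSpace C := isCompact_iff_compactSpace.1 hC.isCompact
    have h := WeaklyHausdorff.isClosed_range (X := X) C (fun c => f c)
      (hf.comp continuous_subtype_val)
    rwa [show Set.range (fun c : C => f c) = f '' C by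
      ext; simp [Set.mem_image]] at h
  have hfib : ∀ s, IsClosed (f ⁻¹' {f s}) := fun s => by
    have := himg {s} isClosed_singleton
    rw [Set.image_singleton] at this
    exact this.preimage hf
  rw [← isOpen_compl_iff, isOpen_prod_iff]
  intro s t hst
  have hd : Disjoint (f ⁻¹' {f s}) (f ⁻¹' {f t}) :=
    Set.disjoint_left.2 fun x hx hx' => hst (hx.symm.trans hx')
  obtain ⟨U, V, hU, hV, hsU, htV, hUV⟩ := normal_separation (hfib s) (hfib t) hd
  refine ⟨f ⁻¹' (f '' Uᶜ)ᶜ, f ⁻¹' (f '' Vᶜ)ᶜ,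
    (himg _ hU.isClosed_compl).isOpen_compl.preimage hf,
    (himg _ hV.isClosed_compl).isOpen_compl.preimage hf, ?_, ?_, ?_⟩
  · rintro ⟨x, hx, e⟩
    exact hx (hsU e)
  · rintro ⟨x, hx, e⟩
    exact hx (htV e)
  · rintro ⟨x, y⟩ ⟨hx, hy⟩ (e : f x = f y)
    have hxU : x ∈ U := by_contra fun h => hx ⟨x, h, rfl⟩
    have hxV : x ∈ V := by_contra fun h => hy ⟨x, h, e⟩
    exact Set.disjoint_left.1 hUV hxU hxV

/-- Apply `WeaklyHausdorff.isClosed_kernel` to the map on the disjoint union. -/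
theorem WeaklyHausdorff.isClosed_eq [WeaklyHausdorff X] {S T : Type} [TopologicalSpace S]
    [CompactSpace S] [T2Space S] [TopologicalSpace T] [CompactSpace T] [T2Space T]
    {f : S → X} {g : T → X} (hf : Continuous f) (hg : Continuous g) :
    IsClosed {p : S × T | f p.1 = g p.2} := by
  have h := WeaklyHausdorff.isClosed_kernel (f := Sum.elim f g) (hf.sumElim hg)
  exact h.preimage (f := fun p : S × T => ((Sum.inl p.1 : S ⊕ T), (Sum.inr p.2 : S ⊕ T)))
    (by fun_prop)

/-- The preimage of the image of `f` in a test space `T` is the projection of the closed set of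
pairs on which `f` and the test map agree. -/
instance [WeaklyHausdorff X] [WeaklyHausdorff Y] : WeaklyHausdorff (KProd X Y) where
  isClosed_range K _ _ _ f hf := by
    refine CompactlyGeneratedSpace.isClosed' fun T _ _ _ g hg => ?_
    have h₁ := WeaklyHausdorff.isClosed_eq (KProd.continuous_fst.comp hf)
      (KProd.continuous_fst.comp hg)
    have h₂ := WeaklyHausdorff.isClosed_eq (KProd.continuous_snd.comp hf)
      (KProd.continuous_snd.comp hg)
    have h := isClosedMap_snd_of_compactSpace _ (h₁.inter h₂)
    convert h using 1
    ext t
    constructor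
    · rintro ⟨k, hk⟩
      exact ⟨(k, t), ⟨congrArg Prod.fst hk, congrArg Prod.snd hk⟩, rfl⟩
    · rintro ⟨⟨k, t'⟩, ⟨h₁, h₂⟩, rfl⟩
      exact ⟨k, Prod.ext h₁ h₂⟩

/-- The product of a compact Hausdorff space with a compactly generated space carries the compactly
generated topology already; this is the exponential law. -/
theorem continuous_prod_of_probe {L : Type} [TopologicalSpace L] [CompactSpace L] [T2Space L]
    [CompactlyGeneratedSpace X] (f : L × X → Z)
    (h : ∀ (T : Type) [TopologicalSpace T] [CompactSpace T] [T2Space T] (g : T → X),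
      Continuous g → Continuous fun p : L × T => f (p.1, g p.2)) : Continuous f := by
  have hc : ∀ x, Continuous fun l => f (l, x) := fun x =>
    (h PUnit (fun _ => x) continuous_const).comp (Continuous.prodMk_left PUnit.unit)
  have hF : Continuous fun x => (⟨fun l => f (l, x), hc x⟩ : C(L, Z)) := by
    refine continuous_from_compactlyGeneratedSpace _ fun T _ _ _ g hg => ?_
    exact ((⟨_, (h T g hg).comp continuous_swap⟩ : C(T × L, Z)).curry).continuous
  exact (ContinuousMap.continuous_uncurry_of_continuous ⟨_, hF⟩).comp continuous_swap

end KProd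

/-! ### Products of global `N_∞`-operads -/

/-- The space of linear isometric embeddings is compact. -/
instance (V W : InnSpace) : CompactSpace (V →ₗᵢ[ℝ] W) := by
  have hr : Set.range (LinearIsometry.toContinuousLinearMap : (V →ₗᵢ[ℝ] W) → (V →L[ℝ] W)) =
      {A | ∀ v, ‖A v‖ = ‖v‖} := by
    ext A
    exact ⟨by rintro ⟨φ, rfl⟩ v; exact φ.norm_map v, fun h => ⟨⟨A.toLinearMap, h⟩, rfl⟩⟩
  have hind : Topology.IsInducing
      (LinearIsometry.toContinuousLinearMap : (V →ₗᵢ[ℝ] W) → (V →L[ℝ] W)) := ⟨rfl⟩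
  rw [← isCompact_univ_iff, hind.isCompact_iff, Set.image_univ, hr]
  refine Metric.isCompact_of_isClosed_isBounded ?_ ?_
  · rw [Set.ofPred_forall]
    exact isClosed_iInter fun v =>
      isClosed_eq ((ContinuousLinearMap.apply ℝ W.carrier v).continuous.norm) continuous_const
  · refine (Metric.isBounded_closedBall (x := (0 : V →L[ℝ] W)) (r := 1)).subset fun A hA => ?_
    rw [mem_closedBall_zero_iff]
    exact A.opNorm_le_bound zero_le_one fun v => by rw [hA v, one_mul]

instance (V W : InnSpace) : T2Space (V →ₗᵢ[ℝ] W) := by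
  refine T2Space.of_injective_continuous
    (f := (LinearIsometry.toContinuousLinearMap : (V →ₗᵢ[ℝ] W) → (V →L[ℝ] W))) ?_ ?_
  · intro φ ψ h
    ext v
    exact congrArg (fun A : V →L[ℝ] W => A v) h
  · exact continuous_induced_dom

/-- The product of two orthogonal spaces. -/
def OrthogonalSpace.prod (X Y : OrthogonalSpace) : OrthogonalSpace where
  obj V := KProd (X.obj V) (Y.obj V)
  map φ p := KProd.mk (X.map φ p.1) (Y.map φ p.2)
  map_id V p := Prod.ext (X.map_id V p.1) (Y.map_id V p.2)
  map_comp ψ φ p := Prod.ext (X.map_comp ψ φ p.1) (Y.map_comp ψ φ p.2)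
  continuous_map V W := continuous_prod_of_probe _ fun _ _ _ _ _ hg =>
    KProd.continuous_mk
      ((X.continuous_map V W).comp
        (continuous_fst.prodMk ((KProd.continuous_fst.comp hg).comp continuous_snd)))
      ((Y.continuous_map V W).comp
        (continuous_fst.prodMk ((KProd.continuous_snd.comp hg).comp continuous_snd)))

/-- The product of two symmetric sequences. -/
def SymSeq.prod (M N : SymSeq) : SymSeq where
  space n := (M.space n).prod (N.space n)
  act σ p := KProd.mk (M.act σ p.1) (N.act σ p.2)
  act_one p := Prod.ext (M.act_one p.1) (N.act_one p.2)
  act_mul σ τ p := Prod.ext (M.act_mul σ τ p.1) (N.act_mul σ τ p.2)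
  continuous_act σ := KProd.continuous_of_probe _ fun _ _ _ _ _ hg =>
    KProd.continuous_mk ((M.continuous_act σ).comp (continuous_fst.comp hg))
      ((N.continuous_act σ).comp (continuous_snd.comp hg))
  act_map φ σ p := Prod.ext (M.act_map φ σ p.1) (N.act_map φ σ p.2)

/-- The product of two operads. -/
def Operad.prod (O P : Operad) : Operad where
  toSymSeq := O.toSymSeq.prod P.toSymSeq
  comp e _ _ x y := KProd.mk (O.comp e x.1 fun i => (y i).1) (P.comp e x.2 fun i => (y i).2)
  unit V := KProd.mk (O.unit V) (P.unit V)
  continuous_comp e _ _ T _ _ _ _ _ ha hb := KProd.continuous_mk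
    (O.continuous_comp e T _ _ (KProd.continuous_fst.comp ha)
      fun i => KProd.continuous_fst.comp (hb i))
    (P.continuous_comp e T _ _ (KProd.continuous_snd.comp ha)
      fun i => KProd.continuous_snd.comp (hb i))
  comp_map e _ _ _ _ φ ψ x y := Prod.ext (O.comp_map e φ ψ x.1 fun i => (y i).1)
    (P.comp_map e φ ψ x.2 fun i => (y i).2)
  comp_act_out e _ _ σ x y := Prod.ext (O.comp_act_out e σ x.1 fun i => (y i).1)
    (P.comp_act_out e σ x.2 fun i => (y i).2)
  comp_act_in e _ _ τ x y := Prod.ext (O.comp_act_in e τ x.1 fun i => (y i).1)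
    (P.comp_act_in e τ x.2 fun i => (y i).2)
  comp_act e _ _ σ x y := Prod.ext (O.comp_act e σ x.1 fun i => (y i).1)
    (P.comp_act e σ x.2 fun i => (y i).2)
  comp_assoc e f h g H _ _ _ x y z :=
    Prod.ext (O.comp_assoc e f h g H x.1 (fun i => (y i).1) fun i => (z i).1)
      (P.comp_assoc e f h g H x.2 (fun i => (y i).2) fun i => (z i).2)
  unit_map φ := Prod.ext (O.unit_map φ) (P.unit_map φ)
  unit_comp e h _ _ y := Prod.ext (O.unit_comp e h y.1) (P.unit_comp e h y.2)
  comp_unit e h _ _ x := Prod.ext (O.comp_unit e h x.1) (P.comp_unit e h x.2)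

/-- The first projection of a product of symmetric sequences. -/
def SymSeq.fst (M N : SymSeq) : (M.prod N).Hom M where
  app n V (p : KProd (M.at n V) (N.at n V)) := p.1
  continuous_app _ _ := KProd.continuous_fst
  naturality _ _ _ _ _ := rfl
  equivariant _ _ _ _ := rfl

/-- The second projection of a product of symmetric sequences. -/
def SymSeq.snd (M N : SymSeq) : (M.prod N).Hom N where
  app n V (p : KProd (M.at n V) (N.at n V)) := p.2
  continuous_app _ _ := KProd.continuous_snd
  naturality _ _ _ _ _ := rfl
  equivariant _ _ _ _ := rfl

/-- The first projection of a product of operads. -/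
def Operad.fst (O P : Operad) : O.prod P ⟶ O :=
  { SymSeq.fst O.toSymSeq P.toSymSeq with
    app_comp := fun _ _ _ _ _ => rfl
    app_unit := fun _ => rfl : Operad.Hom _ _ }

/-- The second projection of a product of operads. -/
def Operad.snd (O P : Operad) : O.prod P ⟶ P :=
  { SymSeq.snd O.toSymSeq P.toSymSeq with
    app_comp := fun _ _ _ _ _ => rfl
    app_unit := fun _ => rfl : Operad.Hom _ _ }

/-- The morphism into a product of operads with given components. -/
def Operad.lift {Q O P : Operad} (f : Q ⟶ O) (g : Q ⟶ P) : Q ⟶ O.prod P :=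
  { app := fun n V x => KProd.mk (f.app n V x) (g.app n V x)
    continuous_app := fun n V => continuous_from_compactlyGeneratedSpace _ fun _ _ _ _ _ hk =>
      KProd.continuous_mk ((f.continuous_app n V).comp hk) ((g.continuous_app n V).comp hk)
    naturality := fun n _ _ φ x => Prod.ext (f.naturality n φ x) (g.naturality n φ x)
    equivariant := fun n V σ x => Prod.ext (f.equivariant n V σ x) (g.equivariant n V σ x)
    app_comp := fun e _ _ x y => Prod.ext (f.app_comp e x y) (g.app_comp e x y)
    app_unit := fun V => Prod.ext (f.app_unit V) (g.app_unit V) : Operad.Hom _ _ }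

section Fixed

variable {G : Type} [Group G] [TopologicalSpace G] {n : ℕ}

theorem SymSeq.mem_fixed_prod {M N : SymSeq} {V : OrthRep G}
    {Γ : Subgroup (G × Equiv.Perm (Fin n))} {p : (M.prod N).at n V.space} :
    p ∈ (M.prod N).fixed V Γ ↔ p.1 ∈ M.fixed V Γ ∧ p.2 ∈ N.fixed V Γ :=
  ⟨fun h => ⟨fun γ hγ => congrArg Prod.fst (h γ hγ), fun γ hγ => congrArg Prod.snd (h γ hγ)⟩,
    fun h γ hγ => Prod.ext (h.1 γ hγ) (h.2 γ hγ)⟩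

variable {M N : SymSeq} {V : OrthRep G} {Γ : Subgroup (G × Equiv.Perm (Fin n))}

/-- The projection `(M × N)_n(V)^Γ → M_n(V)^Γ`. -/
abbrev SymSeq.fixedFst : C((M.prod N).fixed V Γ, M.fixed V Γ) := (SymSeq.fst M N).fixedApp V Γ

/-- The projection `(M × N)_n(V)^Γ → N_n(V)^Γ`. -/
abbrev SymSeq.fixedSnd : C((M.prod N).fixed V Γ, N.fixed V Γ) := (SymSeq.snd M N).fixedApp V Γ

/-- The map from a compact Hausdorff space into the fixed points of a product with given
components. -/
def SymSeq.fixedPair {T : Type} [TopologicalSpace T] [CompactSpace T] [T2Space T]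
    (f : C(T, M.fixed V Γ)) (g : C(T, N.fixed V Γ)) : C(T, (M.prod N).fixed V Γ) where
  toFun t := ⟨KProd.mk (f t).1 (g t).1, SymSeq.mem_fixed_prod.2 ⟨(f t).2, (g t).2⟩⟩
  continuous_toFun := (KProd.continuous_mk (continuous_subtype_val.comp f.continuous)
    (continuous_subtype_val.comp g.continuous)).subtype_mk _

/-- The composite of two embeddings of representations. -/
def OrthRep.Embedding.trans {U V W : OrthRep G} (φ : U.Embedding V) (ψ : V.Embedding W) :
    U.Embedding W where
  toIsom := ψ.toIsom.comp φ.toIsom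
  equivariant g v := by
    exact (congrArg ψ.toIsom (φ.equivariant g v)).trans (ψ.equivariant g _)

theorem SymSeq.fixedMap_trans (M : SymSeq) {U V W : OrthRep G} (φ : U.Embedding V)
    (ψ : V.Embedding W) (x : M.fixed U Γ) :
    M.fixedMap (φ.trans ψ) Γ x = M.fixedMap ψ Γ (M.fixedMap φ Γ x) :=
  Subtype.ext ((M.space n).map_comp _ _ _)

/-- Filling a sphere in the second factor of a product whose first component is already filled. -/
theorem SymSeq.exists_lift_prod [IsCompactLieGroup G] (hN : N.IsNInfinity)
    (hΓ : Γ ∈ N.admissible G n) (V : OrthRep G) (l : ℕ)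
    (α : C(discBoundary l, (M.prod N).fixed V Γ)) {W : OrthRep G} (ψ : V.Embedding W)
    (lam : C(Disc l, M.fixed W Γ))
    (h : ∀ t : discBoundary l, lam t = M.fixedMap ψ Γ (SymSeq.fixedFst (α t))) :
    ∃ (W' : OrthRep G) (φ : W.Embedding W') (lam' : C(Disc l, (M.prod N).fixed W' Γ)),
      (∀ t : discBoundary l, lam' t = (M.prod N).fixedMap (ψ.trans φ) Γ (α t)) ∧
        ∀ t, SymSeq.fixedFst (lam' t) = M.fixedMap φ Γ (lam t) := by
  obtain ⟨W', φ, μ, hμ⟩ := hN.extend G n Γ hΓ W l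
    (((N.fixedMap ψ Γ).comp SymSeq.fixedSnd).comp α)
  refine ⟨W', φ, SymSeq.fixedPair ((M.fixedMap φ Γ).comp lam) μ, fun t => ?_, fun t => rfl⟩
  refine Subtype.ext (Prod.ext ?_ ?_)
  · refine (congrArg (fun x => (M.fixedMap φ Γ x).1) (h t)).trans ?_
    exact congrArg Subtype.val (M.fixedMap_trans ψ φ (SymSeq.fixedFst (α t))).symm
  · refine (congrArg Subtype.val (hμ t)).trans ?_
    exact congrArg Subtype.val (N.fixedMap_trans ψ φ (SymSeq.fixedSnd (α t))).symm

end Fixed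

/-- The product of `N_∞`-symmetric sequences is `N_∞`: spheres are filled in one factor at a
time. -/
theorem SymSeq.IsNInfinity.prod {M N : SymSeq} (hM : M.IsNInfinity) (hN : N.IsNInfinity) :
    (M.prod N).IsNInfinity where
  nonempty n := by
    obtain ⟨V, ⟨x⟩⟩ := hM.nonempty n
    obtain ⟨W, ⟨y⟩⟩ := hN.nonempty n
    exact ⟨V.dsum fun _ : Fin 1 => W,
      ⟨KProd.mk (M.map (InnSpace.dinl V _) x) (N.map (InnSpace.dinr V W) y)⟩⟩
  extend G _ _ _ n Γ hΓ V l α := by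
    obtain ⟨hg, U, p, hp⟩ := hΓ
    obtain ⟨h₁, h₂⟩ := SymSeq.mem_fixed_prod.1 hp
    obtain ⟨W, ψ, lam, h⟩ := hM.extend G n Γ ⟨hg, U, _, h₁⟩ V l (SymSeq.fixedFst.comp α)
    obtain ⟨W', φ, lam', h', -⟩ :=
      SymSeq.exists_lift_prod hN ⟨hg, U, _, h₂⟩ V l α ψ lam h
    exact ⟨W', ψ.trans φ, lam', h'⟩

/-- The identity embedding of a representation. -/
def OrthRep.Embedding.refl {G : Type} [Group G] [TopologicalSpace G] (V : OrthRep G) :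
    V.Embedding V where
  toIsom := LinearIsometry.id
  equivariant _ _ := rfl

theorem SymSeq.fixedMap_refl (M : SymSeq) {G : Type} [Group G] [TopologicalSpace G] {n : ℕ}
    {Γ : Subgroup (G × Equiv.Perm (Fin n))} {V : OrthRep G} (x : M.fixed V Γ) :
    M.fixedMap (OrthRep.Embedding.refl V) Γ x = x :=
  Subtype.ext ((M.space n).map_id _ _)

/-- All graph subgroups that are admissible for `M` are admissible for `N`. -/
def SymSeq.AdmissibleLE (M N : SymSeq) : Prop :=
  ∀ (G : Type) [Group G] [TopologicalSpace G] [IsCompactLieGroup G] (n : ℕ),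
    M.admissible G n ⊆ N.admissible G n

/-- If all graph subgroups admissible for `O` are admissible for `P`, the projection `O × P → O` is
an equivalence: the fixed points of `P` that occur are contractible in the colimit. -/
theorem Operad.isEquivalence_fst {O P : Operad} (hP : P.toSymSeq.IsNInfinity)
    (h : O.AdmissibleLE P.toSymSeq) : (Operad.Hom.toHom (O.fst P)).IsEquivalence := by
  intro n G _ _ _ Γ hΓ V l α β hαβ
  have hadm : Γ ∈ O.admissible G n :=
    ⟨hΓ, V, _, (β ⟨0, Metric.mem_closedBall_self zero_le_one⟩).2⟩
  obtain ⟨W, ψ, lam, h₁, h₂⟩ := SymSeq.exists_lift_prod hP (h G n hadm) V l α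
    (OrthRep.Embedding.refl V) β fun t =>
      ((O.fixedMap_refl _).trans (hαβ t)).symm
  refine ⟨W, (OrthRep.Embedding.refl V).trans ψ, lam, h₁, ?_⟩
  have e : ((Operad.Hom.toHom (O.fst P)).fixedApp W Γ).comp lam =
      (O.fixedMap ((OrthRep.Embedding.refl V).trans ψ) Γ).comp β := by
    ext t
    exact congrArg Subtype.val (h₂ t)
  rw [e]
  exact ContinuousMap.HomotopicRel.refl _

/-! ### Composition of operations fixed by a group -/

namespace SymSeq

/-- The operation of relabelling the inputs along a bijection `Fin n ≃ Fin m`; this is the action of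
`Σ_n`, up to the identification of `n` with `m`. -/
def relabel (M : SymSeq) {V : InnSpace} {n m : ℕ} (t : Fin n ≃ Fin m) (x : M.at n V) : M.at m V :=
  cast (congrArg (fun k => M.at k V) (Fin.equiv_iff_eq.1 ⟨t⟩))
    (M.act (t.trans (finCongr (Fin.equiv_iff_eq.1 ⟨t⟩).symm)) x)

/-- The homomorphism `σ : G → Σ_n` has a fixed point in `M_n(V)` for some representation `V`. -/
def FixedBy (M : SymSeq) {G : Type} [Group G] [TopologicalSpace G] {n : ℕ}
    (σ : G →* Equiv.Perm (Fin n)) : Prop :=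
  ∃ (V : OrthRep G) (x : M.at n V.space), ∀ g,
    M.act (σ g) (M.map (V.ρ g).toLinearIsometry x) = x

end SymSeq

/-- Balancedness of the composition with respect to relabellings of the inner operations. -/
theorem Operad.comp_relabel_in (O : Operad) {k : ℕ} {n n' : Fin k → ℕ} {N : ℕ}
    (e : (Σ i, Fin (n' i)) ≃ Fin N) {V : InnSpace} {W : Fin k → InnSpace}
    (t : ∀ i, Fin (n i) ≃ Fin (n' i)) (x : O.at k V) (y : ∀ i, O.at (n i) (W i)) :
    O.comp e x (fun i => O.relabel (t i) (y i)) =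
      O.comp ((Equiv.sigmaCongrRight t).trans e) x y := by
  obtain rfl : n = n' := funext fun i => Fin.equiv_iff_eq.1 ⟨t i⟩
  exact O.comp_act_in e t x y

namespace InnSpace

theorem continuous_dmk {V : InnSpace} {k : ℕ} {W : Fin k → InnSpace} :
    Continuous fun p : V × (∀ i, W i) => (dmk p.1 p.2 : V.dsum W) :=
  (WithLp.prod_continuous_toLp 2 V.carrier (PiLp 2 fun i => (W i).carrier)).comp
    (continuous_fst.prodMk ((PiLp.continuous_toLp 2 fun i => (W i).carrier).comp continuous_snd))

theorem continuous_dfst {V : InnSpace} {k : ℕ} {W : Fin k → InnSpace} :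
    Continuous fun x : V.dsum W => dfst x :=
  continuous_fst.comp (WithLp.prod_continuous_ofLp 2 V.carrier (PiLp 2 fun i => (W i).carrier))

theorem continuous_dcomp {V : InnSpace} {k : ℕ} {W : Fin k → InnSpace} (i : Fin k) :
    Continuous fun x : V.dsum W => dcomp x i :=
  ((continuous_apply i).comp (PiLp.continuous_ofLp 2 fun i => (W i).carrier)).comp
    (continuous_snd.comp
      (WithLp.prod_continuous_ofLp 2 V.carrier (PiLp 2 fun i => (W i).carrier)))

theorem dsum_ext {V : InnSpace} {k : ℕ} {W : Fin k → InnSpace} {x y : V.dsum W}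
    (h : dfst x = dfst y) (h' : ∀ i, dcomp x i = dcomp y i) : x = y := by
  have hx : ∀ z : V.dsum W, z = dmk (dfst z) (dcomp z) := fun _ => rfl
  rw [hx x, hx y, h, funext h']

end InnSpace

open InnSpace

/-- A strongly continuous multiplicative family of linear isometries is a representation. -/
def OrthRep.mk' {G : Type} [Group G] [TopologicalSpace G] (E : InnSpace) (R : G → E →ₗᵢ[ℝ] E)
    (h₁ : ∀ x, R 1 x = x) (h₂ : ∀ g h x, R (g * h) x = R g (R h x))
    (hc : Continuous fun p : G × E => R p.1 p.2) : OrthRep G where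
  space := E
  ρ :=
    { toFun := fun g =>
        { toLinearEquiv := LinearEquiv.ofLinearMap (R g).toLinearMap (R g⁻¹).toLinearMap
            (LinearMap.ext fun x => by
              change R g (R g⁻¹ x) = x
              rw [← h₂, mul_inv_cancel, h₁])
            (LinearMap.ext fun x => by
              change R g⁻¹ (R g x) = x
              rw [← h₂, inv_mul_cancel, h₁])
          norm_map' := (R g).norm_map }
      map_one' := LinearIsometryEquiv.ext h₁
      map_mul' := fun g h => LinearIsometryEquiv.ext (h₂ g h) }
  continuous_ρ := hc

section Comp

variable {G : Type} [Group G] [TopologicalSpace G] {k : ℕ}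

/-- The isometry of `V ⊕ W^k` given by an isometry of `V` and a permutation of the coordinates of
`W^k`, twisted by isometries of `W`. -/
def twistedPerm (V W : InnSpace) (f : V →ₗᵢ[ℝ] V) (σ : Equiv.Perm (Fin k))
    (r : Fin k → W →ₗᵢ[ℝ] W) : V.dsum (fun _ : Fin k => W) →ₗᵢ[ℝ] V.dsum fun _ : Fin k => W where
  toFun x := dmk (f (dfst x)) fun i => r (σ.symm i) (dcomp x (σ.symm i))
  map_add' x y := dsum_ext (map_add f _ _) fun i => map_add (r (σ.symm i)) _ _
  map_smul' c x := dsum_ext (map_smul f c _) fun i => map_smul (r (σ.symm i)) c _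
  norm_map' x := norm_eq_of_sq (by
    refine (norm_sq_dmk _ _).trans ?_
    rw [norm_sq_dsum x]
    simp only [LinearIsometry.norm_map]
    rw [Equiv.sum_comp σ.symm fun i => ‖dcomp x i‖ ^ 2])

/-- The representation `V ⊕ W^k`, where `G` permutes the coordinates of `W^k` through `σ`, twisted
by a cocycle `r` of isometries of `W`.  (For a transitive action it is the sum of `V` and the
representation induced from a representation of the stabilizer on `W`.) -/
def OrthRep.twistedSum (V : OrthRep G) (W : InnSpace) (σ : G →* Equiv.Perm (Fin k))
    (hσ : ∀ i j, IsOpen {g | σ g i = j}) (r : G → Fin k → W →ₗᵢ[ℝ] W)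
    (hr₁ : ∀ i w, r 1 i w = w) (hr₂ : ∀ g h i w, r (g * h) i w = r g (σ h i) (r h i w))
    (hrc : ∀ i, Continuous fun p : G × W => r p.1 i p.2) : OrthRep G :=
  OrthRep.mk' (V.space.dsum fun _ : Fin k => W)
    (fun g => twistedPerm V.space W (V.ρ g).toLinearIsometry (σ g) (r g))
    (fun x => dsum_ext (by
        change V.ρ 1 (dfst x) = _
        rw [map_one]; rfl)
      (fun i => by
        change r 1 ((σ 1).symm i) (dcomp x ((σ 1).symm i)) = _
        rw [hr₁, map_one]; rfl))
    (fun g h x => dsum_ext (by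
        change V.ρ (g * h) (dfst x) = _
        rw [map_mul]; rfl)
      (fun i => by
        change r (g * h) ((σ (g * h)).symm i) (dcomp x ((σ (g * h)).symm i)) =
          r g ((σ g).symm i)
            (r h ((σ h).symm ((σ g).symm i)) (dcomp x ((σ h).symm ((σ g).symm i))))
        have e : (σ (g * h)).symm i = (σ h).symm ((σ g).symm i) := by
          rw [map_mul]; rfl
        rw [e, hr₂, Equiv.apply_symm_apply]))
    (by
      refine continuous_dmk.comp (Continuous.prodMk
        (V.continuous_ρ.comp (continuous_fst.prodMk (continuous_dfst.comp continuous_snd)))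
        (continuous_pi fun i => ?_))
      refine continuous_iff_continuousAt.2 fun p => ?_
      have hj : (σ p.1) ((σ p.1).symm i) = i := Equiv.apply_symm_apply _ _
      have hcont : Continuous fun q : G × V.space.dsum (fun _ : Fin k => W) =>
          r q.1 ((σ p.1).symm i) (dcomp q.2 ((σ p.1).symm i)) :=
        (hrc _).comp (continuous_fst.prodMk ((continuous_dcomp _).comp continuous_snd))
      refine hcont.continuousAt.congr ?_
      filter_upwards [((hσ ((σ p.1).symm i) i).preimage continuous_fst).mem_nhds hj] with q hq
      have hq' : (σ q.1).symm i = (σ p.1).symm i := by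
        rw [Equiv.symm_apply_eq]; exact hq.symm
      change _ = r q.1 ((σ q.1).symm i) (dcomp q.2 ((σ q.1).symm i))
      rw [hq'])

/-- Composing an operation `x` fixed by `σ : G → Σ_k` with operations `y i` that are permuted by `G`
compatibly with `σ` gives a fixed operation. -/
theorem Operad.fixedBy_comp (O : Operad) {n : Fin k → ℕ} {N : ℕ}
    (e : (Σ i, Fin (n i)) ≃ Fin N) {σ : G →* Equiv.Perm (Fin k)}
    (hσ : ∀ i j, IsOpen {g | σ g i = j}) (hx : O.FixedBy σ) {W : InnSpace}
    (r : G → Fin k → W →ₗᵢ[ℝ] W)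
    (hr₁ : ∀ i w, r 1 i w = w) (hr₂ : ∀ g h i w, r (g * h) i w = r g (σ h i) (r h i w))
    (hrc : ∀ i, Continuous fun p : G × W => r p.1 i p.2)
    (t : ∀ g i, Fin (n i) ≃ Fin (n (σ g i))) (y : ∀ i, O.at (n i) W)
    (hy : ∀ g i, y (σ g i) = O.relabel (t g i) (O.map (r g i) (y i)))
    {τ : G →* Equiv.Perm (Fin N)} (hτ : ∀ g i j, τ g (e ⟨i, j⟩) = e ⟨σ g i, t g i j⟩) :
    O.FixedBy τ := by
  obtain ⟨V, x, hx⟩ := hx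
  refine ⟨V.twistedSum W σ hσ r hr₁ hr₂ hrc, O.comp (W := fun _ => W) e x y, fun g => ?_⟩
  have hperm : Function.Injective
      (O.map (n := N) (dperm V.space (fun _ => W) (σ g))) := by
    have hinv : (dperm V.space (fun _ => W) (σ g)⁻¹).comp (dperm V.space (fun _ => W) (σ g)) =
        LinearIsometry.id := LinearIsometry.ext fun x => dsum_ext rfl fun i =>
      congrArg (dcomp x) (Equiv.apply_symm_apply (σ g) i)
    intro a b (hab : (O.space N).map _ a = (O.space N).map _ b)
    rw [← (O.space N).map_id _ a, ← hinv, (O.space N).map_comp, hab, ← (O.space N).map_comp, hinv,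
      (O.space N).map_id]
  -- It suffices to compare both sides after the symmetry isometry `V ⊕ W^k → V ⊕ W^k`; this is the
  -- form in which the `Σ_k`-invariance of the composition is available.
  apply hperm
  have hR : (dperm V.space (fun _ => W) (σ g)).comp
      (twistedPerm V.space W (V.ρ g).toLinearIsometry (σ g) (r g)) =
      dsumMap (V.ρ g).toLinearIsometry (r g) := LinearIsometry.ext fun x => dsum_ext rfl fun i => by
    change r g ((σ g).symm (σ g i)) (dcomp x ((σ g).symm (σ g i))) = r g i (dcomp x i)
    rw [Equiv.symm_apply_apply]
  have he : (Equiv.sigmaCongrRight (t g)).trans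
      ((Equiv.sigmaCongrLeft (β := fun i => Fin (n i)) (σ g)).trans e) = e.trans (τ g) :=
    Equiv.ext fun ⟨i, j⟩ => (hτ g i j).symm
  calc O.map (dperm V.space (fun _ => W) (σ g)) (O.act (τ g)
        (O.map (twistedPerm V.space W (V.ρ g).toLinearIsometry (σ g) (r g))
          (O.comp (W := fun _ => W) e x y)))
      = O.act (τ g) (O.map (dsumMap (V.ρ g).toLinearIsometry (r g))
          (O.comp (W := fun _ => W) e x y)) := by
        refine (O.act_map _ _ _).symm.trans (congrArg (O.act (τ g)) ?_)
        exact ((O.space N).map_comp _ _ _).symm.trans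
          (congrArg (fun φ => (O.space N).map φ (O.comp (W := fun _ => W) e x y)) hR)
    _ = O.comp (W := fun _ => W) (e.trans (τ g)) (O.map (V.ρ g).toLinearIsometry x)
          fun i => O.map (r g i) (y i) := by
        rw [← O.comp_map, O.comp_act_out]
    _ = O.comp (W := fun _ => W) (n := fun i => n (σ g i))
          ((Equiv.sigmaCongrLeft (β := fun i => Fin (n i)) (σ g)).trans e)
          (O.map (V.ρ g).toLinearIsometry x) fun i => y (σ g i) := by
        rw [← he]
        refine (O.comp_relabel_in _ (t g) _ _).symm.trans ?_
        congr 1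
        funext i
        exact (hy g i).symm
    _ = O.map (dperm V.space (fun _ => W) (σ g)) (O.comp (W := fun _ => W) e
          (O.act (σ g) (O.map (V.ρ g).toLinearIsometry x)) y) :=
        (O.comp_act (W := fun _ => W) e (σ g) _ y).symm
    _ = _ := by rw [hx]

end Comp

/-! ### The transfer system of an operad -/

section Fixed

variable {G : Type} [Group G] [TopologicalSpace G] {k : ℕ}

/-- The pullback of a representation along a continuous homomorphism. -/
def OrthRep.comap {H : Type} [Group H] [TopologicalSpace H] (V : OrthRep H) (θ : G →* H)
    (hθ : Continuous θ) : OrthRep G where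
  space := V.space
  ρ := V.ρ.comp θ
  continuous_ρ := V.continuous_ρ.comp (hθ.prodMap continuous_id)

/-- The trivial representation on an inner product space. -/
def OrthRep.trivial (G : Type) [Group G] [TopologicalSpace G] (V : InnSpace) : OrthRep G where
  space := V
  ρ := 1
  continuous_ρ := continuous_snd

theorem SymSeq.FixedBy.comap {M : SymSeq} {H : Type} [Group H] [TopologicalSpace H]
    {σ : H →* Equiv.Perm (Fin k)} (h : M.FixedBy σ) {θ : G →* H} (hθ : Continuous θ) :
    M.FixedBy (σ.comp θ) := by
  obtain ⟨V, x, hx⟩ := h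
  exact ⟨V.comap θ hθ, x, fun g => hx (θ g)⟩

theorem SymSeq.fixedBy_one {M : SymSeq} (h : ∃ V : InnSpace, Nonempty (M.at k V)) :
    M.FixedBy (1 : G →* Equiv.Perm (Fin k)) := by
  obtain ⟨V, ⟨x⟩⟩ := h
  exact ⟨OrthRep.trivial G V, x, fun _ => (M.act_one _).trans ((M.space k).map_id V x)⟩

/-- Operations of arity at most one: a given operation in arity zero, the unit in arity one.  They
are what is plugged into the inputs of an operation in order to forget or to keep them. -/
def Operad.smallOp (O : Operad) {W : InnSpace} (pt : O.at 0 W) : ∀ n : ℕ, n ≤ 1 → O.at n W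
  | 0, _ => pt
  | 1, _ => O.unit W
  | _ + 2, h => absurd h (by omega)

theorem Operad.relabel_smallOp (O : Operad) {W : InnSpace} (pt : O.at 0 W) {n m : ℕ} (hn : n ≤ 1)
    (hm : m ≤ 1) (t : Fin n ≃ Fin m) :
    O.smallOp pt m hm = O.relabel t (O.map LinearIsometry.id (O.smallOp pt n hn)) := by
  obtain rfl := Fin.equiv_iff_eq.1 ⟨t⟩
  have ht : t = 1 := by
    have : Subsingleton (Fin n) := Fin.subsingleton_iff_le_one.2 hn
    exact Subsingleton.elim _ _
  rw [ht]
  refine Eq.symm ?_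
  exact (O.act_one _).trans ((O.space n).map_id W _)

/-- If a `G`-set is realized by a fixed operation, so is every `G`-subset: plug the unit into the
inputs in the subset, and an operation of arity zero into the others. -/
theorem Operad.fixedBy_of_injective (O : Operad) (h₀ : ∃ V : InnSpace, Nonempty (O.at 0 V))
    {σ : G →* Equiv.Perm (Fin k)} (hσ : ∀ i j, IsOpen {g | σ g i = j}) (hx : O.FixedBy σ)
    {m : ℕ} {τ : G →* Equiv.Perm (Fin m)} {ι : Fin m → Fin k} (hι : Function.Injective ι)
    (h : ∀ g j, ι (τ g j) = σ g (ι j)) : O.FixedBy τ := by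
  obtain ⟨W, ⟨pt⟩⟩ := h₀
  have hle : ∀ i, Nat.card {j // ι j = i} ≤ 1 := fun i => by
    have : Subsingleton {j // ι j = i} := ⟨fun a b => Subtype.ext (hι (a.2.trans b.2.symm))⟩
    exact Finite.card_le_one_iff_subsingleton.2 this
  let c : ∀ i, {j // ι j = i} ≃ Fin (Nat.card {j // ι j = i}) := fun i => Finite.equivFin _
  let f : ∀ g i, {j // ι j = i} ≃ {j // ι j = σ g i} := fun g i =>
    (τ g).subtypeEquiv fun j => by rw [h, (σ g).injective.eq_iff]
  refine O.fixedBy_comp (n := fun i => Nat.card {j // ι j = i})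
    ((Equiv.sigmaCongrRight fun i => (c i).symm).trans (Equiv.sigmaFiberEquiv ι)) hσ hx
    (W := W) (fun _ _ => LinearIsometry.id) (fun _ _ => rfl) (fun _ _ _ _ => rfl)
    (fun _ => continuous_snd) (fun g i => ((c i).symm.trans (f g i)).trans (c (σ g i)))
    (fun i => O.smallOp pt _ (hle i)) (fun g i => O.relabel_smallOp pt _ _ _) ?_
  intro g i j
  change τ g ((c i).symm j).1 = ((c (σ g i)).symm ((c (σ g i)) (f g i ((c i).symm j)))).1
  rw [Equiv.symm_apply_apply]
  rfl

/-- The direct sum of representations. -/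
def OrthRep.dsum (V : OrthRep G) (W : Fin k → OrthRep G) : OrthRep G :=
  OrthRep.mk' (V.space.dsum fun i => (W i).space)
    (fun g => dsumMap (V.ρ g).toLinearIsometry fun i => ((W i).ρ g).toLinearIsometry)
    (fun x => dsum_ext (by
        change V.ρ 1 (dfst x) = _
        rw [map_one]; rfl)
      (fun i => by
        change (W i).ρ 1 (dcomp x i) = _
        rw [map_one]; rfl))
    (fun g h x => dsum_ext (by
        change V.ρ (g * h) (dfst x) = _
        rw [map_mul]; rfl)
      (fun i => by
        change (W i).ρ (g * h) (dcomp x i) = _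
        rw [map_mul]; rfl))
    (continuous_dmk.comp (Continuous.prodMk
        (V.continuous_ρ.comp (continuous_fst.prodMk (continuous_dfst.comp continuous_snd)))
        (continuous_pi fun i => (W i).continuous_ρ.comp
          (continuous_fst.prodMk ((continuous_dcomp i).comp continuous_snd)))))

/-- The inclusion of the `i`-th summand of a direct sum. -/
def dincl (V : InnSpace) (W : Fin k → InnSpace) (i : Fin k) : W i →ₗᵢ[ℝ] V.dsum W where
  toFun w := dmk 0 (Pi.single i w)
  map_add' x y := dsum_ext (add_zero (0 : V)).symm fun j =>
    congrFun (Pi.single_add (f := fun i => (W i).carrier) i x y) j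
  map_smul' c x := dsum_ext (smul_zero (A := V.carrier) c).symm fun j =>
    congrFun (Pi.single_smul (f := fun i => (W i).carrier) i c x) j
  norm_map' x := norm_eq_of_sq (by
    refine (norm_sq_dmk _ _).trans ?_
    rw [Finset.sum_eq_single i]
    · simp
    · intro j _ hj
      simp [Pi.single_eq_of_ne hj]
    · simp)

/-- The inclusion of a summand is an embedding of representations. -/
def OrthRep.dincl (V : OrthRep G) (W : Fin k → OrthRep G) (i : Fin k) :
    (W i).Embedding (V.dsum W) where
  toIsom := GlobalOperads.dincl V.space (fun i => (W i).space) i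
  equivariant g w := dsum_ext (map_zero (V.ρ g)).symm fun j => by
    change (Pi.single i ((W i).ρ g w) : ∀ j, (W j).space) j =
      (W j).ρ g ((Pi.single i w : ∀ j, (W j).space) j)
    by_cases hj : j = i
    · subst hj; simp
    · simp [Pi.single_eq_of_ne hj]

/-- Fixed points can be pushed forward along embeddings of representations. -/
theorem SymSeq.fixed_map {M : SymSeq} {σ : G →* Equiv.Perm (Fin k)} {V W : OrthRep G}
    (ψ : V.Embedding W) {x : M.at k V.space}
    (h : ∀ g, M.act (σ g) (M.map (V.ρ g).toLinearIsometry x) = x) (g : G) :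
    M.act (σ g) (M.map (W.ρ g).toLinearIsometry (M.map ψ.toIsom x)) = M.map ψ.toIsom x := by
  have e : (W.ρ g).toLinearIsometry.comp ψ.toIsom =
      ψ.toIsom.comp (V.ρ g).toLinearIsometry :=
    LinearIsometry.ext fun v => (ψ.equivariant g v).symm
  rw [SymSeq.map, SymSeq.map, ← (M.space k).map_comp, e, (M.space k).map_comp, M.act_map, h]

/-- A disjoint union of realized `G`-sets is realized. -/
theorem Operad.fixedBy_sigma (O : Operad) (hk : ∃ V : InnSpace, Nonempty (O.at k V))
    {n : Fin k → ℕ} {N : ℕ} (e : (Σ i, Fin (n i)) ≃ Fin N)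
    {t : ∀ i, G →* Equiv.Perm (Fin (n i))} {τ : G →* Equiv.Perm (Fin N)}
    (hτ : ∀ g i j, τ g (e ⟨i, j⟩) = e ⟨i, t i g j⟩) (h : ∀ i, O.FixedBy (t i)) :
    O.FixedBy τ := by
  choose W x hx using h
  let Z : OrthRep G := OrthRep.trivial G ⟨EuclideanSpace ℝ (Fin 0)⟩
  refine O.fixedBy_comp (n := n) e (σ := 1) (fun i j => isOpen_const (p := i = j))
    (SymSeq.fixedBy_one hk) (W := (Z.dsum W).space)
    (fun g _ => ((Z.dsum W).ρ g).toLinearIsometry) (fun _ w => ?_) (fun g h _ w => ?_)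
    (fun _ => (Z.dsum W).continuous_ρ) (fun g i => t i g)
    (fun i => O.map (Z.dincl W i).toIsom (x i))
    (fun g i => (SymSeq.fixed_map (Z.dincl W i) (hx i) g).symm) hτ
  · change (Z.dsum W).ρ 1 w = w
    rw [map_one]; rfl
  · change (Z.dsum W).ρ (g * h) w = _
    rw [map_mul]; rfl

end Fixed

/-! ### Actions on cosets -/

section Cosets

variable {G : Type} [Group G]

/-- The action of `G` on `G/H`, with respect to an ordering of `G/H`. -/
abbrev cosetPerm {H : Subgroup G} {k : ℕ} (a : G ⧸ H ≃ Fin k) : G →* Equiv.Perm (Fin k) :=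
  a.permCongrHom.toMonoidHom.comp (MulAction.toPermHom G (G ⧸ H))

theorem cosetPerm_apply {H : Subgroup G} {k : ℕ} (a : G ⧸ H ≃ Fin k) (g : G) (x : G ⧸ H) :
    cosetPerm a g (a x) = a (g • x) := by
  change a (g • a.symm (a x)) = _
  rw [Equiv.symm_apply_apply]

variable [TopologicalSpace G]

theorem isOpen_cosetPerm [IsTopologicalGroup G] {H : Subgroup G} [H.FiniteIndex]
    (hH : IsClosed (H : Set G)) {k : ℕ} (a : G ⧸ H ≃ Fin k) (i j : Fin k) :
    IsOpen {g | cosetPerm a g i = j} := by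
  obtain ⟨x, rfl⟩ := a.surjective i
  obtain ⟨y, rfl⟩ := a.surjective j
  obtain ⟨x, rfl⟩ := QuotientGroup.mk_surjective x
  obtain ⟨y, rfl⟩ := QuotientGroup.mk_surjective y
  have : {g | cosetPerm a g (a x) = a y} = (fun g => y⁻¹ * (g * x)) ⁻¹' (H : Set G) := by
    ext g
    rw [Set.mem_ofPred, cosetPerm_apply, a.injective.eq_iff, eq_comm]
    exact QuotientGroup.eq
  rw [this]
  exact (H.isOpen_of_isClosed_of_finiteIndex hH).preimage (by fun_prop)

theorem isGraphSubgroup_graph {k : ℕ} {φ : G →* Equiv.Perm (Fin k)}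
    (hφ : ∀ i j, IsOpen {g | φ g i = j}) : IsGraphSubgroup φ.graph where
  isClosed := by
    let _ : TopologicalSpace (Equiv.Perm (Fin k)) := ⊥
    have : DiscreteTopology (Equiv.Perm (Fin k)) := ⟨rfl⟩
    have hc : Continuous φ := by
      rw [continuous_discrete_rng]
      intro τ
      have : φ ⁻¹' {τ} = ⋂ i, {g | φ g i = τ i} := by
        ext g
        simp [Equiv.ext_iff]
      rw [this]
      exact isOpen_iInter_of_finite fun i => hφ i _
    exact isClosed_eq (hc.comp continuous_fst) continuous_snd
  trivial σ h := by
    rw [MonoidHom.mem_graph] at h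
    exact h.symm.trans (map_one φ)

theorem SymSeq.graph_mem_admissible {M : SymSeq} {k : ℕ} {φ : G →* Equiv.Perm (Fin k)} :
    φ.graph ∈ M.admissible G k ↔ IsGraphSubgroup φ.graph ∧ M.FixedBy φ := by
  refine and_congr_right fun _ => exists_congr fun V => ⟨?_, ?_⟩
  · rintro ⟨x, hx⟩
    exact ⟨x, fun g => hx (g, φ g) (MonoidHom.mem_graph.2 rfl)⟩
  · rintro ⟨x, hx⟩
    refine ⟨x, fun γ hγ => ?_⟩
    rw [MonoidHom.mem_graph] at hγ
    rw [← hγ]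
    exact hx _

/-- The graph of the action on a finite `G/K` is automatically a graph subgroup. -/
theorem SymSeq.admissibleTransfer_iff [IsTopologicalGroup G] {M : SymSeq} {K : Subgroup G} :
    M.AdmissibleTransfer G K ↔ IsClosed (K : Set G) ∧ K.FiniteIndex ∧
      ∃ (n : ℕ) (a : G ⧸ K ≃ Fin n), M.FixedBy (cosetPerm a) := by
  refine and_congr_right fun hc => and_congr_right fun hf => exists_congr fun n =>
    exists_congr fun a => ?_
  exact SymSeq.graph_mem_admissible.trans
    (and_iff_right (isGraphSubgroup_graph (isOpen_cosetPerm hc a)))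

/-- The restriction of a realized action to the orbit of a point is realized. -/
theorem Operad.fixedBy_orbit [IsTopologicalGroup G] (O : Operad)
    (h₀ : ∃ V : InnSpace, Nonempty (O.at 0 V)) {k : ℕ} {σ : G →* Equiv.Perm (Fin k)}
    (hσ : ∀ i j, IsOpen {g | σ g i = j}) (hx : O.FixedBy σ) {K : Subgroup G} {n : ℕ}
    (a : G ⧸ K ≃ Fin n) (i : Fin k) (hK : ∀ g, g ∈ K ↔ σ g i = i) :
    O.FixedBy (cosetPerm a) := by
  have key : ∀ g g' : G, σ g i = σ g' i ↔ (g : G ⧸ K) = g' := fun g g' => by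
    rw [QuotientGroup.eq, hK, map_mul, map_inv, Equiv.Perm.mul_apply, Equiv.Perm.inv_eq_iff_eq,
      eq_comm]
  have hι : ∀ g : G, σ (a.symm (a g)).out i = σ g i := fun g =>
    (key _ _).2 (by rw [Equiv.symm_apply_apply, QuotientGroup.out_eq'])
  refine O.fixedBy_of_injective h₀ hσ hx (ι := fun j => σ (a.symm j).out i) ?_ ?_
  · intro j j' hj
    have := (key _ _).1 hj
    rwa [QuotientGroup.out_eq', QuotientGroup.out_eq', a.symm.injective.eq_iff] at this
  · intro g j
    obtain ⟨x, rfl⟩ := a.surjective j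
    obtain ⟨x, rfl⟩ := QuotientGroup.mk_surjective x
    rw [cosetPerm_apply]
    change σ (a.symm (a ((g * x : G) : G ⧸ K))).out i = σ g (σ (a.symm (a x)).out i)
    rw [hι, hι, map_mul, Equiv.Perm.mul_apply]

end Cosets

theorem IsCompactLieGroup.isTopologicalGroup (G : Type) [Group G] [TopologicalSpace G]
    [h : IsCompactLieGroup G] : IsTopologicalGroup G := by
  obtain ⟨d, _, _⟩ := h.exists_lieGroup
  exact topologicalGroup_of_lieGroup (𝓡 d) ∞

section Trans

variable {G : Type} [Group G] {H : Subgroup G} {K : Subgroup H} {k m : ℕ}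

/-- For a chosen system of coset representatives, the element of `H` by which `g` differs on the
coset `i`. -/
def cosetCocycle (b : G ⧸ H ≃ Fin k) (g : G) (i : Fin k) : H :=
  ⟨(b.symm (cosetPerm b g i)).out⁻¹ * (g * (b.symm i).out), by
    obtain ⟨x, rfl⟩ := b.surjective i
    rw [cosetPerm_apply, Equiv.symm_apply_apply, Equiv.symm_apply_apply, ← QuotientGroup.eq,
      QuotientGroup.out_eq']
    conv_lhs => rw [← QuotientGroup.out_eq' x]
    rfl⟩

theorem out_mul_cosetCocycle (b : G ⧸ H ≃ Fin k) (g : G) (i : Fin k) :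
    (b.symm (cosetPerm b g i)).out * (cosetCocycle b g i : G) = g * (b.symm i).out :=
  mul_inv_cancel_left _ _

theorem cosetCocycle_one (b : G ⧸ H ≃ Fin k) (i : Fin k) : cosetCocycle b 1 i = 1 := by
  refine Subtype.ext (mul_left_cancel (a := (b.symm (cosetPerm b 1 i)).out) ?_)
  rw [out_mul_cosetCocycle, map_one]
  simp

theorem cosetCocycle_mul (b : G ⧸ H ≃ Fin k) (g h : G) (i : Fin k) :
    cosetCocycle b (g * h) i = cosetCocycle b g (cosetPerm b h i) * cosetCocycle b h i := by
  refine Subtype.ext (mul_left_cancel (a := (b.symm (cosetPerm b (g * h) i)).out) ?_)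
  rw [out_mul_cosetCocycle, map_mul, Equiv.Perm.mul_apply, Subgroup.coe_mul, ← mul_assoc,
    out_mul_cosetCocycle, mul_assoc g h, mul_assoc g, out_mul_cosetCocycle]

/-- The map `G/H × H/K → G/K` given by a choice of coset representatives of `H`. -/
def cosetMap (b : G ⧸ H ≃ Fin k) (c : H ⧸ K ≃ Fin m) (p : Σ _ : Fin k, Fin m) :
    G ⧸ K.map H.subtype :=
  ((b.symm p.1).out * ((c.symm p.2).out : H) : G)

theorem mk_eq_of_mk_eq {x y : H} (h : (x : H ⧸ K) = y) (g : G) :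
    ((g * x : G) : G ⧸ K.map H.subtype) = (g * y : G) := by
  rw [QuotientGroup.eq] at h ⊢
  refine ⟨_, h, ?_⟩
  simp [mul_assoc]

theorem cosetMap_bijective (b : G ⧸ H ≃ Fin k) (c : H ⧸ K ≃ Fin m) :
    Function.Bijective (cosetMap b c) := by
  constructor
  · rintro ⟨i, j⟩ ⟨i', j'⟩ h
    replace h := QuotientGroup.eq.1 h
    obtain ⟨x, hx, e⟩ := h
    have hi : i = i' := by
      apply b.symm.injective
      rw [← QuotientGroup.out_eq' (b.symm i), ← QuotientGroup.out_eq' (b.symm i'),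
        QuotientGroup.eq]
      have e' : (b.symm i).out⁻¹ * (b.symm i').out =
          (((c.symm j).out * x * ((c.symm j').out)⁻¹ : H) : G) := by
        have : (x : G) = _ := e
        rw [Subgroup.coe_mul, Subgroup.coe_mul, Subgroup.coe_inv, this]
        simp [mul_assoc]
      rw [e']
      exact Subtype.property _
    subst hi
    have hj : j = j' := by
      apply c.symm.injective
      rw [← QuotientGroup.out_eq' (c.symm j), ← QuotientGroup.out_eq' (c.symm j'),
        QuotientGroup.eq]
      have : x = (c.symm j).out⁻¹ * (c.symm j').out := Subtype.ext (by
        refine (show (x : G) = _ from e).trans ?_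
        simp [mul_assoc])
      rwa [← this]
    rw [hj]
  · intro q
    obtain ⟨g, rfl⟩ := QuotientGroup.mk_surjective q
    have hmem : ((g : G ⧸ H).out)⁻¹ * g ∈ H := by
      rw [← QuotientGroup.eq, QuotientGroup.out_eq']
    refine ⟨⟨b g, c ((⟨_, hmem⟩ : H) : H ⧸ K)⟩, ?_⟩
    have h := mk_eq_of_mk_eq (K := K) (x := (c.symm (c ((⟨_, hmem⟩ : H) : H ⧸ K))).out)
      (y := ⟨_, hmem⟩) (by rw [QuotientGroup.out_eq', Equiv.symm_apply_apply])
      ((b.symm (b g)).out)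
    refine h.trans ?_
    rw [Equiv.symm_apply_apply]
    simp

theorem smul_cosetMap (b : G ⧸ H ≃ Fin k) (c : H ⧸ K ≃ Fin m) (g : G) (i : Fin k) (j : Fin m) :
    g • cosetMap b c ⟨i, j⟩ =
      cosetMap b c ⟨cosetPerm b g i, cosetPerm c (cosetCocycle b g i) j⟩ := by
  have h := mk_eq_of_mk_eq (K := K)
    (x := (c.symm (cosetPerm c (cosetCocycle b g i) j)).out)
    (y := cosetCocycle b g i * (c.symm j).out) (by
      obtain ⟨y, rfl⟩ := c.surjective j
      rw [QuotientGroup.out_eq', cosetPerm_apply, Equiv.symm_apply_apply, Equiv.symm_apply_apply]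
      conv_lhs => rw [← QuotientGroup.out_eq' y]
      rfl)
    ((b.symm (cosetPerm b g i)).out)
  refine Eq.trans ?_ h.symm
  rw [Subgroup.coe_mul, ← mul_assoc, out_mul_cosetCocycle, mul_assoc]
  rfl

/-- Realizations of the `H`-set `H/K` and the `G`-set `G/H` compose to one of the `G`-set `G/K`; on
representations this uses induction from `H` to `G`. -/
theorem Operad.fixedBy_trans [TopologicalSpace G] [IsTopologicalGroup G] (O : Operad)
    [H.FiniteIndex] (hH : IsClosed (H : Set G)) (b : G ⧸ H ≃ Fin k) (c : H ⧸ K ≃ Fin m)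
    (hb : O.FixedBy (cosetPerm b)) (hc : O.FixedBy (cosetPerm c)) {N : ℕ}
    (a : G ⧸ K.map H.subtype ≃ Fin N) : O.FixedBy (cosetPerm a) := by
  obtain ⟨W, y, hy⟩ := hc
  have hcont : ∀ i, Continuous fun g => cosetCocycle b g i := fun i => by
    refine continuous_iff_continuousAt.2 fun g => ?_
    have h₁ : ContinuousAt
        (fun g' => (b.symm (cosetPerm b g i)).out⁻¹ * (g' * (b.symm i).out)) g := by fun_prop
    refine Topology.IsInducing.subtypeVal.continuousAt_iff.2 (h₁.congr ?_)
    filter_upwards [(isOpen_cosetPerm hH b i (cosetPerm b g i)).mem_nhds rfl] with g' hg'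
    change _ = (b.symm (cosetPerm b g' i)).out⁻¹ * (g' * (b.symm i).out)
    rw [show cosetPerm b g' i = cosetPerm b g i from hg']
  refine O.fixedBy_comp (n := fun _ => m)
    ((Equiv.ofBijective _ (cosetMap_bijective b c)).trans a) (isOpen_cosetPerm hH b) hb
    (W := W.space) (fun g i => (W.ρ (cosetCocycle b g i)).toLinearIsometry) (fun i w => ?_)
    (fun g h i w => ?_) (fun i => W.continuous_ρ.comp (((hcont i).comp continuous_fst).prodMk
      continuous_snd)) (fun g i => cosetPerm c (cosetCocycle b g i)) (fun _ => y)
    (fun g i => (hy _).symm) fun g i j => ?_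
  · change W.ρ _ w = w
    rw [cosetCocycle_one, map_one]; rfl
  · change W.ρ _ w = W.ρ _ (W.ρ _ w)
    rw [cosetCocycle_mul, map_mul]; rfl
  · change cosetPerm a g (a (cosetMap b c ⟨i, j⟩)) = a (cosetMap b c _)
    rw [cosetPerm_apply, smul_cosetMap]

end Trans

/-- The global transfer system of a global `N_∞`-operad. -/
def transferSystem (O : NInfinityOperad) : GlobalTransferSystem where
  rel H _ _ _ K := O.obj.AdmissibleTransfer H K
  isClosed _ _ _ _ _ h := h.1
  finiteIndex _ _ _ _ _ h := h.2.1
  refl H _ _ _ := by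
    have := IsCompactLieGroup.isTopologicalGroup H
    refine SymSeq.admissibleTransfer_iff.2 ⟨isClosed_univ, inferInstance, 1, ?_, ?_⟩
    · have : Subsingleton (H ⧸ (⊤ : Subgroup H)) := QuotientGroup.subsingleton_quotient_top
      have : Unique (H ⧸ (⊤ : Subgroup H)) := Unique.mk' _
      exact Equiv.ofUnique _ _
    · refine ⟨OrthRep.trivial H ⟨EuclideanSpace ℝ (Fin 0)⟩, O.obj.unit _, fun g => ?_⟩
      rw [O.obj.unit_map]
      refine Eq.trans (congrArg (fun σ => O.obj.act σ _) (Subsingleton.elim _ 1)) ?_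
      exact O.obj.act_one _
  trans G _ _ _ H _ K hK hH := by
    have := IsCompactLieGroup.isTopologicalGroup G
    have := IsCompactLieGroup.isTopologicalGroup H
    obtain ⟨hc₁, hf₁, m, c, hm⟩ := SymSeq.admissibleTransfer_iff.1 hK
    obtain ⟨hc₂, hf₂, k, b, hk⟩ := SymSeq.admissibleTransfer_iff.1 hH
    have hcard : Finite (G ⧸ K.map H.subtype) :=
      Finite.of_surjective _ (cosetMap_bijective b c).2
    refine SymSeq.admissibleTransfer_iff.2 ⟨?_, Subgroup.finiteIndex_of_finite_quotient,
      _, Finite.equivFin _, O.obj.fixedBy_trans hc₂ b c hk hm _⟩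
    rw [Subgroup.coe_map]
    exact hc₂.isClosedEmbedding_subtypeVal.isClosedMap _ hc₁
  comap G H _ _ _ _ _ _ θ hθ K hK := by
    have := IsCompactLieGroup.isTopologicalGroup G
    have := IsCompactLieGroup.isTopologicalGroup H
    obtain ⟨hc, hf, m, c, hm⟩ := SymSeq.admissibleTransfer_iff.1 hK
    have hfi : (K.comap θ).FiniteIndex := ⟨by
      rw [Subgroup.index_comap]
      exact Subgroup.FiniteIndex.index_ne_zero⟩
    refine SymSeq.admissibleTransfer_iff.2 ⟨hc.preimage hθ, hfi, _, Finite.equivFin _, ?_⟩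
    refine O.obj.fixedBy_orbit (O.property.nonempty 0) (σ := (cosetPerm c).comp θ)
      (fun i j => (isOpen_cosetPerm hc c i j).preimage hθ) (hm.comap hθ) _
      (c ((1 : H) : H ⧸ K)) fun g => ?_
    rw [MonoidHom.comp_apply, cosetPerm_apply, c.injective.eq_iff, Subgroup.mem_comap, eq_comm]
    change _ ↔ ((1 : H) : H ⧸ K) = ((θ g * 1 : H) : H ⧸ K)
    rw [QuotientGroup.eq]
    simp

/-- The transfer system depends functorially on the operad. -/
def transferFunctor : NInfinityOperad ⥤ GlobalTransferSystem where
  obj := transferSystem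
  map {O P} f := homOfLE fun H _ _ _ K hK => by
    obtain ⟨hc, hf, n, a, hg, V, x, hx⟩ := hK
    exact ⟨hc, hf, n, a, hg, V, _, (f.hom.fixedApp V _ ⟨x, hx⟩).2⟩

/-- Equivalences lift fixed points: apply the lifting property to the zero-dimensional disc. -/
theorem admissibleLE_of_isEquivalence {M N : SymSeq} {f : M.Hom N} (hf : f.IsEquivalence) :
    N.AdmissibleLE M := by
  rintro G _ _ _ n Γ ⟨hg, V, x, hx⟩
  have : IsEmpty (discBoundary 0) := ⟨fun t => by
    have h := t.2
    have e : ((t : Disc 0) : EuclideanSpace ℝ (Fin 0)) = 0 := Subsingleton.elim _ _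
    rw [Set.mem_ofPred, e, norm_zero] at h
    exact zero_ne_one h⟩
  obtain ⟨W, ψ, lam, -⟩ := hf n G Γ hg V 0
    ⟨fun t => isEmptyElim t, continuous_of_const fun t => isEmptyElim t⟩
    (ContinuousMap.const _ ⟨x, hx⟩) fun t => isEmptyElim t
  exact ⟨hg, W, _, (lam ⟨0, Metric.mem_closedBall_self zero_le_one⟩).2⟩

theorem isInvertedBy_transferFunctor : equivalences.IsInvertedBy transferFunctor := by
  intro O P f hf
  have hle : transferFunctor.obj P ≤ transferFunctor.obj O := fun H _ _ _ K hK => by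
    obtain ⟨hc, hfi, n, a, h⟩ := hK
    exact ⟨hc, hfi, n, a, admissibleLE_of_isEquivalence hf H n h⟩
  exact ⟨homOfLE hle, Subsingleton.elim _ _, Subsingleton.elim _ _⟩

/-! ### The Peter–Weyl theorem -/

section PeterWeyl

open MeasureTheory RealInnerProductSpace

section Averaging

variable {E : Type} [NormedAddCommGroup E] [InnerProductSpace ℝ E]

section Unitary

variable {G : Type} [Group G]

theorem unitary_mul_apply (U : G →* (E ≃ₗᵢ[ℝ] E)) (g h : G) (x : E) :
    U (g * h) x = U g (U h x) := by
  rw [map_mul]; rfl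

theorem unitary_inv_apply (U : G →* (E ≃ₗᵢ[ℝ] E)) (g : G) (x : E) : U g⁻¹ (U g x) = x := by
  rw [← unitary_mul_apply, inv_mul_cancel, map_one]; rfl

theorem inner_unitary_right (U : G →* (E ≃ₗᵢ[ℝ] E)) (g : G) (x y : E) :
    ⟪x, U g y⟫ = ⟪U g⁻¹ x, y⟫ := by
  rw [← (U g⁻¹).inner_map_map x, unitary_inv_apply]

end Unitary

variable {G : Type} [TopologicalSpace G]

theorem integrable_of_continuous [CompactSpace G] [MeasurableSpace G] [BorelSpace G]
    (μ : Measure G) [IsFiniteMeasure μ] {F : Type*} [NormedAddCommGroup F] {f : G → F}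
    (hf : Continuous f) : Integrable f μ :=
  hf.integrable_of_hasCompactSupport (HasCompactSupport.of_compactSpace f)

variable [Group G]

/-- A subspace stable under a unitary representation. -/
def IsStable (U : G →* (E ≃ₗᵢ[ℝ] E)) (F : Submodule ℝ E) : Prop :=
  ∀ g, ∀ x ∈ F, U g x ∈ F

theorem continuous_rankOne {U : G →* (E ≃ₗᵢ[ℝ] E)} {v : E} (hv : Continuous fun g => U g v) :
    Continuous fun g => InnerProductSpace.rankOne ℝ (U g v) (U g v) := by
  exact ((InnerProductSpace.rankOne ℝ).continuous.comp hv).clm_apply hv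

variable [CompactSpace G] [MeasurableSpace G] [BorelSpace G]

/-- The average over `G` of the rank one operators `⟪g v, ·⟫ g v`. -/
def averagedRankOne (μ : Measure G) (U : G →* (E ≃ₗᵢ[ℝ] E)) (v : E) : E →L[ℝ] E :=
  ∫ g, InnerProductSpace.rankOne ℝ (U g v) (U g v) ∂μ

variable (μ : Measure G) [IsProbabilityMeasure μ] {U : G →* (E ≃ₗᵢ[ℝ] E)} {v : E}

variable [CompleteSpace E]

theorem inner_averagedRankOne (hv : Continuous fun g => U g v) (x y : E) :
    ⟪x, averagedRankOne μ U v y⟫ = ∫ g, ⟪U g v, x⟫ * ⟪U g v, y⟫ ∂μ := by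
  have hi := integrable_of_continuous μ (continuous_rankOne hv)
  rw [averagedRankOne, ContinuousLinearMap.integral_apply hi, ← integral_inner
    (hi.apply_continuousLinearMap y)]
  refine integral_congr_ae (Filter.Eventually.of_forall fun g => ?_)
  simp only [InnerProductSpace.rankOne_apply, inner_smul_right]
  rw [real_inner_comm x, mul_comm]

/-- An average of operators of rank one lies in the closed subspace of compact operators. -/
theorem isCompactOperator_averagedRankOne (hv : Continuous fun g => U g v) :
    IsCompactOperator (averagedRankOne μ U v) := by
  let S : Submodule ℝ (E →L[ℝ] E) := compactOperator (RingHom.id ℝ) E E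
  have hS : IsClosed (S : Set (E →L[ℝ] E)) := isClosed_setOfPred_isCompactOperator
  refine S.convex.integral_mem hS (Filter.Eventually.of_forall fun g => ?_)
    (integrable_of_continuous μ (continuous_rankOne hv))
  change IsCompactOperator (InnerProductSpace.rankOne ℝ (U g v) (U g v))
  have h : IsCompactOperator (innerSL ℝ (U g v)) :=
    isCompactOperator_of_locallyCompactSpace_dom _
  exact h.clm_comp (ContinuousLinearMap.toSpanSingleton ℝ (U g v))

theorem isSymmetric_averagedRankOne (hv : Continuous fun g => U g v) :
    (averagedRankOne μ U v).IsSymmetric := fun x y => by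
  change ⟪averagedRankOne μ U v x, y⟫ = ⟪x, averagedRankOne μ U v y⟫
  rw [real_inner_comm, inner_averagedRankOne μ hv, inner_averagedRankOne μ hv]
  simp only [mul_comm]

/-- The kernel of the averaged operator is orthogonal to the orbit of `v`: for `x` in the kernel,
the continuous function `g ↦ ⟪g v, x⟫ ^ 2` has integral zero. -/
theorem inner_eq_zero_of_averagedRankOne [μ.IsOpenPosMeasure] (hv : Continuous fun g => U g v)
    {x : E} (hx : averagedRankOne μ U v x = 0) (g : G) : ⟪U g v, x⟫ = 0 := by
  have h := inner_averagedRankOne μ hv x x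
  have hc : Continuous fun g => ⟪U g v, x⟫ * ⟪U g v, x⟫ := by fun_prop
  rw [hx, inner_zero_right, eq_comm, integral_eq_zero_iff_of_nonneg
    (fun g => mul_self_nonneg _) (integrable_of_continuous μ hc)] at h
  exact mul_self_eq_zero.1 (congrFun
    ((Continuous.ae_eq_iff_eq μ hc (continuous_const (y := (0 : ℝ)))).1 h) g)

theorem map_averagedRankOne [IsTopologicalGroup G] [μ.IsMulLeftInvariant]
    (hv : Continuous fun g => U g v) (h : G) (x : E) :
    U h (averagedRankOne μ U v x) = averagedRankOne μ U v (U h x) := by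
  refine ext_inner_left ℝ fun y => ?_
  rw [inner_averagedRankOne μ hv, inner_unitary_right, inner_averagedRankOne μ hv,
    ← integral_mul_left_eq_self (fun g => ⟪U g v, y⟫ * ⟪U g v, U h x⟫) h]
  refine integral_congr_ae (Filter.Eventually.of_forall fun g => ?_)
  simp only [unitary_mul_apply, LinearIsometryEquiv.inner_map_map]
  rw [real_inner_comm y, inner_unitary_right, inv_inv, real_inner_comm]

/-- In a unitary representation of a compact group, matrix coefficients are uniformly approximated
by those of finite-dimensional subrepresentations: expand the vector in eigenvectors of the compact
self-adjoint operator obtained by averaging `⟪v, ·⟫ v`, whose kernel does not contribute to the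
coefficient. -/
theorem exists_stable_approx [IsTopologicalGroup G] [μ.IsMulLeftInvariant] [μ.IsOpenPosMeasure]
    (hv : Continuous fun g => U g v) (f : E) {ε : ℝ} (hε : 0 < ε) :
    ∃ (F : Submodule ℝ E) (_ : FiniteDimensional ℝ F), IsStable U F ∧
      ∃ f' ∈ F, ∀ g, |⟪U g v, f⟫ - ⟪U g v, f'⟫| < ε := by
  set T := averagedRankOne μ U v with hT
  have hcomp := isCompactOperator_averagedRankOne μ hv
  have hsymm := isSymmetric_averagedRankOne μ hv
  have hdense : (⨆ c, Module.End.eigenspace (T : Module.End ℝ E) c).topologicalClosure = ⊤ := by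
    rw [Submodule.topologicalClosure_eq_top_iff]
    exact ContinuousLinearMap.orthogonalComplement_iSup_eigenspaces_eq_bot hcomp hsymm
  have hpos : 0 < ε / (‖v‖ + 1) := by positivity
  obtain ⟨f₁, hf₁, hd⟩ := Metric.mem_closure_iff.1
    (show f ∈ closure ((⨆ c, Module.End.eigenspace (T : Module.End ℝ E) c : Submodule ℝ E) : Set E)
      by
        rw [← Submodule.topologicalClosure_coe, hdense]; trivial) _ hpos
  have hP : ∃ (F : Submodule ℝ E) (_ : FiniteDimensional ℝ F), IsStable U F ∧
      ∃ f' ∈ F, T (f₁ - f') = 0 := by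
    refine Submodule.iSup_induction
      (motive := fun f₁ => ∃ (F : Submodule ℝ E) (_ : FiniteDimensional ℝ F), IsStable U F ∧
        ∃ f' ∈ F, T (f₁ - f') = 0) _ hf₁ (fun c x hx => ?_) ?_ ?_
    · rw [Module.End.mem_eigenspace_iff] at hx
      by_cases hc : c = 0
      · refine ⟨⊥, inferInstance, fun g x hx => ?_, 0, Submodule.zero_mem _, ?_⟩
        · rw [(Submodule.mem_bot ℝ).1 hx, map_zero]
          exact Submodule.zero_mem _
        · rw [hc, zero_smul] at hx
          rw [sub_zero]
          exact hx
      · refine ⟨_, ContinuousLinearMap.finite_dimensional_eigenspace hcomp c hc, fun g y hy => ?_,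
          x, Module.End.mem_eigenspace_iff.2 hx, by rw [sub_self, map_zero]⟩
        rw [Module.End.mem_eigenspace_iff] at hy ⊢
        have hy' : T y = c • y := hy
        change T (U g y) = c • U g y
        rw [hT, ← map_averagedRankOne μ hv, ← hT, hy', map_smul]
    · refine ⟨⊥, inferInstance, fun g x hx => ?_, 0, Submodule.zero_mem _, by simp⟩
      rw [(Submodule.mem_bot ℝ).1 hx, map_zero]
      exact Submodule.zero_mem _
    · rintro x y ⟨F, _, hF, x', hx', ex⟩ ⟨F', _, hF', y', hy', ey⟩
      refine ⟨F ⊔ F', inferInstance, fun g z hz => ?_, x' + y',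
        Submodule.add_mem_sup hx' hy', ?_⟩
      · obtain ⟨a, ha, b, hb, rfl⟩ := Submodule.mem_sup.1 hz
        rw [map_add]
        exact Submodule.add_mem_sup (hF g a ha) (hF' g b hb)
      · rw [add_sub_add_comm, map_add, ex, ey, add_zero]
  obtain ⟨F, hFd, hF, f', hf', h0⟩ := hP
  refine ⟨F, hFd, hF, f', hf', fun g => ?_⟩
  have h1 : ⟪U g v, f₁⟫ = ⟪U g v, f'⟫ := by
    have := inner_eq_zero_of_averagedRankOne μ hv h0 g
    rwa [inner_sub_right, sub_eq_zero] at this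
  rw [← h1, ← inner_sub_right]
  refine (abs_real_inner_le_norm _ _).trans_lt ?_
  rw [LinearIsometryEquiv.norm_map, ← dist_eq_norm]
  calc ‖v‖ * dist f f₁ ≤ (‖v‖ + 1) * dist f f₁ := by gcongr; linarith
    _ < (‖v‖ + 1) * (ε / (‖v‖ + 1)) := by gcongr
    _ = ε := by field_simp

end Averaging

/-- A finite-dimensional subrepresentation of a unitary representation. -/
def OrthRep.ofStable {E : Type} [NormedAddCommGroup E] [InnerProductSpace ℝ E]
    {G : Type} [Group G] [TopologicalSpace G] (U : G →* (E ≃ₗᵢ[ℝ] E))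
    (hU : Continuous fun p : G × E => U p.1 p.2) (F : Submodule ℝ E) [FiniteDimensional ℝ F]
    (hF : IsStable U F) : OrthRep G :=
  OrthRep.mk' ⟨F⟩
    (fun g => ⟨(U g).toLinearEquiv.toLinearMap.restrict (hF g), fun x => (U g).norm_map x⟩)
    (fun x => Subtype.ext (by
      change U 1 x.1 = x.1
      rw [map_one]; rfl))
    (fun g h x => Subtype.ext (unitary_mul_apply U g h x.1))
    ((hU.comp (continuous_fst.prodMk (continuous_subtype_val.comp continuous_snd))).subtype_mk _)

variable {G : Type} [Group G] [TopologicalSpace G] [IsTopologicalGroup G] [CompactSpace G]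

section Regular

variable [MeasurableSpace G] [BorelSpace G]

/-- The normalized Haar measure of a compact group. -/
def haarProb (G : Type) [Group G] [TopologicalSpace G] [IsTopologicalGroup G] [CompactSpace G]
    [MeasurableSpace G] [BorelSpace G] : Measure G :=
  Measure.haarMeasure ⊤

instance : (haarProb G).IsHaarMeasure := by unfold haarProb; infer_instance

instance : (haarProb G).Regular := by unfold haarProb; infer_instance

instance : IsProbabilityMeasure (haarProb G) :=
  ⟨Measure.haarMeasure_self (K₀ := (⊤ : TopologicalSpace.PositiveCompacts G))⟩

/-- The left regular representation of `G` on `L²(G)`. -/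
def regularRep (G : Type) [Group G] [TopologicalSpace G] [IsTopologicalGroup G] [CompactSpace G]
    [MeasurableSpace G] [BorelSpace G] :
    G →* (Lp ℝ 2 (haarProb G) ≃ₗᵢ[ℝ] Lp ℝ 2 (haarProb G)) where
  toFun g :=
    { toFun := fun f => DomMulAct.mk g⁻¹ • f
      invFun := fun f => DomMulAct.mk g • f
      map_add' := fun f f' => smul_add _ f f'
      map_smul' := fun c f => smul_comm _ c f
      left_inv := fun f => by
        change DomMulAct.mk g • DomMulAct.mk g⁻¹ • f = f
        rw [smul_smul, ← DomMulAct.mk_mul, inv_mul_cancel, DomMulAct.mk_one, one_smul]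
      right_inv := fun f => by
        change DomMulAct.mk g⁻¹ • DomMulAct.mk g • f = f
        rw [smul_smul, ← DomMulAct.mk_mul, mul_inv_cancel, DomMulAct.mk_one, one_smul]
      norm_map' := fun f => DomMulAct.norm_smul_Lp _ f }
  map_one' := LinearIsometryEquiv.ext fun f => by
    change DomMulAct.mk (1 : G)⁻¹ • f = f
    rw [inv_one, DomMulAct.mk_one, one_smul]
  map_mul' g h := LinearIsometryEquiv.ext fun f => by
    change DomMulAct.mk (g * h)⁻¹ • f = DomMulAct.mk g⁻¹ • DomMulAct.mk h⁻¹ • f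
    rw [smul_smul, ← DomMulAct.mk_mul, mul_inv_rev]

theorem continuous_regularRep :
    Continuous fun p : G × Lp ℝ 2 (haarProb G) => regularRep G p.1 p.2 := by
  have : Fact ((2 : ENNReal) ≠ ⊤) := ⟨by simp⟩
  have h : Continuous fun p : G × Lp ℝ 2 (haarProb G) => DomMulAct.mk p.1⁻¹ • p.2 :=
    (DomMulAct.continuous_mk.comp continuous_fst.inv).smul continuous_snd
  exact h

/-- Matrix coefficients of the regular representation are convolutions. -/
theorem inner_regularRep_toLp (φ f : C(G, ℝ)) (g : G) :
    ⟪regularRep G g (ContinuousMap.toLp 2 (haarProb G) ℝ φ),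
      ContinuousMap.toLp 2 (haarProb G) ℝ f⟫ = ∫ x, f (g * x) * φ x ∂(haarProb G) := by
  have h : regularRep G g (ContinuousMap.toLp 2 (haarProb G) ℝ φ) =
      ContinuousMap.toLp 2 (haarProb G) ℝ (φ.comp ⟨fun x => g⁻¹ * x, by fun_prop⟩) := rfl
  rw [h, ContinuousMap.inner_toLp,
    ← integral_mul_left_eq_self (fun x => f x * _) g]
  simp

end Regular

theorem inner_orthogonalProjection_of_isStable {E : Type} [NormedAddCommGroup E]
    [InnerProductSpace ℝ E] {G : Type} [Group G] {U : G →* (E ≃ₗᵢ[ℝ] E)} {F : Submodule ℝ E}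
    [F.HasOrthogonalProjection] (hF : IsStable U F) (g : G) (v : E) {f : E} (hf : f ∈ F) :
    ⟪U g (F.orthogonalProjectionOnto v), f⟫ = ⟪U g v, f⟫ := by
  rw [real_inner_comm f, inner_unitary_right, real_inner_comm f, inner_unitary_right _ _ f]
  exact F.inner_orthogonalProjectionOnto_eq_of_mem_left ⟨_, hF g⁻¹ f hf⟩ v

/-- Projecting `v` to the subspace of `exists_stable_approx` turns the approximation into a matrix
coefficient of a finite-dimensional representation. -/
theorem exists_matrixCoefficient_near_inner {E : Type} [NormedAddCommGroup E]
    [InnerProductSpace ℝ E] [CompleteSpace E] [MeasurableSpace G] [BorelSpace G] (μ : Measure G)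
    [IsProbabilityMeasure μ] [μ.IsMulLeftInvariant] [μ.IsOpenPosMeasure]
    {U : G →* (E ≃ₗᵢ[ℝ] E)} (hU : Continuous fun p : G × E => U p.1 p.2) (v f : E) {ε : ℝ}
    (hε : 0 < ε) :
    ∃ (V : OrthRep G) (u w : V.space), ∀ g, |⟪U g v, f⟫ - ⟪V.ρ g u, w⟫| < ε := by
  obtain ⟨F, hFd, hF, f', hf', hd⟩ :=
    exists_stable_approx μ (hU.comp (Continuous.prodMk_left v)) f hε
  refine ⟨OrthRep.ofStable U hU F hF, F.orthogonalProjectionOnto v, ⟨f', hf'⟩, fun g => ?_⟩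
  change |⟪U g v, f⟫ - ⟪U g (F.orthogonalProjectionOnto v), f'⟫| < ε
  rw [inner_orthogonalProjection_of_isStable hF g v hf']
  exact hd g

/-- A continuous function supported near a point, with integral one. -/
theorem exists_bump {X : Type} [TopologicalSpace X] [CompactSpace X] [T2Space X]
    [MeasurableSpace X] [BorelSpace X] (μ : Measure X) [IsFiniteMeasure μ] [μ.IsOpenPosMeasure]
    {x : X} {N : Set X} (hN : N ∈ nhds x) :
    ∃ φ : C(X, ℝ), (∀ y, 0 ≤ φ y) ∧ (∀ y ∉ N, φ y = 0) ∧ ∫ y, φ y ∂μ = 1 := by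
  obtain ⟨φ, h₀, h₁, h⟩ := exists_continuous_zero_one_of_isClosed
    (isOpen_interior (s := N)).isClosed_compl (isClosed_singleton (x := x)) (by
      rw [Set.disjoint_singleton_right]
      exact fun hx => hx (mem_interior_iff_mem_nhds.2 hN))
  have hpos : 0 < ∫ y, φ y ∂μ := φ.continuous.integral_pos_of_hasCompactSupport_nonneg_nonzero
    (HasCompactSupport.of_compactSpace _) (fun y => (h y).1)
    (x := x) (by rw [h₁ rfl]; exact one_ne_zero)
  refine ⟨(∫ y, φ y ∂μ)⁻¹ • φ, fun y => ?_, fun y hy => ?_, ?_⟩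
  · exact mul_nonneg (inv_nonneg.2 hpos.le) (h y).1
  · have : φ y = 0 := h₀ fun hy' => hy (interior_subset hy')
    simp [this]
  · simp only [ContinuousMap.smul_apply, smul_eq_mul]
    rw [integral_const_mul, inv_mul_cancel₀ hpos.ne']

/-- Convolution with a bump function at the identity approximates a continuous function. -/
theorem exists_convolution_near [T2Space G] [MeasurableSpace G] [BorelSpace G] (f : C(G, ℝ))
    {ε : ℝ} (hε : 0 < ε) :
    ∃ φ : C(G, ℝ), ∀ g, |f g - ∫ x, f (g * x) * φ x ∂(haarProb G)| ≤ ε := by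
  -- Translating `f` on the right by elements near the identity changes it little, uniformly.
  have hN : {x : G | ∀ g, |f (g * x) - f g| < ε} ∈ nhds (1 : G) := by
    let F : C(G, C(G, ℝ)) :=
      ContinuousMap.curry ⟨fun p : G × G => f (p.2 * p.1), by fun_prop⟩
    have h1 : F 1 = f := ContinuousMap.ext fun g => congrArg f (mul_one g)
    filter_upwards [F.continuous.continuousAt.preimage_mem_nhds
      (Metric.ball_mem_nhds (F 1) hε)] with x hx g
    rw [Set.mem_preimage, Metric.mem_ball, h1] at hx
    rw [← Real.dist_eq]
    exact (ContinuousMap.dist_apply_le_dist (f := F x) (g := f) g).trans_lt hx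
  obtain ⟨φ, hφ₀, hφN, hφ₁⟩ := exists_bump (haarProb G) hN
  refine ⟨φ, fun g => ?_⟩
  have hi : Integrable (fun x => f (g * x) * φ x) (haarProb G) :=
    integrable_of_continuous _ (by fun_prop)
  have hi' : Integrable φ (haarProb G) := integrable_of_continuous _ φ.continuous
  have e : f g - ∫ x, f (g * x) * φ x ∂(haarProb G) =
      ∫ x, (f g - f (g * x)) * φ x ∂(haarProb G) := by
    simp only [sub_mul]
    rw [integral_sub (hi'.const_mul _) hi, integral_const_mul, hφ₁, mul_one]
  rw [e, ← Real.norm_eq_abs]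
  calc ‖∫ x, (f g - f (g * x)) * φ x ∂(haarProb G)‖
      ≤ ∫ x, ε * φ x ∂(haarProb G) := by
        refine norm_integral_le_of_norm_le (hi'.const_mul _) (Filter.Eventually.of_forall
          fun x => ?_)
        rw [norm_mul, Real.norm_eq_abs, Real.norm_eq_abs, abs_of_nonneg (hφ₀ x)]
        by_cases hx : x ∈ {x : G | ∀ g, |f (g * x) - f g| < ε}
        · rw [abs_sub_comm]
          exact mul_le_mul_of_nonneg_right (hx g).le (hφ₀ x)
        · rw [hφN x hx, mul_zero, mul_zero]
    _ = ε := by rw [integral_const_mul, hφ₁, mul_one]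

/-- **Peter–Weyl**: continuous functions on a compact group are uniformly approximated by matrix
coefficients of finite-dimensional orthogonal representations. -/
theorem exists_matrixCoefficient_near [T2Space G] (f : C(G, ℝ)) {ε : ℝ} (hε : 0 < ε) :
    ∃ (V : OrthRep G) (u v : V.space), ∀ g, |f g - ⟪V.ρ g u, v⟫| < ε := by
  let _ : MeasurableSpace G := borel G
  have : BorelSpace G := ⟨rfl⟩
  obtain ⟨φ, hφ⟩ := exists_convolution_near f (half_pos hε)
  obtain ⟨V, u, v, h⟩ := exists_matrixCoefficient_near_inner (haarProb G) continuous_regularRep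
    (ContinuousMap.toLp 2 (haarProb G) ℝ φ) (ContinuousMap.toLp 2 (haarProb G) ℝ f) (half_pos hε)
  refine ⟨V, u, v, fun g => ?_⟩
  have h₂ := h g
  rw [inner_regularRep_toLp] at h₂
  calc |f g - ⟪V.ρ g u, v⟫|
      ≤ _ := abs_sub_le _ (∫ x, f (g * x) * φ x ∂(haarProb G)) _
    _ < ε / 2 + ε / 2 := add_lt_add_of_le_of_lt (hφ g) h₂
    _ = ε := add_halves ε

end PeterWeyl

/-! ### Extending representations from a closed subgroup -/

section Polar

open RealInnerProductSpace

/-- The polar decomposition of an injective linear map `Ψ` makes it isometric: precomposing it with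
`(Ψ* Ψ)^(-1/2)`, a polynomial in `Ψ* Ψ`, gives an isometric embedding. -/
theorem exists_polynomial_isometry {W E : Type} [NormedAddCommGroup W] [InnerProductSpace ℝ W]
    [FiniteDimensional ℝ W] [NormedAddCommGroup E] [InnerProductSpace ℝ E]
    {Ψ : W →ₗ[ℝ] E} (hΨ : Function.Injective Ψ) {T : W →ₗ[ℝ] W}
    (hT : ∀ x y, ⟪T x, y⟫ = ⟪Ψ x, Ψ y⟫) :
    ∃ (p : Polynomial ℝ) (φ : W →ₗᵢ[ℝ] E), ∀ x, φ x = Ψ (Polynomial.aeval T p x) := by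
  have hsymm : T.IsSymmetric := fun x y => by
    rw [hT, real_inner_comm _ x, hT, real_inner_comm]
  let b := hsymm.eigenvectorBasis rfl
  let c := hsymm.eigenvalues rfl
  have hb : ∀ i, T (b i) = c i • b i := hsymm.apply_eigenvectorBasis rfl
  have hc : ∀ i, 0 < c i := fun i => by
    have h1 : ⟪T (b i), b i⟫ = c i := by
      rw [hb, inner_smul_left, real_inner_self_eq_norm_sq, b.norm_eq_one]
      simp
    rw [← h1, hT, real_inner_self_eq_norm_sq]
    have : Ψ (b i) ≠ 0 := fun h => b.orthonormal.ne_zero i (hΨ (h.trans (map_zero Ψ).symm))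
    positivity
  let p : Polynomial ℝ := Lagrange.interpolate (Finset.univ.image c) id fun x => (√x)⁻¹
  have hp : ∀ i, p.eval (c i) = (√(c i))⁻¹ := fun i =>
    Lagrange.eval_interpolate_at_node _ (Function.injective_id.injOn)
      (Finset.mem_image_of_mem c (Finset.mem_univ i))
  have hS : ∀ i, Polynomial.aeval T p (b i) = (√(c i))⁻¹ • b i := fun i => by
    have : Module.End.HasEigenvector T (c i) (b i) :=
      ⟨Module.End.mem_eigenspace_iff.2 (hb i), b.orthonormal.ne_zero i⟩
    rw [Module.End.aeval_apply_of_hasEigenvector this, hp]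
  have ho : Orthonormal ℝ ((Ψ ∘ₗ Polynomial.aeval T p) ∘ b) := by
    rw [orthonormal_iff_ite]
    intro i j
    simp only [Function.comp_apply, LinearMap.comp_apply]
    rw [← hT, hS, hS, map_smul, hb, inner_smul_left, inner_smul_left, inner_smul_right,
      orthonormal_iff_ite.1 b.orthonormal]
    split_ifs with h
    · subst h
      have h1 : √(c i) ≠ 0 := (Real.sqrt_pos.2 (hc i)).ne'
      have h2 : c i = √(c i) * √(c i) := (Real.mul_self_sqrt (hc i).le).symm
      simp only [conj_trivial, mul_one]
      nth_rewrite 2 [h2]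
      field_simp
    · simp
  refine ⟨p, (Ψ ∘ₗ Polynomial.aeval T p).isometryOfOrthonormal (v := b.toBasis)
    (by simp) (by simpa using ho), fun x => rfl⟩

variable {H : Type} [Group H] [TopologicalSpace H]

theorem OrthRep.continuous_apply (V : OrthRep H) (v : V.space) : Continuous fun g => V.ρ g v :=
  V.continuous_ρ.comp (Continuous.prodMk_left v)

/-- An injective equivariant map between representations can be replaced by an isometric one. -/
theorem OrthRep.exists_embedding_of_injective (W E : OrthRep H) {Ψ : W.space →ₗ[ℝ] E.space}
    (hΨ : Function.Injective Ψ) (heq : ∀ h w, Ψ (W.ρ h w) = E.ρ h (Ψ w)) :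
    Nonempty (W.Embedding E) := by
  let T : W.space →ₗ[ℝ] W.space := Ψ.adjoint ∘ₗ Ψ
  have hT : ∀ x y, ⟪T x, y⟫ = ⟪Ψ x, Ψ y⟫ := fun x y => LinearMap.adjoint_inner_left Ψ y (Ψ x)
  obtain ⟨p, φ, hφ⟩ := exists_polynomial_isometry hΨ hT
  have hcomm : ∀ h, Commute T ((W.ρ h).toLinearEquiv : W.space →ₗ[ℝ] W.space) := fun h => by
    refine LinearMap.ext fun x => ext_inner_right ℝ fun y => ?_
    change ⟪T (W.ρ h x), y⟫ = ⟪W.ρ h (T x), y⟫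
    rw [hT, heq, real_inner_comm, inner_unitary_right, ← heq, real_inner_comm, ← hT,
      real_inner_comm, ← inner_unitary_right, real_inner_comm]
  refine ⟨⟨φ, fun h w => ?_⟩⟩
  have hpc : Polynomial.aeval T p (W.ρ h w) = W.ρ h (Polynomial.aeval T p w) := by
    have : Commute (Polynomial.aeval T p) ((W.ρ h).toLinearEquiv : W.space →ₗ[ℝ] W.space) := by
      refine Polynomial.induction_on p (fun a => ?_) (fun q r hq hr => ?_) (fun n a hn => ?_)
      · rw [Polynomial.aeval_C]
        exact Algebra.commutes a _
      · rw [map_add]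
        exact hq.add_left hr
      · rw [map_mul, Polynomial.aeval_C, map_pow, Polynomial.aeval_X]
        exact Commute.mul_left (Algebra.commutes a _) ((hcomm h).pow_left _)
    exact LinearMap.congr_fun this w
  rw [hφ, hφ, hpc, heq]

end Polar

section Extension

open MeasureTheory RealInnerProductSpace

variable {G : Type} [Group G] [TopologicalSpace G] {H : Type} [Group H] [TopologicalSpace H]

/-- Elements near the identity act almost trivially. -/
theorem OrthRep.norm_sub_lt_nhds_one (W : OrthRep H) {ε : ℝ} (hε : 0 < ε) :
    {h : H | ∀ w, ‖W.ρ h w - w‖ ≤ ε * ‖w‖} ∈ nhds (1 : H) := by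
  let A : H → W.space →L[ℝ] W.space := fun h => (W.ρ h).toContinuousLinearEquiv
  have hA : Continuous A := continuous_clm_apply.2 fun w => W.continuous_apply w
  have h1 : A 1 = ContinuousLinearMap.id ℝ _ := by
    ext w
    change W.ρ 1 w = w
    rw [map_one]; rfl
  filter_upwards [hA.continuousAt.preimage_mem_nhds (Metric.ball_mem_nhds (A 1) hε)] with h hh w
  rw [Set.mem_preimage, mem_ball_iff_norm, h1] at hh
  exact ((A h - ContinuousLinearMap.id ℝ _).le_opNorm w).trans (by gcongr)

variable [IsTopologicalGroup H] [CompactSpace H] [MeasurableSpace H] [BorelSpace H]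

/-- The map `w ↦ ∫ ⟪w, h y⟫ θ(h) u dh`. -/
def averagedMap (W : OrthRep H) (V : OrthRep G) {θ : H →* G} (hθ : Continuous θ) (y : W.space)
    (u : V.space) : W.space →ₗ[ℝ] V.space where
  toFun w := ∫ h, ⟪w, W.ρ h y⟫ • V.ρ (θ h) u ∂(haarProb H)
  map_add' w w' := by
    have hy := W.continuous_apply y
    have hu := (V.continuous_apply u).comp hθ
    simp only [inner_add_left, add_smul]
    exact integral_add (integrable_of_continuous _ (by fun_prop))
      (integrable_of_continuous _ (by fun_prop))
  map_smul' c w := by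
    simp only [inner_smul_left, mul_smul, RCLike.conj_to_real, RingHom.id_apply]
    exact integral_smul c _

theorem averagedMap_equivariant (W : OrthRep H) (V : OrthRep G) {θ : H →* G} (hθ : Continuous θ)
    (y : W.space) (u : V.space) (k : H) (w : W.space) :
    averagedMap W V hθ y u (W.ρ k w) = V.ρ (θ k) (averagedMap W V hθ y u w) := by
  change ∫ h, ⟪W.ρ k w, W.ρ h y⟫ • V.ρ (θ h) u ∂(haarProb H) =
    V.ρ (θ k) (∫ h, ⟪w, W.ρ h y⟫ • V.ρ (θ h) u ∂(haarProb H))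
  rw [← integral_mul_left_eq_self _ k]
  refine Eq.trans ?_ ((V.ρ (θ k)).toContinuousLinearEquiv.integral_comp_comm _)
  refine integral_congr_ae (Filter.Eventually.of_forall fun h => ?_)
  simp only [map_mul θ, unitary_mul_apply, LinearIsometryEquiv.inner_map_map]
  exact (map_smul (V.ρ (θ k)) _ _).symm

theorem inner_averagedMap (W : OrthRep H) (V : OrthRep G) {θ : H →* G} (hθ : Continuous θ)
    (y : W.space) (u v : V.space) (w : W.space) :
    ⟪v, averagedMap W V hθ y u w⟫ = ∫ h, ⟪w, W.ρ h y⟫ * ⟪V.ρ (θ h) u, v⟫ ∂(haarProb H) := by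
  have hy := W.continuous_apply y
  have hu := (V.continuous_apply u).comp hθ
  refine (integral_inner (𝕜 := ℝ) (integrable_of_continuous _ (by fun_prop)) v).symm.trans ?_
  simp only [inner_smul_right, real_inner_comm]

/-- Every representation of a closed subgroup `H` of a compact group `G` embeds into the restriction
of a representation of `G`: choose a matrix coefficient of `G` whose restriction to `H` is close to
a bump function at the identity. -/
theorem OrthRep.exists_embedding_comap [IsTopologicalGroup G] [CompactSpace G] [T2Space G]
    [T2Space H] (W : OrthRep H) {θ : H →* G} (hθ : Continuous θ)
    (hinj : Function.Injective θ) :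
    ∃ E : OrthRep G, Nonempty (W.Embedding (E.comap θ hθ)) := by
  obtain ⟨φ, hφ₀, hφN, hφ₁⟩ := exists_bump (haarProb H)
    (W.norm_sub_lt_nhds_one (ε := 1 / 4) (by norm_num))
  obtain ⟨f, hf⟩ := ContinuousMap.exists_extension (hθ.isClosedEmbedding hinj) φ
  obtain ⟨V, u, v, hV⟩ := exists_matrixCoefficient_near f (ε := 1 / 4) (by norm_num)
  have ha : ∀ h, |φ h - ⟪V.ρ (θ h) u, v⟫| < 1 / 4 := fun h => by
    rw [← hf]
    exact hV (θ h)
  let b := stdOrthonormalBasis ℝ W.space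
  let E : OrthRep G := V.dsum fun _ : Fin (Module.finrank ℝ W.space) => V
  let Ψ : W.space →ₗ[ℝ] E.space :=
    { toFun := fun w => dmk 0 fun i => averagedMap W V hθ (b i) u w
      map_add' := fun w w' => dsum_ext (add_zero (0 : V.space)).symm fun i =>
        map_add (averagedMap W V hθ (b i) u) w w'
      map_smul' := fun c w => dsum_ext (smul_zero (A := V.space.carrier) c).symm fun i =>
        map_smul (averagedMap W V hθ (b i) u) c w }
  suffices hΨ : Function.Injective Ψ from
    ⟨E, OrthRep.exists_embedding_of_injective W (E.comap θ hθ) (Ψ := Ψ) hΨ fun k w =>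
      dsum_ext (map_zero (V.ρ (θ k))).symm fun i =>
        averagedMap_equivariant W V hθ (b i) u k w⟩
  rw [injective_iff_map_eq_zero]
  intro w hw
  have hw' : ∀ i, averagedMap W V hθ (b i) u w = 0 := fun i => congrArg (fun x => dcomp x i) hw
  have hcont : ∀ y, Continuous fun h => ⟪w, W.ρ h y⟫ * ⟪V.ρ (θ h) u, v⟫ := fun y => by
    have hy := W.continuous_apply y
    have hu := (V.continuous_apply u).comp hθ
    fun_prop
  -- Expanding `w` in the basis `b`, the integral below is a combination of the coordinates of
  -- `Ψ w`. On the other hand it is close to `∫ ⟪w, h w⟫ φ(h) dh`, which is at least `3 / 4 * ‖w‖ ^ 2`.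
  have h0 : ∫ h, ⟪w, W.ρ h w⟫ * ⟪V.ρ (θ h) u, v⟫ ∂(haarProb H) = 0 := by
    have e : ∀ h, ⟪w, W.ρ h w⟫ * ⟪V.ρ (θ h) u, v⟫ =
        ∑ i, ⟪b i, w⟫ * (⟪w, W.ρ h (b i)⟫ * ⟪V.ρ (θ h) u, v⟫) := fun h => by
      have e₁ : W.ρ h w = ∑ i, ⟪b i, w⟫ • W.ρ h (b i) := by
        conv_lhs => rw [← b.sum_repr' w]
        simp only [map_sum, map_smul]
      rw [e₁, inner_sum, Finset.sum_mul]
      simp only [inner_smul_right, mul_assoc]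
    simp only [e]
    rw [integral_finsetSum _ fun i _ => (integrable_of_continuous _ (hcont (b i))).const_mul _]
    refine Finset.sum_eq_zero fun i _ => ?_
    rw [integral_const_mul, ← inner_averagedMap W V hθ, hw', inner_zero_right, mul_zero]
  have hlow : ∫ h, (3 / 4 * ‖w‖ ^ 2 * φ h - 1 / 4 * ‖w‖ ^ 2) ∂(haarProb H) ≤ 0 := by
    rw [← h0]
    refine integral_mono (integrable_of_continuous _ (by fun_prop))
      (integrable_of_continuous _ (hcont w)) fun h => ?_
    have h1 : |⟪w, W.ρ h w⟫| ≤ ‖w‖ ^ 2 := by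
      refine (abs_real_inner_le_norm _ _).trans ?_
      rw [LinearIsometryEquiv.norm_map, sq]
    have h2 : 3 / 4 * ‖w‖ ^ 2 * φ h ≤ ⟪w, W.ρ h w⟫ * φ h := by
      by_cases hh : h ∈ {h : H | ∀ w, ‖W.ρ h w - w‖ ≤ 1 / 4 * ‖w‖}
      · refine mul_le_mul_of_nonneg_right ?_ (hφ₀ h)
        have h3 : |⟪w, W.ρ h w - w⟫| ≤ ‖w‖ * (1 / 4 * ‖w‖) :=
          (abs_real_inner_le_norm _ _).trans (by gcongr; exact hh w)
        rw [inner_sub_right, real_inner_self_eq_norm_sq] at h3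
        nlinarith [(abs_le.1 h3).1]
      · rw [hφN h hh, mul_zero, mul_zero]
    have h4 : |⟪w, W.ρ h w⟫ * (φ h - ⟪V.ρ (θ h) u, v⟫)| ≤ ‖w‖ ^ 2 * (1 / 4) := by
      rw [abs_mul]
      gcongr
      exact (ha h).le
    rw [mul_sub] at h4
    have := (abs_le.1 h4).2
    simp only
    linarith
  have hc : ∫ h, (3 / 4 * ‖w‖ ^ 2 * φ h - 1 / 4 * ‖w‖ ^ 2) ∂(haarProb H) = 1 / 2 * ‖w‖ ^ 2 := by
    rw [integral_sub (integrable_of_continuous _ (by fun_prop)) (integrable_const _),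
      integral_const_mul, hφ₁, integral_const]
    simp
    ring
  rw [hc] at hlow
  have : ‖w‖ ^ 2 = 0 := le_antisymm (by linarith) (sq_nonneg _)
  simpa using this

end Extension

/-! ### Faithful representations of compact Lie groups -/

section NoSmallSubgroups

open Filter Topology

/-- In a chart around the identity, squaring has derivative `2` at the identity. -/
theorem hasFDerivAt_extChartAt_sq {d : ℕ} {G : Type} [Group G] [TopologicalSpace G]
    [ChartedSpace (EuclideanSpace ℝ (Fin d)) G] [LieGroup (𝓡 d) ∞ G] :
    HasFDerivAt (fun x => extChartAt (𝓡 d) (1 : G)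
        ((extChartAt (𝓡 d) (1 : G)).symm x * (extChartAt (𝓡 d) (1 : G)).symm x))
      ((2 : ℝ) • ContinuousLinearMap.id ℝ (EuclideanSpace ℝ (Fin d)))
      (extChartAt (𝓡 d) (1 : G) 1) := by
  set φ := extChartAt (𝓡 d) (1 : G) with hφ
  set x₀ := φ 1 with hx₀
  have hs : φ.symm x₀ = 1 := extChartAt_to_inv 1
  let M : EuclideanSpace ℝ (Fin d) × EuclideanSpace ℝ (Fin d) → EuclideanSpace ℝ (Fin d) :=
    fun p => φ (φ.symm p.1 * φ.symm p.2)
  have hsymm : ContMDiffAt 𝓘(ℝ, EuclideanSpace ℝ (Fin d)) (𝓡 d) ∞ φ.symm x₀ :=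
    (contMDiffOn_extChartAt_symm (n := ∞) (I := 𝓡 d) (1 : G)).contMDiffAt
      (extChartAt_target_mem_nhds (I := 𝓡 d) (1 : G))
  have hM : ContDiffAt ℝ ∞ M (x₀, x₀) := by
    have h1 : ContMDiffAt (𝓘(ℝ, EuclideanSpace ℝ (Fin d)).prod 𝓘(ℝ, EuclideanSpace ℝ (Fin d)))
        (𝓡 d) ∞ (fun p : EuclideanSpace ℝ (Fin d) × EuclideanSpace ℝ (Fin d) =>
          φ.symm p.1 * φ.symm p.2) (x₀, x₀) :=
      (ContMDiffAt.comp (x₀, x₀) (f := Prod.fst) hsymm contMDiffAt_fst).mul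
        (ContMDiffAt.comp (x₀, x₀) (f := Prod.snd) hsymm contMDiffAt_snd)
    have h2 : ContMDiffAt (𝓡 d) 𝓘(ℝ, EuclideanSpace ℝ (Fin d)) ∞ φ
        (φ.symm x₀ * φ.symm x₀) := by
      rw [hs, mul_one]
      exact contMDiffAt_extChartAt
    have h3 := ContMDiffAt.comp (x₀, x₀) h2 h1
    rw [← contMDiffAt_iff_contDiffAt, modelWithCornersSelf_prod, ← chartedSpaceSelf_prod]
    exact h3
  have hD := (hM.differentiableAt (by simp)).hasFDerivAt
  have hleft : ∀ᶠ x in 𝓝 x₀, φ (φ.symm x) = x :=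
    mem_of_superset (extChartAt_target_mem_nhds (I := 𝓡 d) (1 : G)) fun _ hx => φ.right_inv hx
  have h1 : (fderiv ℝ M (x₀, x₀)).comp (ContinuousLinearMap.inl ℝ _ _) =
      ContinuousLinearMap.id ℝ _ := by
    refine HasFDerivAt.unique (HasFDerivAt.comp x₀ (f := fun x => (x, x₀)) hD
      (hasFDerivAt_prodMk_left x₀ x₀)) ((hasFDerivAt_id x₀).congr_of_eventuallyEq ?_)
    filter_upwards [hleft] with x hx
    simp [M, hs, hx]
  have h2 : (fderiv ℝ M (x₀, x₀)).comp (ContinuousLinearMap.inr ℝ _ _) =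
      ContinuousLinearMap.id ℝ _ := by
    refine HasFDerivAt.unique (HasFDerivAt.comp x₀ (f := fun x => (x₀, x)) hD
      (hasFDerivAt_prodMk_right x₀ x₀)) ((hasFDerivAt_id x₀).congr_of_eventuallyEq ?_)
    filter_upwards [hleft] with x hx
    simp [M, hs, hx]
  have h3 := HasFDerivAt.comp x₀ (f := fun x => (x, x)) hD
    ((hasFDerivAt_id x₀).prodMk (hasFDerivAt_id x₀))
  refine h3.congr_fderiv (ContinuousLinearMap.ext fun u => ?_)
  have e1 := DFunLike.congr_fun h1 u
  have e2 := DFunLike.congr_fun h2 u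
  simp only [ContinuousLinearMap.comp_apply, ContinuousLinearMap.inl_apply,
    ContinuousLinearMap.inr_apply, ContinuousLinearMap.id_apply] at e1 e2
  change fderiv ℝ M (x₀, x₀) (u, u) = (2 : ℝ) • u
  rw [show (u, u) = (u, 0) + (0, u) by simp, map_add, e1, e2, two_smul]

/-- Lie groups have no small subgroups: in a chart around the identity, squaring moves points away
from the identity by a factor of at least `3 / 2`. -/
theorem exists_nhds_one_subgroup_eq_bot {d : ℕ} {G : Type} [Group G] [TopologicalSpace G]
    [ChartedSpace (EuclideanSpace ℝ (Fin d)) G] [LieGroup (𝓡 d) ∞ G] :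
    ∃ N ∈ 𝓝 (1 : G), ∀ K : Subgroup G, (K : Set G) ⊆ N → K = ⊥ := by
  have hF := hasFDerivAt_extChartAt_sq (d := d) (G := G)
  set φ := extChartAt (𝓡 d) (1 : G) with hφ
  set x₀ := φ 1 with hx₀
  have hs : φ.symm x₀ = 1 := extChartAt_to_inv 1
  have hev : ∀ᶠ x in 𝓝 x₀, 3 / 2 * ‖x - x₀‖ ≤ ‖φ (φ.symm x * φ.symm x) - x₀‖ := by
    filter_upwards [hF.isLittleO.def (c := 1 / 2) (by norm_num)] with x hx
    rw [hs, mul_one] at hx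
    have h1 : ‖(2 : ℝ) • (x - x₀)‖ = 2 * ‖x - x₀‖ := by rw [norm_smul]; norm_num
    have h2 := norm_sub_norm_le ((2 : ℝ) • (x - x₀)) (φ (φ.symm x * φ.symm x) - x₀)
    rw [norm_sub_rev ((2 : ℝ) • (x - x₀))] at h2
    change ‖φ (φ.symm x * φ.symm x) - x₀ - (2 : ℝ) • (x - x₀)‖ ≤ 1 / 2 * ‖x - x₀‖ at hx
    linarith
  have hball : ∀ᶠ x in 𝓝 x₀, ‖x - x₀‖ < 1 := by
    filter_upwards [Metric.ball_mem_nhds x₀ one_pos] with x hx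
    rwa [mem_ball_iff_norm] at hx
  have hcont : ContinuousAt φ 1 := continuousAt_extChartAt 1
  refine ⟨_, inter_mem (hcont.preimage_mem_nhds (inter_mem hev hball))
    (extChartAt_source_mem_nhds (I := 𝓡 d) (1 : G)), fun K hK => ?_⟩
  refine (Subgroup.eq_bot_iff_forall K).2 fun g hg => ?_
  have hgrow : ∀ n : ℕ, (3 / 2 : ℝ) ^ n * ‖φ g - x₀‖ ≤ ‖φ (g ^ 2 ^ n) - x₀‖ := fun n => by
    induction n with
    | zero => simp
    | succ n ih =>
      have hk := hK (K.pow_mem hg (2 ^ n))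
      have h1 : 3 / 2 * ‖φ (g ^ 2 ^ n) - x₀‖ ≤ _ := hk.1.1
      rw [φ.left_inv hk.2, ← pow_two, ← pow_mul, ← pow_succ] at h1
      refine le_trans ?_ h1
      rw [pow_succ]
      linarith
  have hzero : ‖φ g - x₀‖ = 0 := by
    by_contra hne
    have hpos : 0 < ‖φ g - x₀‖ := lt_of_le_of_ne (norm_nonneg _) (Ne.symm hne)
    obtain ⟨n, hn⟩ := pow_unbounded_of_one_lt (‖φ g - x₀‖)⁻¹ (by norm_num : (1 : ℝ) < 3 / 2)
    have h1 : ‖φ (g ^ 2 ^ n) - x₀‖ < 1 := (hK (K.pow_mem hg (2 ^ n))).1.2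
    have h2 := hgrow n
    have h3 : 1 < (3 / 2 : ℝ) ^ n * ‖φ g - x₀‖ := by
      rw [← inv_mul_cancel₀ hne]
      exact mul_lt_mul_of_pos_right hn hpos
    linarith
  exact φ.injOn (hK hg).2 (hK K.one_mem).2 (sub_eq_zero.1 (norm_eq_zero.1 hzero))

end NoSmallSubgroups

/-- Compact Lie groups have faithful representations. -/
theorem exists_injective_orthRep (G : Type) [Group G] [TopologicalSpace G]
    [hG : IsCompactLieGroup G] : ∃ V : OrthRep G, Function.Injective V.ρ := by
  obtain ⟨d, _, _⟩ := hG.exists_lieGroup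
  have := hG.compactSpace
  have := hG.t2Space
  have := IsCompactLieGroup.isTopologicalGroup G
  obtain ⟨N, hN, hK⟩ := exists_nhds_one_subgroup_eq_bot (d := d) (G := G)
  obtain ⟨f, hf0, hf1, -⟩ := exists_continuous_zero_one_of_isClosed
    (isClosed_singleton (x := (1 : G))) (isOpen_interior (s := N)).isClosed_compl
    (Set.disjoint_singleton_left.2 fun h => h (mem_interior_iff_mem_nhds.2 hN))
  borelize G
  obtain ⟨V, u, v, hV⟩ := exists_matrixCoefficient_near f (ε := 1 / 2) (by norm_num)
  refine ⟨V, (MonoidHom.ker_eq_bot_iff _).1 (hK _ fun g hg => ?_)⟩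
  by_contra hgN
  have h1 := hV 1
  have h2 := hV g
  rw [MonoidHom.mem_ker.1 hg, hf1 (fun h => hgN (interior_subset h))] at h2
  rw [map_one V.ρ, hf0 rfl] at h1
  simp only [Pi.zero_apply, Pi.one_apply] at h1 h2
  rw [abs_lt] at h1 h2
  linarith [h1.1, h2.2]

/-! ### Compact groups of invertible elements of a finite-dimensional algebra are Lie groups -/

section ClosedSubgroup

open Filter Topology

section LocalStructure

open NormedSpace

section Exp

variable {A : Type} [NormedRing A] [NormedAlgebra ℝ A] [CompleteSpace A]

theorem exp_nsmul_real (n : ℕ) (X : A) : exp (n • X) = exp X ^ n :=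
  let := NormedAlgebra.restrictScalars ℚ ℝ A
  exp_nsmul n X

theorem exp_neg_mul_self (X : A) : exp (-X) * exp X = 1 := by
  let := NormedAlgebra.restrictScalars ℚ ℝ A
  rw [← exp_add_of_commute (Commute.refl X).neg_left, neg_add_cancel, exp_zero]

theorem contDiff_exp_real : ContDiff ℝ ω (exp : A → A) :=
  contDiff_iff_contDiffAt.2 fun X => (exp_analytic (𝕂 := ℝ) X).contDiffAt

/-- A logarithm near `1`. -/
theorem exists_log : ∃ L : A → A, L 1 = 0 ∧ HasFDerivAt L (ContinuousLinearMap.id ℝ A) 1 ∧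
    ∀ᶠ a in 𝓝 (1 : A), exp (L a) = a := by
  have h : HasStrictFDerivAt (exp : A → A)
      ((ContinuousLinearEquiv.refl ℝ A : A ≃L[ℝ] A) : A →L[ℝ] A) 0 :=
    hasStrictFDerivAt_exp_zero
  refine ⟨h.localInverse _ _ _, ?_, ?_, ?_⟩
  · have := h.localInverse_apply_image
    rwa [exp_zero] at this
  · have := h.to_localInverse.hasFDerivAt
    rwa [exp_zero] at this
  · have := h.eventually_right_inverse
    rwa [exp_zero] at this

end Exp

variable {A : Type} [NormedRing A] [NormedAlgebra ℝ A] [CompleteSpace A] {K : Submonoid A}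

theorem exp_neg_mem (hinv : ∀ a ∈ K, ∃ b ∈ K, a * b = 1) {X : A} (h : exp X ∈ K) :
    exp (-X) ∈ K := by
  obtain ⟨b, hb, hab⟩ := hinv _ h
  rwa [left_inv_eq_right_inv (exp_neg_mul_self X) hab]

/-- If `exp X ∈ K` for `X` tending to `0` in the direction `Z`, then `exp (t Z) ∈ K` for all `t`:
the powers of the `exp X` approximate the `exp (t Z)`. -/
theorem exp_smul_mem_of_tendsto (hK : IsClosed (K : Set A)) (hinv : ∀ a ∈ K, ∃ b ∈ K, a * b = 1)
    {α : Type} {l : Filter α} [l.NeBot] {X : α → A} {ε : α → ℝ} {Z : A}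
    (hε : Tendsto ε l (𝓝[>] 0)) (hX : ∀ᶠ a in l, exp (X a) ∈ K)
    (hZ : Tendsto (fun a => (ε a)⁻¹ • X a) l (𝓝 Z)) (t : ℝ) : exp (t • Z) ∈ K := by
  have key : ∀ t : ℝ, 0 ≤ t → exp (t • Z) ∈ K := fun t ht => by
    have h1 := (tendsto_nat_floor_mul_div_atTop ht).comp (tendsto_inv_nhdsGT_zero.comp hε)
    have h2 := (contDiff_exp_real.continuous.tendsto (t • Z)).comp (h1.smul hZ)
    refine hK.mem_of_tendsto h2 ?_
    filter_upwards [hX, hε self_mem_nhdsWithin] with a ha hpos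
    have hne : ε a ≠ 0 := ne_of_gt hpos
    have h3 : ((fun x => (⌊t * x⌋₊ : ℝ) / x) ∘ (fun x => x⁻¹) ∘ ε) a • (ε a)⁻¹ • X a =
        ⌊t * (ε a)⁻¹⌋₊ • X a := by
      simp only [Function.comp_apply]
      rw [smul_smul, div_mul_cancel₀ _ (inv_ne_zero hne), Nat.cast_smul_eq_nsmul]
    change exp (((fun x => (⌊t * x⌋₊ : ℝ) / x) ∘ (fun x => x⁻¹) ∘ ε) a • (ε a)⁻¹ • X a) ∈ K
    rw [h3, exp_nsmul_real]
    exact K.pow_mem ha _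
  rcases le_total 0 t with ht | ht
  · exact key t ht
  · have := exp_neg_mem hinv (key (-t) (neg_nonneg.2 ht))
    rwa [neg_smul, neg_neg] at this

/-- The Lie algebra of a closed group `K` of invertible elements of `A`. -/
def lieAlgebra (hK : IsClosed (K : Set A)) (hinv : ∀ a ∈ K, ∃ b ∈ K, a * b = 1) :
    Submodule ℝ A where
  carrier := {X | ∀ t : ℝ, exp (t • X) ∈ K}
  zero_mem' t := by
    rw [smul_zero, exp_zero]
    exact K.one_mem
  smul_mem' c X hX t := by
    rw [smul_smul]
    exact hX _
  add_mem' := by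
    intro X Y hX hY
    obtain ⟨L, hL1, hL, hexp⟩ := exists_log (A := A)
    have h1 : ∀ Z : A, HasDerivAt (fun s : ℝ => exp (s • Z)) Z 0 := fun Z => by
      have := hasDerivAt_exp_smul_const (𝕂 := ℝ) Z 0
      rwa [zero_smul, exp_zero, one_mul] at this
    have h2 : HasDerivAt (fun s : ℝ => exp (s • X) * exp (s • Y)) (X + Y) 0 := by
      have := (h1 X).mul (h1 Y)
      rw [zero_smul, zero_smul, exp_zero, mul_one, one_mul] at this
      exact this
    have h20 : exp ((0 : ℝ) • X) * exp ((0 : ℝ) • Y) = 1 := by simp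
    have h3 : HasDerivAt (fun s : ℝ => L (exp (s • X) * exp (s • Y))) (X + Y) 0 :=
      HasFDerivAt.comp_hasDerivAt (l := L) (l' := ContinuousLinearMap.id ℝ A) (0 : ℝ)
        (by rw [h20]; exact hL) h2
    have h4 := (hasDerivAt_iff_tendsto_slope.1 h3).mono_left
      (nhdsWithin_mono 0 fun s (hs : s ∈ Set.Ioi (0 : ℝ)) => ne_of_gt hs)
    refine exp_smul_mem_of_tendsto hK hinv (l := 𝓝[>] (0 : ℝ)) (ε := id)
      (X := fun s => L (exp (s • X) * exp (s • Y))) tendsto_id ?_ ?_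
    · have h5 : Tendsto (fun s : ℝ => exp (s • X) * exp (s • Y)) (𝓝[>] 0) (𝓝 1) := by
        rw [← h20]
        exact h2.continuousAt.tendsto.mono_left nhdsWithin_le_nhds
      filter_upwards [h5.eventually hexp] with s hs
      rw [hs]
      exact K.mul_mem (hX s) (hY s)
    · refine h4.congr fun s => ?_
      rw [slope_def_module, h20, hL1, sub_zero, sub_zero]
      rfl

/-- Near `1`, a closed group `K` of invertible elements of a finite-dimensional algebra is the image
under the exponential of a neighbourhood of `0` in its Lie algebra. -/
theorem exists_local_parametrization [FiniteDimensional ℝ A] (hK : IsClosed (K : Set A))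
    (hinv : ∀ a ∈ K, ∃ b ∈ K, a * b = 1) :
    ∃ (d : ℕ) (e : EuclideanSpace ℝ (Fin d) → A) (r : A → EuclideanSpace ℝ (Fin d)),
      ContDiff ℝ ω e ∧ (∀ X, e X ∈ K) ∧ e 0 = 1 ∧ ContDiffAt ℝ ω r 1 ∧
      (∀ᶠ X in 𝓝 0, r (e X) = X) ∧ ∀ᶠ a in 𝓝 1, a ∈ K → e (r a) = a := by
  let 𝔥 := lieAlgebra hK hinv
  obtain ⟨𝔪, hm⟩ := 𝔥.exists_isCompl
  let d := Module.finrank ℝ 𝔥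
  let j₀ : EuclideanSpace ℝ (Fin d) ≃L[ℝ] 𝔥 :=
    ContinuousLinearEquiv.ofFinrankEq (by simp [d])
  let j : EuclideanSpace ℝ (Fin d) →L[ℝ] A := 𝔥.subtypeL.comp (j₀ : _ →L[ℝ] 𝔥)
  let f' : (EuclideanSpace ℝ (Fin d) × 𝔪) ≃L[ℝ] A :=
    (j₀.prodCongr (ContinuousLinearEquiv.refl ℝ 𝔪)).trans
      (Submodule.prodEquivOfIsCompl 𝔥 𝔪 hm).toContinuousLinearEquiv
  have hf'_apply : ∀ p, f' p = j p.1 + p.2 := fun p => by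
    simp [f', j]
  let ψ : EuclideanSpace ℝ (Fin d) × 𝔪 → A := fun p => exp (j p.1) * exp (p.2 : A)
  have hψ : ContDiff ℝ ω ψ := by
    refine ContDiff.mul (contDiff_exp_real.comp (j.contDiff.comp contDiff_fst))
      (contDiff_exp_real.comp (𝔪.subtypeL.contDiff.comp contDiff_snd))
  have hψ0 : ψ 0 = 1 := by simp [ψ]
  have hψ' : HasFDerivAt ψ (f' : _ →L[ℝ] A) 0 := by
    have h0 : HasFDerivAt (exp : A → A) (1 : A →L[ℝ] A) 0 := hasFDerivAt_exp_zero
    have h1 : HasFDerivAt (fun p : EuclideanSpace ℝ (Fin d) × 𝔪 => exp (j p.1))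
        ((1 : A →L[ℝ] A).comp (j.comp (ContinuousLinearMap.fst ℝ _ _))) 0 :=
      HasFDerivAt.comp 0 (g := exp) (by simpa using h0)
        (j.comp (ContinuousLinearMap.fst ℝ (EuclideanSpace ℝ (Fin d)) 𝔪)).hasFDerivAt
    have h2 : HasFDerivAt (fun p : EuclideanSpace ℝ (Fin d) × 𝔪 => exp (p.2 : A))
        ((1 : A →L[ℝ] A).comp (𝔪.subtypeL.comp (ContinuousLinearMap.snd ℝ _ _))) 0 :=
      HasFDerivAt.comp 0 (g := exp) (by simpa using h0)
        (𝔪.subtypeL.comp (ContinuousLinearMap.snd ℝ (EuclideanSpace ℝ (Fin d)) 𝔪)).hasFDerivAt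
    refine (h1.mul' h2).congr_fderiv (ContinuousLinearMap.ext fun p => ?_)
    rw [ContinuousLinearEquiv.coe_coe, hf'_apply]
    simp [add_comm]
  have hω : (ω : ℕ∞ω) ≠ 0 := by simp
  have hs := hψ.contDiffAt.hasStrictFDerivAt' hψ' hω
  let Φ := hψ.contDiffAt.localInverse hψ' hω
  have hΦ1 : Φ 1 = 0 := by
    rw [← hψ0]
    exact hψ.contDiffAt.localInverse_apply_image hψ' hω
  have hΦ : ContDiffAt ℝ ω Φ 1 := by
    rw [← hψ0]
    exact hψ.contDiffAt.to_localInverse hψ' hω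
  have hΦψ : ∀ᶠ p in 𝓝 0, Φ (ψ p) = p := hs.eventually_left_inverse
  have hψΦ : ∀ᶠ a in 𝓝 1, ψ (Φ a) = a := by
    rw [← hψ0]
    exact hs.eventually_right_inverse
  have hjK : ∀ X, exp (j X) ∈ K := fun X => by
    have := (j₀ X).2 1
    rwa [one_smul] at this
  refine ⟨d, fun X => exp (j X), fun a => (Φ a).1, contDiff_exp_real.comp j.contDiff, hjK, by simp,
    contDiff_fst.contDiffAt.comp 1 hΦ, ?_, ?_⟩
  · have h1 : Tendsto (fun X : EuclideanSpace ℝ (Fin d) => (X, (0 : 𝔪))) (𝓝 0) (𝓝 0) :=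
      (Continuous.prodMk_left (0 : 𝔪)).tendsto 0
    filter_upwards [h1.eventually hΦψ] with X hX
    have : ψ (X, 0) = exp (j X) := by simp [ψ]
    rw [← this, hX]
  · by_contra hcon
    -- Points of `K` off the image have nontrivial, arbitrarily small `𝔪`-components `Y`; then
    -- `exp Y ∈ K`, and a limit direction of the `Y` lies in `𝔥 ∩ 𝔪`.
    have hfreq : ∃ᶠ a in 𝓝 (1 : A), ¬(a ∈ K → exp (j (Φ a).1) = a) :=
      not_eventually.1 hcon
    let S : Set A := {a | ¬(a ∈ K → exp (j (Φ a).1) = a)}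
    have : (𝓝 (1 : A) ⊓ 𝓟 S).NeBot := frequently_mem_iff_neBot.1 hfreq
    let l := Ultrafilter.of (𝓝 (1 : A) ⊓ 𝓟 S)
    have hl : (l : Filter A) ≤ 𝓝 1 := (Ultrafilter.of_le _).trans inf_le_left
    have hS : ∀ᶠ a in (l : Filter A), a ∈ S :=
      ((Ultrafilter.of_le _).trans inf_le_right) (mem_principal_self S)
    have hev : ∀ᶠ a in (l : Filter A), exp ((Φ a).2 : A) ∈ K ∧ (Φ a).2 ≠ 0 := by
      filter_upwards [hS, hl hψΦ] with a ha hψa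
      obtain ⟨haK, hne⟩ := Classical.not_imp.1 ha
      have hψa' : exp (j (Φ a).1) * exp ((Φ a).2 : A) = a := hψa
      constructor
      · have : exp ((Φ a).2 : A) = exp (-j (Φ a).1) * a := by
          rw [← one_mul (exp _), ← exp_neg_mul_self (j (Φ a).1), mul_assoc, hψa']
        rw [this]
        exact K.mul_mem (exp_neg_mem hinv (hjK _)) haK
      · intro h0
        rw [h0, ZeroMemClass.coe_zero, exp_zero, mul_one] at hψa'
        exact hne hψa'
    have hY : Tendsto (fun a => (Φ a).2) l (𝓝 0) := by
      have := (continuous_snd.continuousAt.comp hΦ.continuousAt).tendsto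
      rw [Function.comp_apply, hΦ1] at this
      exact this.mono_left hl
    have hε : Tendsto (fun a => ‖(Φ a).2‖) l (𝓝[>] 0) := by
      refine tendsto_nhdsWithin_iff.2 ⟨by simpa using hY.norm, ?_⟩
      filter_upwards [hev] with a ha
      exact norm_pos_iff.2 ha.2
    obtain ⟨Z, hZ, hlim⟩ := (isCompact_sphere (0 : 𝔪) 1).ultrafilter_le_nhds
      (l.map fun a => ‖(Φ a).2‖⁻¹ • (Φ a).2) (by
        rw [Ultrafilter.coe_map, le_principal_iff, mem_map]
        filter_upwards [hev] with a ha
        rw [Set.mem_preimage, mem_sphere_zero_iff_norm, norm_smul, norm_inv, norm_norm,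
          inv_mul_cancel₀ (norm_ne_zero_iff.2 ha.2)])
    have hlim' : Tendsto (fun a => ‖(Φ a).2‖⁻¹ • ((Φ a).2 : A)) l (𝓝 (Z : A)) :=
      (continuous_subtype_val.tendsto Z).comp hlim
    have hZh : (Z : A) ∈ 𝔥 :=
      exp_smul_mem_of_tendsto hK hinv hε (hev.mono fun a ha => ha.1) hlim'
    have hZ0 : (Z : A) = 0 := (Submodule.disjoint_def.1 hm.disjoint) _ hZh Z.2
    have : Z = 0 := Subtype.ext hZ0
    rw [this] at hZ
    simp at hZ

end LocalStructure

/-- A smooth parametrization of a neighbourhood of the identity of a group `H` of invertible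
elements of the algebra `A`: the map `γ` is inverted by a smooth map `r` defined near the identity
of `A`. -/
structure LocalParametrization {H : Type} [Group H] [TopologicalSpace H] {A : Type} [NormedRing A]
    [NormedAlgebra ℝ A] (ι : H →* A) (d : ℕ) where
  γ : EuclideanSpace ℝ (Fin d) → H
  r : A → EuclideanSpace ℝ (Fin d)
  U : Set A
  B : Set (EuclideanSpace ℝ (Fin d))
  isOpen_U : IsOpen U
  isOpen_B : IsOpen B
  one_mem : 1 ∈ U
  r_one_mem : r 1 ∈ B
  continuous_ι : Continuous ι
  continuous_γ : Continuous γ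
  contDiff_γ : ContDiff ℝ ω fun X => ι (γ X)
  contDiffOn_r : ContDiffOn ℝ ω r U
  r_γ : ∀ X ∈ B, r (ι (γ X)) = X
  γ_r : ∀ h, ι h ∈ U → γ (r (ι h)) = h

namespace LocalParametrization

variable {H : Type} [Group H] [TopologicalSpace H] {A : Type} [NormedRing A] [NormedAlgebra ℝ A]
  {ι : H →* A} {d : ℕ} (c : LocalParametrization ι d)

/-- The chart around the identity. -/
def chartOne : OpenPartialHomeomorph H (EuclideanSpace ℝ (Fin d)) where
  toFun h := c.r (ι h)
  invFun := c.γ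
  source := {h | ι h ∈ c.U ∧ c.r (ι h) ∈ c.B}
  target := {X | X ∈ c.B ∧ ι (c.γ X) ∈ c.U}
  map_source' h hh := ⟨hh.2, by rw [c.γ_r h hh.1]; exact hh.1⟩
  map_target' X hX := ⟨hX.2, by rw [c.r_γ X hX.1]; exact hX.1⟩
  left_inv' h hh := c.γ_r h hh.1
  right_inv' X hX := c.r_γ X hX.1
  open_source := (c.contDiffOn_r.continuousOn.comp c.continuous_ι.continuousOn
    (Set.mapsTo_preimage ι c.U)).isOpen_inter_preimage
      (c.isOpen_U.preimage c.continuous_ι) c.isOpen_B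
  open_target := c.isOpen_B.inter (c.isOpen_U.preimage (c.continuous_ι.comp c.continuous_γ))
  continuousOn_toFun := c.contDiffOn_r.continuousOn.comp c.continuous_ι.continuousOn
    fun _ hh => hh.1
  continuousOn_invFun := c.continuous_γ.continuousOn

variable [IsTopologicalGroup H]

/-- The chart around `h`, obtained by translation from the chart around the identity. -/
def chart (h : H) : OpenPartialHomeomorph H (EuclideanSpace ℝ (Fin d)) :=
  (Homeomorph.mulLeft h⁻¹).transOpenPartialHomeomorph c.chartOne

theorem chart_apply (h k : H) : c.chart h k = c.r (ι (h⁻¹ * k)) := rfl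

theorem chart_symm_apply (h : H) (X : EuclideanSpace ℝ (Fin d)) :
    (c.chart h).symm X = h * c.γ X := by
  change (h⁻¹)⁻¹ * c.γ X = _
  rw [inv_inv]

theorem mem_chart_source {h k : H} :
    k ∈ (c.chart h).source ↔ ι (h⁻¹ * k) ∈ c.U ∧ c.r (ι (h⁻¹ * k)) ∈ c.B := Iff.rfl

/-- The atlas of translates of the chart around the identity. -/
@[reducible]
def chartedSpace : ChartedSpace (EuclideanSpace ℝ (Fin d)) H where
  atlas := Set.range c.chart
  chartAt := c.chart
  mem_chart_source h := by
    rw [mem_chart_source, inv_mul_cancel, map_one]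
    exact ⟨c.one_mem, c.r_one_mem⟩
  chart_mem_atlas h := ⟨h, rfl⟩

/-- The maps `γ` and `r` being smooth, the translated charts make `H` a Lie group: the inclusion
into `A` is smooth, and a continuous map to `H` is smooth if it is so as a map to `A`. -/
theorem lieGroup [CompleteSpace A] :
    @LieGroup ℝ _ _ _ _ _ _ (𝓡 d) ω H _ _ c.chartedSpace := by
  let := c.chartedSpace
  have hman : IsManifold (𝓡 d) ω H := by
    refine isManifold_of_contDiffOn _ _ _ fun e e' he he' => ?_
    obtain ⟨h, rfl⟩ := he
    obtain ⟨k, rfl⟩ := he'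
    have h1 : ContDiff ℝ ω fun X => ι (k⁻¹ * h) * ι (c.γ X) := contDiff_const.mul c.contDiff_γ
    refine (c.contDiffOn_r.comp h1.contDiffOn fun X hX => ?_).congr fun X hX => ?_
    · have h2 : (c.chart h).symm X ∈ (c.chart k).source := hX.1.2
      rw [chart_symm_apply, mem_chart_source, ← mul_assoc, map_mul] at h2
      exact h2.1
    · change c.chart k ((c.chart h).symm X) = _
      rw [chart_symm_apply, chart_apply, ← mul_assoc, map_mul]
      rfl
  have hι : ContMDiff (𝓡 d) 𝓘(ℝ, A) ω ι := fun h => by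
    refine contMDiffAt_iff.2 ⟨c.continuous_ι.continuousAt, ?_⟩
    have h1 : ContDiff ℝ ω fun X => ι h * ι (c.γ X) := contDiff_const.mul c.contDiff_γ
    refine h1.contDiffWithinAt.congr_of_mem (fun X _ => ?_) (Set.mem_range_self _)
    change ι ((c.chart h).symm X) = _
    rw [chart_symm_apply, map_mul]
  -- Near `h₀`, the chart around `h₀` is the restriction of a smooth function on `A`.
  have hr : ∀ h₀ : H, ContDiffAt ℝ ω (fun a => c.r (ι h₀⁻¹ * a)) (ι h₀) := fun h₀ => by
    refine ContDiffAt.comp (ι h₀) (g := c.r) ?_ (contDiff_const.mul contDiff_id).contDiffAt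
    rw [← map_mul, inv_mul_cancel, map_one]
    exact c.contDiffOn_r.contDiffAt (c.isOpen_U.mem_nhds c.one_mem)
  have hr' : ∀ h₀ : H, ContMDiffAt 𝓘(ℝ, A) (𝓡 d) ω (fun a => c.r (ι h₀⁻¹ * a)) (ι h₀) :=
    fun h₀ => (hr h₀).contMDiffAt
  refine @LieGroup.mk _ _ _ _ _ _ _ _ _ _ _ _ _ (@ContMDiffMul.mk _ _ _ _ _ _ _ _ _ _ _ _ _ hman
    fun p => ?_) fun h => ?_
  · refine contMDiffAt_iff_target.2 ⟨continuous_mul.continuousAt, ?_⟩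
    have h1 : ContMDiffAt ((𝓡 d).prod (𝓡 d)) 𝓘(ℝ, A) ω (fun q : H × H => ι q.1 * ι q.2) p :=
      ContMDiffAt.comp p (g := fun a : A × A => a.1 * a.2) contDiff_mul.contDiffAt.contMDiffAt
        (((hι p.1).comp p contMDiffAt_fst).prodMk_space ((hι p.2).comp p contMDiffAt_snd))
    have h2 := ContMDiffAt.comp p (g := fun a => c.r (ι (p.1 * p.2)⁻¹ * a))
      (by rw [← map_mul]; exact hr' (p.1 * p.2)) h1
    refine h2.congr_of_eventuallyEq (Eventually.of_forall fun q => ?_)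
    change c.r (ι ((p.1 * p.2)⁻¹ * (q.1 * q.2))) = c.r (ι (p.1 * p.2)⁻¹ * (ι q.1 * ι q.2))
    rw [map_mul, map_mul ι q.1]
  · refine contMDiffAt_iff_target.2 ⟨continuous_inv.continuousAt, ?_⟩
    have hinv : ∀ k : H, Ring.inverse (ι k) = ι k⁻¹ := fun k => by
      have := Ring.inverse_unit (ι.toHomUnits k)
      rw [← map_inv] at this
      exact this
    have h1 : ContMDiffAt 𝓘(ℝ, A) 𝓘(ℝ, A) ω Ring.inverse (ι h) :=
      (contDiffAt_ringInverse ℝ (ι.toHomUnits h)).contMDiffAt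
    have h2 := ContMDiffAt.comp h (g := fun a => c.r (ι (h⁻¹)⁻¹ * a))
      (by rw [Function.comp_apply, hinv]; exact hr' h⁻¹) (h1.comp h (hι h))
    refine h2.congr_of_eventuallyEq (Eventually.of_forall fun k => ?_)
    change c.r (ι ((h⁻¹)⁻¹ * k⁻¹)) = c.r (ι (h⁻¹)⁻¹ * Ring.inverse (ι k))
    rw [map_mul, hinv]

end LocalParametrization

/-- Von Neumann's theorem: a compact group which embeds into a finite-dimensional algebra is a Lie
group. -/
theorem isCompactLieGroup_of_injective {H : Type} [Group H] [TopologicalSpace H]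
    [IsTopologicalGroup H] [hc : CompactSpace H] {A : Type} [NormedRing A]
    [NormedAlgebra ℝ A] [FiniteDimensional ℝ A] (ι : H →* A) (hι : Continuous ι)
    (hinj : Function.Injective ι) : IsCompactLieGroup H := by
  have : CompleteSpace A := FiniteDimensional.complete ℝ A
  have hce := hι.isClosedEmbedding hinj
  obtain ⟨d, e, r, he, heK, he0, hr, hre, her⟩ := exists_local_parametrization
    (K := MonoidHom.mrange ι) hce.isClosed_range (by
      rintro _ ⟨h, rfl⟩
      exact ⟨_, ⟨h⁻¹, rfl⟩, by rw [← map_mul, mul_inv_cancel, map_one]⟩)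
  choose γ hγ using heK
  have hr1 : r 1 = 0 := by
    rw [← he0]
    exact hre.self_of_nhds
  obtain ⟨U, hUsub, hUo, hU1⟩ := eventually_nhds_iff.1
    ((hr.eventually (by simp)).and her)
  obtain ⟨B, hBsub, hBo, hB0⟩ := eventually_nhds_iff.1 hre
  let c : LocalParametrization ι d :=
    { γ := γ
      r := r
      U := U
      B := B
      isOpen_U := hUo
      isOpen_B := hBo
      one_mem := hU1
      r_one_mem := by rwa [hr1]
      continuous_ι := hι
      continuous_γ := hce.isInducing.continuous_iff.2 (by
        have : ι ∘ γ = e := funext hγ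
        rw [this]
        exact he.continuous)
      contDiff_γ := by
        simp only [hγ]
        exact he
      contDiffOn_r := fun a ha => (hUsub a ha).1.contDiffWithinAt
      r_γ := fun X hX => by rw [hγ, hBsub X hX]
      γ_r := fun h hh => hinj (by rw [hγ, (hUsub _ hh).2 ⟨h, rfl⟩]) }
  let := c.chartedSpace
  have := c.lieGroup
  exact ⟨hc, T2Space.of_injective_continuous hinj hι, d, c.chartedSpace, inferInstance⟩

/-- Cartan's theorem: closed subgroups of compact Lie groups are compact Lie groups. -/
theorem isCompactLieGroup_of_isClosed {G : Type} [Group G] [TopologicalSpace G]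
    [hG : IsCompactLieGroup G] (H : Subgroup G) (hH : IsClosed (H : Set G)) :
    IsCompactLieGroup H := by
  have := hG.compactSpace
  have := IsCompactLieGroup.isTopologicalGroup G
  have : CompactSpace H := isCompact_iff_compactSpace.1 hH.isCompact
  obtain ⟨V, hV⟩ := exists_injective_orthRep G
  let ι : H →* (V.space →L[ℝ] V.space) :=
    { toFun := fun h => ((V.ρ h).toContinuousLinearEquiv : V.space →L[ℝ] V.space)
      map_one' := by
        ext v
        change V.ρ 1 v = v
        rw [map_one]
        rfl
      map_mul' := fun h k => by
        ext v
        change V.ρ (h * k) v = V.ρ h (V.ρ k v)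
        rw [map_mul]
        rfl }
  refine isCompactLieGroup_of_injective ι (continuous_clm_apply.2 fun v =>
    (V.continuous_apply v).comp continuous_subtype_val) fun h k hhk => ?_
  exact Subtype.ext (hV (LinearIsometryEquiv.ext fun v => DFunLike.congr_fun hhk v))

end ClosedSubgroup

/-! ### The transfer system determines the admissible graph subgroups -/

section Orbits

variable {G : Type} [Group G] {N : ℕ}

/-- A finite `G`-set is the disjoint union of the cosets of the stabilizers of representatives of
its orbits. -/
theorem exists_sigma_cosets (φ : G →* Equiv.Perm (Fin N)) :
    ∃ (k : ℕ) (x : Fin k → Fin N) (K : Fin k → Subgroup G) (n : Fin k → ℕ)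
      (a : ∀ i, G ⧸ K i ≃ Fin (n i)) (e : (Σ i, Fin (n i)) ≃ Fin N),
      (∀ i g, g ∈ K i ↔ φ g (x i) = x i) ∧
      ∀ g i j, φ g (e ⟨i, j⟩) = e ⟨i, cosetPerm (a i) g j⟩ := by
  let := MulAction.compHom (Fin N) φ
  let Ω := Quotient (MulAction.orbitRel G (Fin N))
  let b : Ω ≃ Fin (Nat.card Ω) := Finite.equivFin Ω
  let x : Fin (Nat.card Ω) → Fin N := fun i => (b.symm i).out
  have hfin : ∀ i, Finite (G ⧸ MulAction.stabilizer G (x i)) := fun i =>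
    Finite.of_injective _ (MulAction.injective_ofQuotientStabilizer G (x i))
  let a := fun i => Finite.equivFin (G ⧸ MulAction.stabilizer G (x i))
  let f : (Σ i, Fin (Nat.card (G ⧸ MulAction.stabilizer G (x i)))) → Fin N := fun p =>
    MulAction.ofQuotientStabilizer G (x p.1) ((a p.1).symm p.2)
  have hf : Function.Bijective f := by
    constructor
    · rintro ⟨i, p⟩ ⟨i', p'⟩ h
      have horb : ∀ q : Σ i, Fin (Nat.card (G ⧸ MulAction.stabilizer G (x i))),
          (Quotient.mk _ (f q) : Ω) = b.symm q.1 := fun q => by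
        conv_rhs => rw [← Quotient.out_eq (b.symm q.1)]
        exact Quotient.sound (MulAction.ofQuotientStabilizer_mem_orbit _ _ _)
      obtain rfl : i = i' := b.symm.injective ((horb ⟨i, p⟩).symm.trans (h ▸ horb ⟨i', p'⟩))
      exact congrArg (Sigma.mk i)
        ((a i).symm.injective (MulAction.injective_ofQuotientStabilizer G (x i) h))
    · intro y
      have h1 : (b.symm (b (Quotient.mk _ y))).out ∈ MulAction.orbit G y := by
        rw [Equiv.symm_apply_apply]
        exact Quotient.exact (Quotient.out_eq (Quotient.mk _ y : Ω))
      obtain ⟨g, hg⟩ := MulAction.mem_orbit_symm.1 h1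
      refine ⟨⟨b (Quotient.mk _ y), a _ (g : G ⧸ _)⟩, ?_⟩
      change MulAction.ofQuotientStabilizer G _ ((a _).symm (a _ _)) = y
      rw [Equiv.symm_apply_apply]
      exact hg
  refine ⟨_, x, fun i => MulAction.stabilizer G (x i), _, a, Equiv.ofBijective f hf,
    fun i g => MulAction.mem_stabilizer_iff, fun g i j => ?_⟩
  change g • MulAction.ofQuotientStabilizer G (x i) ((a i).symm j) =
    MulAction.ofQuotientStabilizer G (x i) ((a i).symm (cosetPerm (a i) g j))
  rw [← MulAction.ofQuotientStabilizer_smul]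
  obtain ⟨q, rfl⟩ := (a i).surjective j
  rw [cosetPerm_apply, Equiv.symm_apply_apply, Equiv.symm_apply_apply]

variable [TopologicalSpace G]

/-- Realizing an action amounts to realizing its orbits, which the transfer system records. -/
theorem fixedBy_of_transferSystem_le [IsCompactLieGroup G] {O P : NInfinityOperad}
    (h : transferSystem O ≤ transferSystem P) {φ : G →* Equiv.Perm (Fin N)}
    (hφ : ∀ i j, IsOpen {g | φ g i = j}) (hO : O.obj.FixedBy φ) : P.obj.FixedBy φ := by
  have := IsCompactLieGroup.isTopologicalGroup G
  obtain ⟨k, x, K, n, a, e, hK, he⟩ := exists_sigma_cosets φ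
  refine P.obj.fixedBy_sigma (P.property.nonempty k) e he fun i => ?_
  have hKo : IsOpen (K i : Set G) := by
    have : (K i : Set G) = {g | φ g (x i) = x i} := Set.ext fun g => hK i g
    rw [this]
    exact hφ _ _
  have hfin : Finite (G ⧸ K i) := Finite.of_equiv _ (a i).symm
  have hadm : O.obj.AdmissibleTransfer G (K i) := SymSeq.admissibleTransfer_iff.2
    ⟨(K i).isClosed_of_isOpen hKo, Subgroup.finiteIndex_of_finite_quotient, n i, a i,
      O.obj.fixedBy_orbit (O.property.nonempty 0) hφ hO (a i) (x i) (hK i)⟩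
  obtain ⟨hc, hf, m, c, hm⟩ := SymSeq.admissibleTransfer_iff.1 (h G (K i) hadm)
  refine P.obj.fixedBy_orbit (P.property.nonempty 0) (isOpen_cosetPerm hc c) hm (a i)
    (c ((1 : G) : G ⧸ K i)) fun g => ?_
  rw [cosetPerm_apply, c.injective.eq_iff, eq_comm]
  change _ ↔ ((1 : G) : G ⧸ K i) = ((g * 1 : G) : G ⧸ K i)
  rw [QuotientGroup.eq]
  simp

end Orbits

/-- A graph subgroup of `G × Σ_n` is the graph of a homomorphism to `Σ_n` on a closed subgroup `H`
of `G`. -/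
theorem IsGraphSubgroup.exists_hom {G : Type} [Group G] [TopologicalSpace G] {n : ℕ}
    {Γ : Subgroup (G × Equiv.Perm (Fin n))} (hΓ : IsGraphSubgroup Γ) :
    ∃ (H : Subgroup G) (φ : H →* Equiv.Perm (Fin n)), IsClosed (H : Set G) ∧
      (∀ i j, IsOpen {h | φ h i = j}) ∧ ∀ γ : G × Equiv.Perm (Fin n),
        γ ∈ Γ ↔ ∃ hγ : γ.1 ∈ H, φ ⟨γ.1, hγ⟩ = γ.2 := by
  let _ : TopologicalSpace (Equiv.Perm (Fin n)) := ⊥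
  have : DiscreteTopology (Equiv.Perm (Fin n)) := ⟨rfl⟩
  have hmap : IsClosedMap (Prod.fst : G × Equiv.Perm (Fin n) → G) := isClosedMap_fst_of_compactSpace
  let H : Subgroup G := Γ.map (MonoidHom.fst G _)
  have hex : ∀ h : H, ∃ σ, ((h : G), σ) ∈ Γ := by
    rintro ⟨_, ⟨γ, hγ, rfl⟩⟩
    exact ⟨γ.2, hγ⟩
  choose s hs using hex
  have huniq : ∀ (h : H) (σ : Equiv.Perm (Fin n)), ((h : G), σ) ∈ Γ → s h = σ := fun h σ hσ => by
    have h1 := Γ.mul_mem (Γ.inv_mem (hs h)) hσ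
    rw [Prod.inv_mk, Prod.mk_mul_mk, inv_mul_cancel] at h1
    exact inv_mul_eq_one.1 (hΓ.trivial _ h1)
  let φ : H →* Equiv.Perm (Fin n) := MonoidHom.mk' s fun h h' =>
    huniq _ _ (Γ.mul_mem (hs h) (hs h'))
  have hclosed : ∀ i j, IsClosed {h | φ h i = j} := fun i j => by
    have h1 : IsClosed ((Γ : Set (G × Equiv.Perm (Fin n))) ∩ {γ | γ.2 i = j}) :=
      hΓ.isClosed.inter ((isClosed_discrete {σ : Equiv.Perm (Fin n) | σ i = j}).preimage
        continuous_snd)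
    have h2 : {h | φ h i = j} = ((↑) : H → G) ⁻¹' (Prod.fst ''
        ((Γ : Set (G × Equiv.Perm (Fin n))) ∩ {γ | γ.2 i = j})) := by
      ext h
      constructor
      · intro hh
        exact ⟨(h, s h), ⟨hs h, hh⟩, rfl⟩
      · rintro ⟨⟨g, σ⟩, ⟨hγ, hij⟩, rfl⟩
        change s h i = j
        rw [huniq h σ hγ]
        exact hij
    rw [h2]
    exact (hmap _ h1).preimage continuous_subtype_val
  refine ⟨H, φ, ?_, fun i j => ?_, fun γ => ⟨fun hγ => ?_, ?_⟩⟩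
  · rw [Subgroup.coe_map]
    exact hmap _ hΓ.isClosed
  · have : {h | φ h i = j} = (⋃ j' : {j' // j' ≠ j}, {h | φ h i = j'})ᶜ := by
      ext h
      rw [Set.mem_compl_iff, Set.mem_iUnion, not_exists]
      exact ⟨fun hj j' hj' => j'.2 (hj'.symm.trans hj), fun hj => by_contra fun hne =>
        hj ⟨φ h i, hne⟩ rfl⟩
    rw [this]
    exact (isClosed_iUnion_of_finite fun j' : {j' // j' ≠ j} => hclosed i j').isOpen_compl
  · exact ⟨⟨γ, hγ, rfl⟩, huniq _ _ hγ⟩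
  · rintro ⟨hγ, h⟩
    have h1 := hs ⟨γ.1, hγ⟩
    rwa [show s ⟨γ.1, hγ⟩ = γ.2 from h] at h1

/-- A graph subgroup of `G × Σ_n` is the graph of an action of a closed subgroup `H` of `G`. Whether
it is admissible can be tested on `H`-representations, as these embed into restrictions of
`G`-representations; and over `H` the transfer system decides. -/
theorem admissibleLE_of_transferSystem_le {O P : NInfinityOperad}
    (h : transferSystem O ≤ transferSystem P) :
    O.obj.AdmissibleLE P.obj.toSymSeq := by
  rintro G _ _ hG n Γ ⟨hΓ, V, x, hx⟩
  have := hG.compactSpace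
  have := hG.t2Space
  have := IsCompactLieGroup.isTopologicalGroup G
  obtain ⟨H, φ, hH, hφ, hmem⟩ := hΓ.exists_hom
  have hHL := isCompactLieGroup_of_isClosed H hH
  have := hHL.compactSpace
  have hfix : O.obj.FixedBy φ := ⟨V.comap H.subtype continuous_subtype_val, x, fun k =>
    hx (k, φ k) ((hmem _).2 ⟨k.2, rfl⟩)⟩
  obtain ⟨W, y, hy⟩ := fixedBy_of_transferSystem_le h hφ hfix
  borelize ↥H
  obtain ⟨E, ⟨ψ⟩⟩ := W.exists_embedding_comap (θ := H.subtype) continuous_subtype_val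
    H.subtype_injective
  refine ⟨hΓ, E, P.obj.map ψ.toIsom y, fun γ hγ => ?_⟩
  obtain ⟨hγH, hγφ⟩ := (hmem γ).1 hγ
  rw [← hγφ]
  exact SymSeq.fixed_map ψ hy ⟨γ.1, hγH⟩

/-- The product of operads serves as a weak product, and its first projection is an equivalence when
the transfer system of the second factor is at least as large as that of the first. -/
theorem hasWeakProducts : HasWeakProducts equivalences transferFunctor := fun O P =>
  ⟨⟨O.obj.prod P.obj, O.property.prod P.property⟩, ⟨O.obj.fst P.obj⟩, ⟨O.obj.snd P.obj⟩,
    fun h => Operad.isEquivalence_fst P.property (admissibleLE_of_transferSystem_le h),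
    fun _ f g => ⟨⟨Operad.lift f.hom g.hom⟩, rfl, rfl⟩⟩

end GlobalOperads
end

theorem mainTheorem2 :
    Quiver.IsThin GlobalOperads.HoNInfinity ∧
    ∃ (T : GlobalOperads.NInfinityOperad ⥤ GlobalOperads.GlobalTransferSystem)
      (hT : GlobalOperads.equivalences.IsInvertedBy T),
      (∀ (O : GlobalOperads.NInfinityOperad) (H : Type) [Group H] [TopologicalSpace H]
        [GlobalOperads.IsCompactLieGroup H] (K : Subgroup H),
        (T.obj O).rel H K ↔ O.obj.toSymSeq.AdmissibleTransfer H K) ∧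
      (Localization.Construction.lift T hT).Full ∧
      (Localization.Construction.lift T hT).Faithful :=
  ⟨(GlobalOperads.thin_full_faithful_of_weakProducts GlobalOperads.isInvertedBy_transferFunctor
      GlobalOperads.hasWeakProducts).1,
    GlobalOperads.transferFunctor, GlobalOperads.isInvertedBy_transferFunctor,
    fun _ _ _ _ _ _ => Iff.rfl,
    (GlobalOperads.thin_full_faithful_of_weakProducts GlobalOperads.isInvertedBy_transferFunctor
      GlobalOperads.hasWeakProducts).2⟩
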